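/- Let $F$ be a formula in conjunctive normal form with $m\ge 1$ clauses and $n\ge 0$ variables; a clause is a set of literals. For an integer $k\ge 0$, a total ordering $<$ of the clauses and variables of $F$ together is called a $k$-interval ordering of $F$ if for every clause $C$ there are at most $k$ variables $x$ not appearing in $C$ such that (1) some variable $x'$ appearing in $C$ satisfies $x'<x<C$, or (2) $x$ appears in some clause $C'$ with $C'<C<x$. Theorem. There are an algorithm for #SAT and an algorithm for weighted MaxSAT which, given a CNF formula $F$ with $m\ge 1$ clauses and $n$ variables, a $k$-interval ordering of it and, for weighted MaxSAT, an integer weight for each clause, run in time $\mathcal{O}(m^3 4^k (m+n))$ and compute, respectively, the number of satisfying assignments of $F$, and an assignment that maximizes the total weight of the satisfied clauses together with that maximum. Here time is the number of steps of a random access machine whose registers and memory cells hold integers and which performs an addition, a subtraction, a memory access or a comparison with $0$ in one step (uniform cost). The algorithms are not given $k$: the bound holds for every $k$ for which the given ordering is a $k$-interval ordering, and the constant in it depends on none of $F$, the ordering, the weights, $m$, $n$, $k$. -/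

import Mathlib

namespace KInterval

/-! ### Random access machines, uniform cost -/

/-- Structured programs for a random access machine. The machine has registers, each named by a
constant of the program, and a memory that is accessed through addresses held in registers.
Registers and memory cells hold integers. The only arithmetic is addition and subtraction. -/
inductive Prog : Type
  /-- do nothing -/
  | skip : Prog
  /-- `R[r] := c` -/
  | const (r : ℕ) (c : ℤ) : Prog
  /-- `R[r] := R[a] + R[b]` -/
  | add (r a b : ℕ) : Prog
  /-- `R[r] := R[a] - R[b]` -/
  | sub (r a b : ℕ) : Prog
  /-- `R[r] := M[R[a]]` -/
  | load (r a : ℕ) : Prog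
  /-- `M[R[a]] := R[r]` -/
  | store (a r : ℕ) : Prog
  /-- first `p`, then `q` -/
  | seq (p q : Prog) : Prog
  /-- if `R[r] > 0` then `p` else `q` -/
  | ifPos (r : ℕ) (p q : Prog) : Prog
  /-- while `R[r] > 0` do `p` -/
  | whilePos (r : ℕ) (p : Prog) : Prog

/-- A configuration of the machine: contents of the registers and of the memory. -/
@[ext] structure State : Type where
  reg : ℕ → ℤ
  mem : ℤ → ℤ

/-- Assign the value `v` to register `r`. -/
def State.setReg (s : State) (r : ℕ) (v : ℤ) : State :=
  { s with reg := Function.update s.reg r v }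

/-- Write the value `v` to the memory cell with address `a`. -/
def State.setMem (s : State) (a v : ℤ) : State :=
  { s with mem := Function.update s.mem a v }

/-- `Run p s t s'`: the program `p`, started in `s`, halts in `s'` after exactly `t` steps.
Every elementary instruction and every evaluation of a test is one step. -/
inductive Run : Prog → State → ℕ → State → Prop
  | skip (s : State) : Run .skip s 1 s
  | const (s : State) (r : ℕ) (c : ℤ) : Run (.const r c) s 1 (s.setReg r c)
  | add (s : State) (r a b : ℕ) : Run (.add r a b) s 1 (s.setReg r (s.reg a + s.reg b))
  | sub (s : State) (r a b : ℕ) : Run (.sub r a b) s 1 (s.setReg r (s.reg a - s.reg b))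
  | load (s : State) (r a : ℕ) : Run (.load r a) s 1 (s.setReg r (s.mem (s.reg a)))
  | store (s : State) (a r : ℕ) : Run (.store a r) s 1 (s.setMem (s.reg a) (s.reg r))
  | seq {p q : Prog} {s s₁ s₂ : State} {t₁ t₂ : ℕ} :
      Run p s t₁ s₁ → Run q s₁ t₂ s₂ → Run (.seq p q) s (t₁ + t₂) s₂
  | ifTrue {r : ℕ} {p q : Prog} {s s' : State} {t : ℕ} :
      0 < s.reg r → Run p s t s' → Run (.ifPos r p q) s (t + 1) s'
  | ifFalse {r : ℕ} {p q : Prog} {s s' : State} {t : ℕ} :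
      ¬ 0 < s.reg r → Run q s t s' → Run (.ifPos r p q) s (t + 1) s'
  | whileTrue {r : ℕ} {p : Prog} {s s₁ s₂ : State} {t₁ t₂ : ℕ} :
      0 < s.reg r → Run p s t₁ s₁ → Run (.whilePos r p) s₁ t₂ s₂ →
        Run (.whilePos r p) s (t₁ + t₂ + 1) s₂
  | whileFalse {r : ℕ} {p : Prog} {s : State} :
      ¬ 0 < s.reg r → Run (.whilePos r p) s 1 s

/-- The initial configuration on an input word: the word stands in the memory cells
`0, 1, 2, …`; all other memory cells and all registers are `0`. -/
def initState (input : List ℤ) : State where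
  reg := fun _ => 0
  mem := fun a => if 0 ≤ a then input.getD a.toNat 0 else 0

/-! ### CNF formulas -/

/-- A CNF formula with `m` clauses and `n` variables. A literal is a variable together with its
sign (`true` for a positive literal). A clause is a set of literals, given by listing each of its
literals once, in any order. -/
structure CNF (m n : ℕ) : Type where
  clause : Fin m → List (Fin n × Bool)
  nodup : ∀ j, (clause j).Nodup

namespace CNF

variable {m n : ℕ}

/-- The variable `x` appears in clause `j`. -/
def Appears (F : CNF m n) (x : Fin n) (j : Fin m) : Prop :=
  ∃ b : Bool, (x, b) ∈ F.clause j

/-- The assignment `τ` satisfies clause `j`. -/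
def SatClause (F : CNF m n) (τ : Fin n → Bool) (j : Fin m) : Prop :=
  ∃ l ∈ F.clause j, τ l.1 = l.2

instance (F : CNF m n) (τ : Fin n → Bool) (j : Fin m) : Decidable (F.SatClause τ j) :=
  inferInstanceAs (Decidable (∃ l ∈ F.clause j, τ l.1 = l.2))

/-- The number of satisfying assignments. -/
def numSat (F : CNF m n) : ℕ :=
  (Finset.univ.filter fun τ : Fin n → Bool => ∀ j, F.SatClause τ j).card

/-- The total weight of the clauses satisfied by `τ`. -/
def satWeight (F : CNF m n) (w : Fin m → ℤ) (τ : Fin n → Bool) : ℤ :=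
  ∑ j ∈ Finset.univ.filter (fun j => F.SatClause τ j), w j

end CNF

/-! ### Orderings -/

/-- A total ordering of the `m` clauses and `n` variables, given by the position of each. -/
abbrev Ordering (m n : ℕ) : Type := (Fin m ⊕ Fin n) ≃ Fin (m + n)

/-- The variables `x` not appearing in clause `j` such that a variable `x'` appears in `j` with
`x' < x < j`, or `x` appears in a clause `j'` with `j' < j < x`. -/
def faults {m n : ℕ} (F : CNF m n) (π : Ordering m n) (j : Fin m) : Set (Fin n) :=
  {x | ¬ F.Appears x j ∧
    ((∃ x', F.Appears x' j ∧ π (.inr x') < π (.inr x) ∧ π (.inr x) < π (.inl j)) ∨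
     (∃ j', F.Appears x j' ∧ π (.inl j') < π (.inl j) ∧ π (.inl j) < π (.inr x)))}

/-- `π` is a `k`-interval ordering of `F`. -/
def IsKIntervalOrdering {m n : ℕ} (k : ℕ) (F : CNF m n) (π : Ordering m n) : Prop :=
  ∀ j, (faults F π j).ncard ≤ k

/-! ### Encoding of the input as a word -/

/-- Literals on the `i`-th variable (counted from `0`) are coded by `i + 1` and `-(i + 1)`. -/
def encodeLiteral {n : ℕ} (l : Fin n × Bool) : ℤ :=
  if l.2 then (l.1 : ℤ) + 1 else -((l.1 : ℤ) + 1)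

/-- In the ordering, the `i`-th variable is coded by `i + 1`, the `j`-th clause by `-(j + 1)`. -/
def encodeElement {m n : ℕ} : Fin m ⊕ Fin n → ℤ
  | .inl j => -((j : ℤ) + 1)
  | .inr i => (i : ℤ) + 1

/-- The word `m, n`, followed by the elements of the ordering from first to last, followed by
the clauses, each given as the list of its literals closed by a `0`. -/
def encode {m n : ℕ} (F : CNF m n) (π : Ordering m n) : List ℤ :=
  [(m : ℤ), (n : ℤ)]
    ++ List.ofFn (fun p : Fin (m + n) => encodeElement (π.symm p))
    ++ (List.ofFn fun j : Fin m => (F.clause j).map encodeLiteral ++ [0]).flatten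

/-- The same with the weights of the clauses inserted before the clauses. -/
def encodeWeighted {m n : ℕ} (F : CNF m n) (π : Ordering m n) (w : Fin m → ℤ) : List ℤ :=
  [(m : ℤ), (n : ℤ)]
    ++ List.ofFn (fun p : Fin (m + n) => encodeElement (π.symm p))
    ++ List.ofFn w
    ++ (List.ofFn fun j : Fin m => (F.clause j).map encodeLiteral ++ [0]).flatten

/-! ### Outputs -/

/-- The final configuration reports the number of satisfying assignments, in register `0`. -/
def OutputsCount {m n : ℕ} (F : CNF m n) (s : State) : Prop :=
  s.reg 0 = (F.numSat : ℤ)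

/-- The final configuration reports an assignment that maximizes the total weight of the
satisfied clauses (the value of variable `i`, as `1` or `0`, in memory cell `i`), and that maximum
(in register `0`). -/
def OutputsMax {m n : ℕ} (F : CNF m n) (w : Fin m → ℤ) (s : State) : Prop :=
  ∃ τ : Fin n → Bool,
    (∀ i : Fin n, s.mem (i : ℤ) = if τ i then 1 else 0) ∧
    s.reg 0 = F.satWeight w τ ∧
    ∀ τ' : Fin n → Bool, F.satWeight w τ' ≤ F.satWeight w τ

end KInterval

/-! Cut the ordering at a position `p`. What the part before the cut must know about the part after
it is captured by two sets: S₁, the later clauses already satisfied by a variable before the cut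
(`lset`), and S₂, the earlier clauses that are left to the variables after the cut, which is the
same notion for the reversed ordering. For each pair (S₁, S₂), consider the assignments of the
earlier variables that produce S₁. The tables record how many of them satisfy every earlier clause
outside S₂, the maximum weight of the earlier clauses that are satisfied or in S₂, and a maximizer
(`Rep`).

When one element is passed, S₁ is pushed forward and S₂ is pulled back. Hence a value b, a set S₁
before the element and a set S₂ after it determine one source entry and one target entry
(`Rep.move`). The contributions to one target come from disjoint sets of assignments and are added
or maximized (`Rep.union`). At the last cut both sets are empty and the entry is the answer
(`Rep.last`).

The running time rests on `card_satisfied_le`: few sets occur at a cut. Among the clauses an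
assignment leaves unsatisfied, take one, C, of highest rank for a suitable ranking. Every clause
ranked higher is satisfied. A clause ranked no higher contains, on the relevant side of the cut,
only variables of C, whose values are forced because C is unsatisfied, and at most k exceptions. So
C and the values of the exceptions determine the whole set, which leaves at most 1 + m·2^k sets.
Fault condition (1) provides the ranking for the left sets (`card_fam_le`), condition (2) the one
for the right sets (`card_fam_rev_le`).

With K = 2·m·2^k, each of the m + n positions treats at most two values and K² pairs. A pair costs
O(m), because sets are integers whose binary digits are processed one at a time. Rows of memory are
indexed by these integers and are exponentially long, but memory starts as 0 and only the sets that
occur are visited, through linked lists threaded through the rows. No knowledge of k is needed for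
this.

Programs are verified with `Wp`, a weakest precondition that also counts steps. -/

namespace KInterval

/-! ### Verification of programs -/

/-- The program `P` started in `s` halts after some number of steps in a configuration such that
`Q` holds of both. -/
def Wp (P : Prog) (s : State) (Q : ℕ → State → Prop) : Prop :=
  ∃ t s', Run P s t s' ∧ Q t s'

theorem Wp.mono {P : Prog} {s : State} {Q Q' : ℕ → State → Prop} (h : Wp P s Q)
    (hQ : ∀ t s', Q t s' → Q' t s') : Wp P s Q' := by
  obtain ⟨t, s', hr, hq⟩ := h
  exact ⟨t, s', hr, hQ _ _ hq⟩

@[simp] theorem wp_skip {s : State} {Q : ℕ → State → Prop} : Wp .skip s Q ↔ Q 1 s := by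
  constructor
  · rintro ⟨t, s', hr, hq⟩; cases hr; exact hq
  · intro h; exact ⟨_, _, .skip s, h⟩

@[simp] theorem wp_const {s : State} {r : ℕ} {c : ℤ} {Q : ℕ → State → Prop} :
    Wp (.const r c) s Q ↔ Q 1 (s.setReg r c) := by
  constructor
  · rintro ⟨t, s', hr, hq⟩; cases hr; exact hq
  · intro h; exact ⟨_, _, .const s r c, h⟩

@[simp] theorem wp_add {s : State} {r a b : ℕ} {Q : ℕ → State → Prop} :
    Wp (.add r a b) s Q ↔ Q 1 (s.setReg r (s.reg a + s.reg b)) := by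
  constructor
  · rintro ⟨t, s', hr, hq⟩; cases hr; exact hq
  · intro h; exact ⟨_, _, .add s r a b, h⟩

@[simp] theorem wp_sub {s : State} {r a b : ℕ} {Q : ℕ → State → Prop} :
    Wp (.sub r a b) s Q ↔ Q 1 (s.setReg r (s.reg a - s.reg b)) := by
  constructor
  · rintro ⟨t, s', hr, hq⟩; cases hr; exact hq
  · intro h; exact ⟨_, _, .sub s r a b, h⟩

@[simp] theorem wp_load {s : State} {r a : ℕ} {Q : ℕ → State → Prop} :
    Wp (.load r a) s Q ↔ Q 1 (s.setReg r (s.mem (s.reg a))) := by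
  constructor
  · rintro ⟨t, s', hr, hq⟩; cases hr; exact hq
  · intro h; exact ⟨_, _, .load s r a, h⟩

@[simp] theorem wp_store {s : State} {a r : ℕ} {Q : ℕ → State → Prop} :
    Wp (.store a r) s Q ↔ Q 1 (s.setMem (s.reg a) (s.reg r)) := by
  constructor
  · rintro ⟨t, s', hr, hq⟩; cases hr; exact hq
  · intro h; exact ⟨_, _, .store s a r, h⟩

@[simp] theorem wp_seq {s : State} {p q : Prog} {Q : ℕ → State → Prop} :
    Wp (.seq p q) s Q ↔ Wp p s (fun t s' => Wp q s' (fun t' s'' => Q (t + t') s'')) := by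
  constructor
  · rintro ⟨t, s', hr, hq⟩
    cases hr with
    | seq h₁ h₂ => exact ⟨_, _, h₁, _, _, h₂, hq⟩
  · rintro ⟨t, s', h₁, t', s'', h₂, hq⟩
    exact ⟨_, _, .seq h₁ h₂, hq⟩

@[simp] theorem wp_ifPos {s : State} {r : ℕ} {p q : Prog} {Q : ℕ → State → Prop} :
    Wp (.ifPos r p q) s Q ↔
      if 0 < s.reg r then Wp p s (fun t s' => Q (t + 1) s')
      else Wp q s (fun t s' => Q (t + 1) s') := by
  constructor
  · rintro ⟨t, s', hr, hq⟩
    cases hr with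
    | ifTrue h h' => rw [if_pos h]; exact ⟨_, _, h', hq⟩
    | ifFalse h h' => rw [if_neg h]; exact ⟨_, _, h', hq⟩
  · intro h
    split_ifs at h with hr
    · obtain ⟨t, s', h', hq⟩ := h; exact ⟨_, _, .ifTrue hr h', hq⟩
    · obtain ⟨t, s', h', hq⟩ := h; exact ⟨_, _, .ifFalse hr h', hq⟩

/-- The programs of a list one after the other. -/
def seqs : List Prog → Prog
  | [] => .skip
  | p :: l => .seq p (seqs l)

@[simp] theorem wp_seqs_nil {s : State} {Q : ℕ → State → Prop} : Wp (seqs []) s Q ↔ Q 1 s :=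
  wp_skip

@[simp] theorem wp_seqs_cons {s : State} {p : Prog} {l : List Prog} {Q : ℕ → State → Prop} :
    Wp (seqs (p :: l)) s Q ↔
      Wp p s (fun t s' => Wp (seqs l) s' (fun t' s'' => Q (t + t') s'')) :=
  wp_seq

@[simp] theorem reg_setReg (s : State) (r r' : ℕ) (v : ℤ) :
    (s.setReg r v).reg r' = if r' = r then v else s.reg r' := by
  simp [State.setReg, Function.update_apply]

@[simp] theorem mem_setReg (s : State) (r : ℕ) (v : ℤ) : (s.setReg r v).mem = s.mem := rfl

@[simp] theorem reg_setMem (s : State) (a v : ℤ) : (s.setMem a v).reg = s.reg := rfl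

@[simp] theorem mem_setMem (s : State) (a v : ℤ) :
    (s.setMem a v).mem = Function.update s.mem a v := rfl

/-- A loop that is run `N` times. -/
theorem wp_while {r : ℕ} {body : Prog} (Inv : ℕ → State → Prop) (N T : ℕ)
    (hpos : ∀ i s, i < N → Inv i s → 0 < s.reg r)
    (hend : ∀ s, Inv N s → ¬ 0 < s.reg r)
    (hbody : ∀ i s, i < N → Inv i s → Wp body s (fun t s' => t ≤ T ∧ Inv (i + 1) s'))
    {s : State} (h0 : Inv 0 s) :
    Wp (.whilePos r body) s (fun t s' => t ≤ N * (T + 1) + 1 ∧ Inv N s') := by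
  have key : ∀ d i s, i + d = N → Inv i s →
      Wp (.whilePos r body) s (fun t s' => t ≤ d * (T + 1) + 1 ∧ Inv N s') := by
    intro d
    induction d with
    | zero =>
      intro i s hi hs
      obtain rfl : i = N := by omega
      exact ⟨1, s, .whileFalse (hend s hs), by omega, hs⟩
    | succ d ih =>
      intro i s hi hs
      obtain ⟨t, s₁, hr, ht, h1⟩ := hbody i s (by omega) hs
      obtain ⟨t', s₂, hr', ht', h2⟩ := ih (i + 1) s₁ (by omega) h1
      refine ⟨_, s₂, .whileTrue (hpos i s (by omega) hs) hr hr', ?_, h2⟩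
      have : (d + 1) * (T + 1) = d * (T + 1) + (T + 1) := by ring
      omega
  exact key N 0 s (by omega) h0

/-- A loop that is run once for each entry of a list. -/
theorem wp_while_list {α : Type*} {r : ℕ} {body : Prog} (Inv : List α → List α → State → Prop)
    (T : ℕ) (hpos : ∀ a x b s, Inv a (x :: b) s → 0 < s.reg r)
    (hend : ∀ a s, Inv a [] s → ¬ 0 < s.reg r)
    (hbody : ∀ a x b s, Inv a (x :: b) s →
      Wp body s (fun t s' => t ≤ T ∧ Inv (a ++ [x]) b s'))
    {l : List α} {s : State} (h0 : Inv [] l s) :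
    Wp (.whilePos r body) s (fun t s' => t ≤ l.length * (T + 1) + 1 ∧ Inv l [] s') := by
  have key : ∀ b a s, Inv a b s →
      Wp (.whilePos r body) s (fun t s' => t ≤ b.length * (T + 1) + 1 ∧ Inv (a ++ b) [] s') := by
    intro b
    induction b with
    | nil =>
      intro a s hs
      exact ⟨1, s, .whileFalse (hend a s hs), by simp, by simpa using hs⟩
    | cons x b ih =>
      intro a s hs
      obtain ⟨t, s₁, hr, ht, h1⟩ := hbody a x b s hs
      obtain ⟨t', s₂, hr', ht', h2⟩ := ih _ s₁ h1
      refine ⟨_, s₂, .whileTrue (hpos a x b s hs) hr hr', ?_, by simpa using h2⟩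
      have : (b.length + 1) * (T + 1) = b.length * (T + 1) + (T + 1) := by ring
      simp only [List.length_cons]
      omega
  simpa using key l [] s h0

/-- The registers below `k` have the same contents in `s` and `s'`. -/
def Same (k : ℕ) (s s' : State) : Prop := ∀ r < k, s'.reg r = s.reg r

@[simp] theorem Same.rfl {k : ℕ} {s : State} : Same k s s := fun _ _ => Eq.refl _

theorem Same.trans {k : ℕ} {s s' s'' : State} (h : Same k s s') (h' : Same k s' s'') :
    Same k s s'' := fun r hr => (h' r hr).trans (h r hr)

theorem Same.mono {k k' : ℕ} {s s' : State} (h : Same k s s') (hk : k' ≤ k) : Same k' s s' :=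
  fun r hr => h r (hr.trans_le hk)

theorem same_setReg {k r : ℕ} {s s' : State} {v : ℤ} (h : k ≤ r) :
    Same k s (s'.setReg r v) ↔ Same k s s' := by
  refine forall₂_congr fun r' hr' => ?_
  rw [reg_setReg, if_neg (by omega)]

@[simp] theorem same_setMem {k : ℕ} {s s' : State} {a v : ℤ} :
    Same k s (s'.setMem a v) ↔ Same k s s' := Iff.rfl

/-! ### Sets as integers -/

section Code

variable {m : ℕ}

/-- A set coded by the integer whose binary digits form its characteristic vector. -/
def code (A : Finset (Fin m)) : ℕ := ∑ j ∈ A, 2 ^ (j : ℕ)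

/-- The digit number `i` of the code of `A`. -/
def digit (A : Finset (Fin m)) (i : ℕ) : ℕ := if ∃ h : i < m, (⟨i, h⟩ : Fin m) ∈ A then 1 else 0

/-- The number formed by the last `r` digits of the code of `A`. -/
def lowCode (A : Finset (Fin m)) (r : ℕ) : ℕ := ∑ i ∈ Finset.range r, digit A i * 2 ^ i

theorem lowCode_self (A : Finset (Fin m)) : lowCode A m = code A := by
  unfold lowCode code
  rw [← Fin.sum_univ_eq_sum_range (fun i => digit A i * 2 ^ i)]
  simp [digit, Finset.sum_ite_mem, ite_mul]

theorem lowCode_succ (A : Finset (Fin m)) (r : ℕ) :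
    lowCode A (r + 1) = lowCode A r + digit A r * 2 ^ r :=
  Finset.sum_range_succ _ _

theorem digit_eq (A : Finset (Fin m)) (i : ℕ) : digit A i = 0 ∨ digit A i = 1 := by
  unfold digit; split_ifs <;> simp

theorem lowCode_lt (A : Finset (Fin m)) (r : ℕ) : lowCode A r < 2 ^ r := by
  induction r with
  | zero => simp [lowCode]
  | succ r ih =>
    rw [lowCode_succ, pow_succ]
    rcases digit_eq A r with h | h <;> rw [h] <;> omega

theorem code_lt (A : Finset (Fin m)) : code A < 2 ^ m := lowCode_self A ▸ lowCode_lt A m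

theorem digit_inter (A B : Finset (Fin m)) (i : ℕ) :
    digit (A ∩ B) i = digit A i * digit B i := by
  unfold digit
  by_cases h : i < m <;> simp [h]
  split_ifs <;> simp_all

/-- The digits below r sum to less than 2^r, so equal codes have equal leading digits, and one
descends. Injectivity is what allows a cell addressed by a code to belong to a single set. -/
theorem code_injective : Function.Injective (code : Finset (Fin m) → ℕ) := by
  intro A B h
  have key : ∀ r, lowCode A r = lowCode B r → ∀ i < r, digit A i = digit B i := by
    intro r
    induction r with
    | zero => intro _ i hi; omega
    | succ r ih =>
      intro h i hi
      rw [lowCode_succ, lowCode_succ] at h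
      have hA := lowCode_lt A r
      have hB := lowCode_lt B r
      have hd : digit A r = digit B r := by
        rcases digit_eq A r with h1 | h1 <;> rcases digit_eq B r with h2 | h2 <;>
          rw [h1, h2] at h ⊢ <;> omega
      rw [hd] at h
      rcases Nat.lt_succ_iff_lt_or_eq.1 hi with h' | rfl
      · exact ih (by omega) i h'
      · exact hd
  ext j
  have := key m (by rw [lowCode_self, lowCode_self, h]) j j.2
  unfold digit at this
  by_cases hA : j ∈ A <;> by_cases hB : j ∈ B <;> simp_all

@[simp] theorem code_empty : code (∅ : Finset (Fin m)) = 0 := rfl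

theorem code_union_add_inter (A B : Finset (Fin m)) :
    code (A ∪ B) + code (A ∩ B) = code A + code B :=
  Finset.sum_union_inter

theorem code_union_of_disjoint {A B : Finset (Fin m)} (h : Disjoint A B) :
    code (A ∪ B) = code A + code B :=
  Finset.sum_union h

theorem code_sdiff_add_inter (A B : Finset (Fin m)) :
    code (A \ B) + code (A ∩ B) = code A := by
  rw [← code_union_of_disjoint (Finset.disjoint_sdiff_inter A B), Finset.sdiff_union_inter]

theorem code_pos {A : Finset (Fin m)} : 0 < code A ↔ A.Nonempty := by
  rw [Nat.pos_iff_ne_zero, Finset.nonempty_iff_ne_empty, ne_eq, ne_eq, ← code_empty (m := m),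
    code_injective.eq_iff]

@[simp] theorem code_singleton (j : Fin m) : code {j} = 2 ^ (j : ℕ) := by simp [code]

end Code

/-! ### Arithmetic subroutines -/

/-- `R[r] := R[a]`, given that register `6` holds `0`. -/
abbrev mov (r a : ℕ) : Prog := .add r a 6

/-- `R[r] := R[r] + R[r]` -/
abbrev dbl (r : ℕ) : Prog := .add r r r

/-- Register `102` receives the code of the intersection of the sets coded in `100` and `101`. -/
def interProg : Prog := seqs
  [mov 103 1, .const 102 0,
   .whilePos 103 (seqs
    [dbl 100, dbl 101, dbl 102, .sub 104 100 3, .add 104 104 5, .sub 105 101 3, .add 105 105 5,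
     .ifPos 104
      (.seq (.sub 100 100 3) (.ifPos 105 (.seq (.sub 101 101 3) (.add 102 102 5)) .skip))
      (.ifPos 105 (.sub 101 101 3) .skip),
     .sub 103 103 5])]

/-- Register `101` receives `2` to the power given in register `100`. -/
def powProg : Prog := seqs
  [.const 101 1, .whilePos 100 (.seq (dbl 101) (.sub 100 100 5))]

/-- The registers that stay constant during the computation. -/
structure Glob (m n : ℕ) (s : State) : Prop where
  r1 : s.reg 1 = m
  r2 : s.reg 2 = n
  r3 : s.reg 3 = 2 ^ m
  r5 : s.reg 5 = 1
  r6 : s.reg 6 = 0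
  r7 : s.reg 7 = -(n + 1)
  r8 : s.reg 8 = 2 ^ m + 1
  r9 : s.reg 9 = m + n + 1

theorem Glob.congr {m n : ℕ} {s s' : State} (h : Glob m n s) (hs : Same 10 s s') :
    Glob m n s' := by
  constructor <;> rw [hs _ (by norm_num)]
  exacts [h.r1, h.r2, h.r3, h.r5, h.r6, h.r7, h.r8, h.r9]

theorem wp_pow {s : State} (e : ℕ) (h5 : s.reg 5 = 1) (h : s.reg 100 = e) :
    Wp powProg s (fun t s' => t ≤ 3 * e + 3 ∧ s'.mem = s.mem ∧
      Same 100 s s' ∧ s'.reg 101 = 2 ^ e) := by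
  simp only [powProg, wp_seqs_cons, wp_const, wp_seqs_nil]
  refine (wp_while (fun i s' => s'.mem = s.mem ∧ Same 100 s s' ∧
    s'.reg 101 = 2 ^ i ∧ s'.reg 100 = e - i) e 2 ?_ ?_ ?_ ?_).mono ?_
  · rintro i s' hi ⟨-, -, -, h⟩; rw [h]; omega
  · rintro s' ⟨-, -, -, h⟩; rw [h]; omega
  · rintro i s' hi ⟨h1, h2, h3, h4⟩
    simp [h1, h3, h4, h2 5, h5, same_setReg, h2]
    exact ⟨by ring, by ring⟩
  · simp [h, same_setReg]
  · rintro t s' ⟨ht, h1, h2, h3, h4⟩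
    exact ⟨by omega, h1, h2, h3⟩

/-- Without bit operations, digits are shifted out at the top: after a doubling, the leading digit
is 1 exactly when the number is at least 2^m. The m rounds of this loop are one factor m of the
running time. -/
theorem wp_inter {m : ℕ} {s : State} (A B : Finset (Fin m)) (h1 : s.reg 1 = m)
    (h3 : s.reg 3 = 2 ^ m) (h5 : s.reg 5 = 1) (h6 : s.reg 6 = 0) (hA : s.reg 100 = code A)
    (hB : s.reg 101 = code B) :
    Wp interProg s (fun t s' => t ≤ 20 * (m + 1) ∧ s'.mem = s.mem ∧
      Same 100 s s' ∧ s'.reg 102 = code (A ∩ B)) := by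
  simp only [interProg, wp_seqs_cons, wp_const, wp_seqs_nil, wp_add]
  -- After i rounds the unread low digits of A and B stand shifted by i places, and register 102
  -- holds the top i digits of the intersection.
  refine (wp_while (fun i s' => s'.mem = s.mem ∧ Same 100 s s' ∧
    s'.reg 100 = lowCode A (m - i) * 2 ^ i ∧ s'.reg 101 = lowCode B (m - i) * 2 ^ i ∧
    s'.reg 102 * 2 ^ (m - i) + lowCode (A ∩ B) (m - i) = code (A ∩ B) ∧
    s'.reg 103 = m - i) m 17 ?_ ?_ ?_ ?_).mono ?_
  · rintro i s' hi ⟨-, -, -, -, -, h⟩; rw [h]; omega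
  · rintro s' ⟨-, -, -, -, -, h⟩; rw [h]; omega
  · rintro i s' hi ⟨g1, g2, g3, g4, g5, g6⟩
    obtain ⟨r, hr⟩ : ∃ r, m - i = r + 1 := ⟨m - i - 1, by omega⟩
    have hr' : m - (i + 1) = r := by omega
    have hm : m = r + (i + 1) := by omega
    -- Doubling puts the next digit at 2^m and keeps the remainder in [0, 2^m), so a comparison with
    -- 2^m reads the digit and a subtraction removes it.
    have key : ∀ C : Finset (Fin m), (lowCode C (r + 1) * 2 ^ i + lowCode C (r + 1) * 2 ^ i : ℤ)
        = lowCode C r * 2 ^ (i + 1) + digit C r * 2 ^ m ∧ 0 ≤ (lowCode C r * 2 ^ (i + 1) : ℤ) ∧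
        (lowCode C r * 2 ^ (i + 1) : ℤ) < 2 ^ m := by
      intro C
      refine ⟨?_, mul_nonneg (Nat.cast_nonneg _) (pow_nonneg (by norm_num) _), ?_⟩
      · rw [lowCode_succ]
        have : (2 : ℤ) ^ m = 2 ^ (r + (i + 1)) := by rw [← hm]
        rw [this]
        push_cast
        ring
      · have : (2 : ℤ) ^ m = 2 ^ (r + (i + 1)) := by rw [← hm]
        rw [this, pow_add (2 : ℤ) r (i + 1)]
        have := lowCode_lt C r
        have h2 : ((lowCode C r : ℕ) : ℤ) < 2 ^ r := by exact_mod_cast this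
        exact mul_lt_mul_of_pos_right h2 (pow_pos two_pos _)
    obtain ⟨a1, a2, a3⟩ := key A
    obtain ⟨b1, b2, b3⟩ := key B
    rw [hr] at g3 g4 g5
    rw [lowCode_succ, pow_succ, digit_inter] at g5
    have hp : (0 : ℤ) < 2 ^ m := by positivity
    simp only [wp_seqs_cons, wp_add, wp_sub, wp_ifPos, wp_seq, wp_skip, wp_seqs_nil, reg_setReg,
      mem_setReg, Nat.reduceEqDiff, if_true, if_false, g3, g4, g6, a1, b1, hr',
      g2 3 (by norm_num), g2 5 (by norm_num), h3, h5]
    generalize (lowCode A r * 2 ^ (i + 1) : ℤ) = a at *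
    generalize (lowCode B r * 2 ^ (i + 1) : ℤ) = b at *
    generalize (2 : ℤ) ^ m = P at *
    rcases digit_eq A r with hA | hA <;> rcases digit_eq B r with hB | hB <;>
      simp only [hA, hB, Nat.cast_zero, Nat.cast_one, zero_mul, one_mul, mul_zero, mul_one,
        add_zero, Nat.cast_add, Nat.cast_pow, Nat.cast_ofNat] at g5 ⊢ <;>
      split_ifs <;> first | omega | skip
    all_goals
      simp only [same_setReg, g1, g2, Nat.reduceLeDiff, true_and]
      refine ⟨?_, ?_⟩ <;> (try refine ⟨?_, ?_⟩) <;> (try refine ⟨?_, ?_⟩) <;> (try refine ⟨?_, ?_⟩) <;>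
        first | omega | linear_combination g5
  · simp [h1, h6, same_setReg, lowCode_self, hA, hB]
  · rintro t s' ⟨ht, g1, g2, g3, g4, g5, g6⟩
    refine ⟨by omega, g1, g2, ?_⟩
    simpa [lowCode] using g5

end KInterval

namespace KInterval

/-! ### Partial assignments along an ordering -/

section Semantics

variable {m n : ℕ}

open Finset in
/-- The clauses that contain the literal `(x, b)`. -/
def lits (F : CNF m n) (x : Fin n) (b : Bool) : Finset (Fin m) :=
  univ.filter fun j => (x, b) ∈ F.clause j

@[simp] theorem mem_lits {F : CNF m n} {x : Fin n} {b : Bool} {j : Fin m} :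
    j ∈ lits F x b ↔ (x, b) ∈ F.clause j := by
  simp [lits]

open Finset in
/-- The clauses at position `p` or later. -/
def rem (π : Ordering m n) (p : ℕ) : Finset (Fin m) :=
  univ.filter fun j => p ≤ (π (.inl j) : ℕ)

open Finset in
/-- The clauses at position `p` or later that `τ` satisfies through a variable before `p`. -/
def lset (F : CNF m n) (π : Ordering m n) (p : ℕ) (τ : Fin n → Bool) : Finset (Fin m) :=
  univ.filter fun j =>
    p ≤ (π (.inl j) : ℕ) ∧ ∃ x, (π (.inr x) : ℕ) < p ∧ (x, τ x) ∈ F.clause j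

open Finset in
/-- The sets `lset F π p τ` for all assignments `τ`. -/
def fam (F : CNF m n) (π : Ordering m n) (p : ℕ) : Finset (Finset (Fin m)) :=
  univ.image (lset F π p)

/-- The clauses of `R` that become satisfied by the value `b` at the element `e`. -/
def gain (F : CNF m n) (R : Finset (Fin m)) (b : Bool) : Fin m ⊕ Fin n → Finset (Fin m)
  | .inl _ => ∅
  | .inr x => lits F x b ∩ R

/-- The clause at an element of the ordering. -/
def here : Fin m ⊕ Fin n → Finset (Fin m)
  | .inl j => {j}
  | .inr _ => ∅

/-- The values to be tried at an element of the ordering. -/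
def choices : Fin m ⊕ Fin n → List Bool
  | .inl _ => [false]
  | .inr _ => [false, true]

/-- The value chosen by an assignment at an element of the ordering. -/
def choice (τ : Fin n → Bool) : Fin m ⊕ Fin n → Bool
  | .inl _ => false
  | .inr x => τ x

/-- The set of satisfied clauses after an element with the value `b`. -/
def advance (F : CNF m n) (R : Finset (Fin m)) (e : Fin m ⊕ Fin n) (b : Bool)
    (S : Finset (Fin m)) : Finset (Fin m) :=
  (S ∪ gain F R b e) \ here e

/-- The clause at an element if it is found to be satisfied. -/
def hit (F : CNF m n) (R : Finset (Fin m)) (e : Fin m ⊕ Fin n) (b : Bool)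
    (S : Finset (Fin m)) : Finset (Fin m) :=
  (S ∪ gain F R b e) ∩ here e

/-- The reverse ordering. -/
def rev (π : Ordering m n) : Ordering m n := π.trans Fin.revPerm

theorem rev_apply (π : Ordering m n) (e : Fin m ⊕ Fin n) :
    (rev π e : ℕ) = m + n - 1 - π e := by
  simp [rev, Fin.val_rev]
  omega

theorem rev_symm (π : Ordering m n) (p : Fin (m + n)) : (rev π).symm p = π.symm p.rev := by
  simp [rev]

theorem choice_mem (τ : Fin n → Bool) (e : Fin m ⊕ Fin n) : choice τ e ∈ choices e := by
  cases e <;> simp [choice, choices]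

theorem val_eq_iff (π : Ordering m n) {p : ℕ} (hp : p < m + n) (e : Fin m ⊕ Fin n) :
    (π e : ℕ) = p ↔ e = π.symm ⟨p, hp⟩ := by
  rw [Equiv.eq_symm_apply, Fin.ext_iff]

variable (F : CNF m n) (π : Ordering m n)

theorem lset_subset (p : ℕ) (τ : Fin n → Bool) : lset F π p τ ⊆ rem π p := by
  intro j; simp only [lset, rem, Finset.mem_filter]; tauto

theorem lset_zero (τ : Fin n → Bool) : lset F π 0 τ = ∅ := by
  ext j; simp [lset]

theorem rem_zero : rem π 0 = Finset.univ := by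
  ext j; simp [rem]

theorem rem_last : rem π (m + n) = ∅ := by
  ext j; simp [rem]

theorem lset_last (τ : Fin n → Bool) : lset F π (m + n) τ = ∅ :=
  Finset.subset_empty.1 (rem_last π ▸ lset_subset F π _ τ)

theorem fam_zero : fam F π 0 = {∅} := by
  ext S; simp [fam, lset_zero, eq_comm]

theorem rem_succ {p : ℕ} (hp : p < m + n) : rem π (p + 1) = rem π p \ here (π.symm ⟨p, hp⟩) := by
  ext j
  have h := val_eq_iff π hp (.inl j)
  rcases he : π.symm ⟨p, hp⟩ with i | x <;> rw [he] at h <;>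
    simp only [Sum.inl.injEq, reduceCtorEq, iff_false] at h <;>
    simp [rem, here] <;> omega

/-- Only a variable at p can satisfy further clauses, and only a clause at p can leave the set. The
new set therefore depends on τ only through the old set and the value at p. -/
theorem lset_succ {p : ℕ} (hp : p < m + n) (τ : Fin n → Bool) :
    lset F π (p + 1) τ = advance F (rem π p) (π.symm ⟨p, hp⟩)
      (choice τ (π.symm ⟨p, hp⟩)) (lset F π p τ) := by
  ext j
  have h := fun e => val_eq_iff π hp e
  have hs : ∀ e, (π e : ℕ) < p + 1 ↔ (π e : ℕ) < p ∨ (π e : ℕ) = p := fun e => by omega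
  have hs' : ∀ e, p + 1 ≤ (π e : ℕ) ↔ p ≤ (π e : ℕ) ∧ ¬ (π e : ℕ) = p := fun e => by omega
  rcases he : π.symm ⟨p, hp⟩ with i | x
  · simp [lset, advance, gain, here, hs, hs', h, he]; tauto
  · simp [lset, advance, gain, here, choice, rem, hs, hs', h, he, or_and_right, exists_or]
    rw [and_or_left]
    exact or_congr Iff.rfl and_comm

/-- `lset` depends only on the variables before the position. -/
theorem lset_congr {p : ℕ} {τ τ' : Fin n → Bool}
    (h : ∀ x, (π (.inr x) : ℕ) < p → τ x = τ' x) : lset F π p τ = lset F π p τ' := by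
  ext j
  simp only [lset, Finset.mem_filter, Finset.mem_univ, true_and]
  refine and_congr_right fun _ => exists_congr fun x => and_congr_right fun hx => ?_
  rw [h x hx]

/-- The assignment `τ` with the value at the element `e` replaced by `b`. -/
def change (e : Fin m ⊕ Fin n) (b : Bool) (τ : Fin n → Bool) : Fin n → Bool :=
  match e with
  | .inl _ => τ
  | .inr x => Function.update τ x b

theorem change_of_lt {p : ℕ} (hp : p < m + n) (b : Bool) (τ : Fin n → Bool) {x : Fin n}
    (hx : (π (.inr x) : ℕ) ≠ p) : change (π.symm ⟨p, hp⟩) b τ x = τ x := by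
  have h := (val_eq_iff π hp (.inr x)).not.1 hx
  rcases he : π.symm ⟨p, hp⟩ with i | y
  · rfl
  · rw [he] at h
    simp only [Sum.inr.injEq] at h
    simp [change, h]

theorem choice_change {e : Fin m ⊕ Fin n} {b : Bool} (hb : b ∈ choices e) (τ : Fin n → Bool) :
    choice (change e b τ) e = b := by
  cases e <;> simp_all [choice, change, choices]

theorem lset_change {p : ℕ} (hp : p < m + n) (b : Bool) (τ : Fin n → Bool) :
    lset F π p (change (π.symm ⟨p, hp⟩) b τ) = lset F π p τ :=
  lset_congr F π fun _ hx => change_of_lt π hp b τ hx.ne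

/-- The value at p can be changed without affecting the set at p, so every set combines with every
value. This is the rule by which the families are generated. -/
theorem mem_fam_succ {p : ℕ} (hp : p < m + n) (S : Finset (Fin m)) :
    S ∈ fam F π (p + 1) ↔ ∃ b ∈ choices (π.symm ⟨p, hp⟩), ∃ S₀ ∈ fam F π p,
      advance F (rem π p) (π.symm ⟨p, hp⟩) b S₀ = S := by
  simp only [fam, Finset.mem_image, Finset.mem_univ, true_and]
  constructor
  · rintro ⟨τ, rfl⟩
    exact ⟨_, choice_mem τ _, _, ⟨τ, rfl⟩, (lset_succ F π hp τ).symm⟩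
  · rintro ⟨b, hb, _, ⟨τ, rfl⟩, rfl⟩
    refine ⟨change (π.symm ⟨p, hp⟩) b τ, ?_⟩
    rw [lset_succ F π hp, lset_change, choice_change hb]

theorem rem_rev {p : ℕ} : rem (rev π) (m + n - p) = (rem π p)ᶜ := by
  ext j
  have := (π (.inl j)).2
  simp [rem, rev_apply]
  omega

theorem rev_symm_sub {p : ℕ} (hp : p < m + n) :
    (rev π).symm ⟨m + n - (p + 1), by omega⟩ = π.symm ⟨p, hp⟩ := by
  rw [rev_symm]
  congr 1
  ext
  simp [Fin.val_rev]
  omega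

/-- The two restricting sets differ at most by a clause standing at p, and if a clause stands there
the gain is empty anyway. -/
theorem gain_rev {p : ℕ} (hp : p < m + n) (b : Bool) :
    gain F (rem (rev π) (m + n - (p + 1))) b (π.symm ⟨p, hp⟩) =
      gain F (rem π p)ᶜ b (π.symm ⟨p, hp⟩) := by
  rw [rem_rev π, rem_succ π hp]
  rcases π.symm ⟨p, hp⟩ with i | y <;> simp [gain, here]

/-- In the reversed ordering the element at p comes right after those at p + 1 and later. The right
set of the source entry is thus again in the reversed family, so the entry looked up has been
computed. -/
theorem mem_rfam {p : ℕ} (hp : p < m + n) {b : Bool} (hb : b ∈ choices (π.symm ⟨p, hp⟩))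
    {S : Finset (Fin m)} (hS : S ∈ fam F (rev π) (m + n - (p + 1))) :
    advance F (rem π p)ᶜ (π.symm ⟨p, hp⟩) b S ∈ fam F (rev π) (m + n - p) := by
  rw [show m + n - p = m + n - (p + 1) + 1 by omega,
    mem_fam_succ F (rev π) (show m + n - (p + 1) < m + n by omega), rev_symm_sub π hp]
  refine ⟨b, hb, S, hS, ?_⟩
  rw [advance, advance, gain_rev]

end Semantics

/-! ### The number of sets of satisfied clauses -/

section Count

variable {m n : ℕ}

open Finset in
/-- If the clauses of `K` can be ranked such that all variables in `V` of a clause of lower rank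
appear in the clause of higher rank, up to `k` exceptions for each, then the assignments have at most
`1 + 2 ^ k * K.card` distinct sets of clauses in `K` satisfied by variables in `V`. -/
theorem card_satisfied_le (F : CNF m n) (V : Finset (Fin n)) (K : Finset (Fin m)) (k : ℕ)
    (ρ : Fin m → ℕ) (Φ : Fin m → Finset (Fin n)) (hΦ : ∀ j, (Φ j).card ≤ k)
    (h : ∀ C ∈ K, ∀ D ∈ K, ρ D ≤ ρ C → ∀ x ∈ V, F.Appears x D → F.Appears x C ∨ x ∈ Φ C) :
    (univ.image fun τ : Fin n → Bool =>
      K.filter fun j => ∃ x ∈ V, (x, τ x) ∈ F.clause j).card ≤ 1 + m * 2 ^ k := by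
  classical
  -- Outside Φ C the value is the one that falsifies the literal of x in C. For variables neither in
  -- Φ C nor in C it is a junk value that no relevant clause sees.
  let forced (C : Fin m) (β : Finset (Fin n)) (x : Fin n) : Bool :=
    if x ∈ Φ C then decide (x ∈ β) else !decide ((x, true) ∈ F.clause C)
  let g (C : Fin m) (β : Finset (Fin n)) : Finset (Fin m) :=
    K.filter fun D => ρ C < ρ D ∨ ∃ x ∈ V, (x, forced C β x) ∈ F.clause D
  -- The singleton {K} covers the assignments satisfying all of K and gives the summand 1; the rest
  -- is m choices of C times at most 2 ^ k subsets of Φ C.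
  have hsub : (univ.image fun τ : Fin n → Bool =>
      K.filter fun j => ∃ x ∈ V, (x, τ x) ∈ F.clause j) ⊆
      {K} ∪ univ.biUnion fun C => (Φ C).powerset.image (g C) := by
    intro S hS
    obtain ⟨τ, -, rfl⟩ := mem_image.1 hS
    set S := K.filter fun j => ∃ x ∈ V, (x, τ x) ∈ F.clause j with hSdef
    by_cases hK : S = K
    · simp [hK]
    have hne : (K \ S).Nonempty := by
      rw [sdiff_nonempty]
      exact fun hKS => hK (Subset.antisymm (filter_subset _ _) hKS)
    -- C is an unsatisfied clause of highest rank. The set is rebuilt from C and the exceptional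
    -- variables that are true: clauses of higher rank belong to it, and the others are tested with
    -- the forced values.
    obtain ⟨C, hC, hmax⟩ := exists_max_image _ ρ hne
    rw [mem_sdiff] at hC
    have hCS : ∀ x ∈ V, (x, τ x) ∉ F.clause C := by
      intro x hx hx'
      exact hC.2 (mem_filter.2 ⟨hC.1, x, hx, hx'⟩)
    refine mem_union_right _ (mem_biUnion.2 ⟨C, mem_univ _, mem_image.2
      ⟨(Φ C).filter fun x => τ x = true, by simp, ?_⟩⟩)
    ext D
    simp only [g, hSdef, mem_filter, and_congr_right_iff]
    intro hD
    by_cases hρ : ρ C < ρ D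
    · simp only [hρ, true_or, true_iff]
      by_contra hDS
      have := hmax D (mem_sdiff.2 ⟨hD, fun hh => hDS (mem_filter.1 hh).2⟩)
      omega
    · simp only [hρ, false_or]
      refine exists_congr fun x => and_congr_right fun hx => ?_
      by_cases hA : F.Appears x D
      · suffices hf : forced C ((Φ C).filter fun x => τ x = true) x = τ x by rw [hf]
        by_cases hxΦ : x ∈ Φ C
        · simp [forced, hxΦ]
        · have hxC := (h C hC.1 D hD (by omega) x hx hA).resolve_right hxΦ
          have hn := hCS x hx
          obtain ⟨b, hb⟩ := hxC
          simp only [forced, hxΦ, if_false]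
          cases hτ : τ x <;> rw [hτ] at hn
          · cases b
            · exact absurd hb hn
            · simp [hb]
          · simp [hn]
      · exact iff_of_false (fun hh => hA ⟨_, hh⟩) (fun hh => hA ⟨_, hh⟩)
  refine (card_le_card hsub).trans ((card_union_le _ _).trans ?_)
  rw [card_singleton]
  refine Nat.add_le_add_left (card_biUnion_le.trans ?_) 1
  refine (sum_le_card_nsmul univ _ (2 ^ k) fun C _ => ?_).trans (by simp)
  refine card_image_le.trans ?_
  rw [card_powerset]
  exact Nat.pow_le_pow_right (by norm_num) (hΦ C)

open Finset in
theorem fam_eq_image (F : CNF m n) (π : Ordering m n) (p : ℕ) :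
    fam F π p = univ.image fun τ : Fin n → Bool => (rem π p).filter fun j =>
      ∃ x ∈ univ.filter (fun x => (π (.inr x) : ℕ) < p), (x, τ x) ∈ F.clause j := by
  unfold fam
  congr 1
  ext τ j
  simp [lset, rem]

theorem exists_faults_finset {F : CNF m n} {π : Ordering m n} {k : ℕ}
    (h : IsKIntervalOrdering k F π) :
    ∃ Φ : Fin m → Finset (Fin n), (∀ j, (Φ j).card ≤ k) ∧ ∀ j x, x ∈ Φ j ↔ x ∈ faults F π j := by
  classical
  refine ⟨fun j => (faults F π j).toFinset, fun j => ?_, fun j x => by simp⟩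
  rw [← Set.ncard_eq_toFinset_card']
  exact h j

-- A clause ranks higher the earlier its first variable is. If D ranks no higher than C and x
-- appears in D before the cut, then C has a variable no later than x, while C itself stands after
-- the cut. So x appears in C or is a fault of C by condition (1).
open Finset in
theorem card_fam_le {F : CNF m n} {π : Ordering m n} {k : ℕ} (h : IsKIntervalOrdering k F π)
    (p : ℕ) : (fam F π p).card ≤ 1 + m * 2 ^ k := by
  classical
  obtain ⟨Φ, hΦ, hmem⟩ := exists_faults_finset h
  rw [fam_eq_image]
  /- clauses with an early variable have a high rank -/
  let ρ (C : Fin m) : ℕ := (univ.filter fun x => F.Appears x C).sup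
    fun x => m + n - (π (.inr x) : ℕ)
  refine card_satisfied_le F _ _ k ρ Φ hΦ ?_
  intro C hC D hD hρ x hx hxD
  by_contra! hcon
  refine hcon.2 ((hmem C x).2 ⟨hcon.1, Or.inl ?_⟩)
  have h1 : m + n - (π (.inr x) : ℕ) ≤ ρ C :=
    (le_sup (f := fun x => m + n - (π (.inr x) : ℕ)) (by simpa using hxD)).trans hρ
  have h2 := (π (.inr x)).2
  -- A supremum over no variables would be 0, but m + n - π x is positive; hence C does have a
  -- variable y at least as early as x.
  obtain ⟨y, hy, hy'⟩ := (Finset.le_sup_iff (by simp)).1 h1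
  have hyC : F.Appears y C := by simpa using hy
  have hne : π (.inr y) ≠ π (.inr x) := fun he => hcon.1 <| by
    rwa [← Sum.inr_injective (π.injective he)]
  have hne' := Fin.val_ne_of_ne hne
  simp only [mem_filter, mem_univ, true_and, rem] at hx hC
  exact ⟨y, hyC, Fin.lt_def.2 (by omega), Fin.lt_def.2 (by omega)⟩

-- Here the variables lie after the cut and the clauses before it, and clauses are ranked by
-- position. If D is before C and x appears in D but not in C, then D < C < x is condition (2).
open Finset in
theorem card_fam_rev_le {F : CNF m n} {π : Ordering m n} {k : ℕ} (h : IsKIntervalOrdering k F π)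
    (p : ℕ) : (fam F (rev π) p).card ≤ 1 + m * 2 ^ k := by
  obtain ⟨Φ, hΦ, hmem⟩ := exists_faults_finset h
  rw [fam_eq_image]
  refine card_satisfied_le F _ _ k (fun C => (π (.inl C) : ℕ)) Φ hΦ ?_
  intro C hC D hD hρ x hx hxD
  by_contra! hcon
  refine hcon.2 ((hmem C x).2 ⟨hcon.1, Or.inr ⟨D, hxD, ?_, ?_⟩⟩)
  · refine lt_of_le_of_ne hρ fun he => hcon.1 ?_
    have := Sum.inl_injective (π.injective he)
    exact this ▸ hxD
  · simp only [mem_filter, mem_univ, true_and, rem, rev_apply] at hx hC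
    have := (π (.inl C)).2
    have := (π (.inr x)).2
    exact Fin.lt_def.2 (by omega)

end Count

end KInterval

namespace KInterval

/-! ### Table entries -/

section Tables

variable {m n : ℕ}

open Finset in
/-- The assignments that are `false` on all variables at position `p` or later. -/
def leftA (π : Ordering m n) (p : ℕ) : Finset (Fin n → Bool) :=
  univ.filter fun τ => ∀ x, p ≤ (π (.inr x) : ℕ) → τ x = false

open Finset in
/-- The clauses before position `p` that lie in `S` or are satisfied by `τ` through a variable
before `p`. -/
def satL (F : CNF m n) (π : Ordering m n) (p : ℕ) (S : Finset (Fin m)) (τ : Fin n → Bool) :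
    Finset (Fin m) :=
  univ.filter fun j => (π (.inl j) : ℕ) < p ∧
    (j ∈ S ∨ ∃ x, (π (.inr x) : ℕ) < p ∧ (x, τ x) ∈ F.clause j)

/-- A positive integer that codes an assignment. -/
def enc (τ : Fin n → Bool) : ℕ := code (Finset.univ.filter fun x => τ x = true) + 1

/-- What a value adds to the code of an assignment. -/
def encGain (b : Bool) : Fin m ⊕ Fin n → ℕ
  | .inl _ => 0
  | .inr x => if b then 2 ^ (x : ℕ) else 0

/-- The weight of the clause at an element. -/
def weightAt (w : Fin m → ℤ) : Fin m ⊕ Fin n → ℤ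
  | .inl j => w j
  | .inr _ => 0

open Finset in
/-- The entries `c v a` describe the set `X` of partial assignments: the number of those that satisfy
all clauses before `p` not in `S`, the maximum weight of the clauses before `p` that are in `S` or
satisfied, and the code of an assignment that attains it. -/
structure Rep (F : CNF m n) (π : Ordering m n) (w : Fin m → ℤ) (p : ℕ) (S : Finset (Fin m))
    (X : Finset (Fin n → Bool)) (c v a : ℤ) : Prop where
  count : c = (X.filter fun τ => satL F π p S τ = (rem π p)ᶜ).card
  empty : X = ∅ → a = 0
  best : X.Nonempty → ∃ τ ∈ X, a = enc τ ∧ v = ∑ j ∈ satL F π p S τ, w j ∧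
    ∀ τ' ∈ X, ∑ j ∈ satL F π p S τ', w j ≤ v

variable (F : CNF m n) (π : Ordering m n) (w : Fin m → ℤ)

theorem satL_congr {p : ℕ} (S : Finset (Fin m)) {τ τ' : Fin n → Bool}
    (h : ∀ x, (π (.inr x) : ℕ) < p → τ x = τ' x) : satL F π p S τ = satL F π p S τ' := by
  ext j
  simp only [satL, Finset.mem_filter, Finset.mem_univ, true_and]
  refine and_congr_right fun _ => or_congr Iff.rfl (exists_congr fun x =>
    and_congr_right fun hx => ?_)
  rw [h x hx]

theorem satL_change {p : ℕ} (hp : p < m + n) (b : Bool) (S : Finset (Fin m)) (τ : Fin n → Bool) :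
    satL F π p S (change (π.symm ⟨p, hp⟩) b τ) = satL F π p S τ :=
  satL_congr F π S fun _ hx => change_of_lt π hp b τ hx.ne

theorem satL_subset (p : ℕ) (S : Finset (Fin m)) (τ : Fin n → Bool) :
    satL F π p S τ ⊆ (rem π p)ᶜ := by
  intro j
  simp only [satL, rem, Finset.mem_filter, Finset.mem_compl]
  intro h
  simp [h.2.1]

variable {π}

/-- The clause at position `p` if satisfied either way. -/
def hits (F : CNF m n) (π : Ordering m n) (p : ℕ) (e : Fin m ⊕ Fin n) (b : Bool)
    (S₁ S₂ : Finset (Fin m)) : Finset (Fin m) :=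
  hit F (rem π p) e b S₁ ∪ hit F (rem π p)ᶜ e b S₂

/-- S is a promise about later variables and is pulled back. An earlier clause promised at p + 1, or
satisfied by the value at p, is promised at p. A clause standing at p counts if it is in S or was
satisfied from the left. -/
theorem satL_succ {p : ℕ} (hp : p < m + n) (S : Finset (Fin m))
    (τ : Fin n → Bool) :
    satL F π (p + 1) S τ =
      satL F π p (advance F (rem π p)ᶜ (π.symm ⟨p, hp⟩) (choice τ (π.symm ⟨p, hp⟩)) S) τ ∪
      hits F π p (π.symm ⟨p, hp⟩) (choice τ (π.symm ⟨p, hp⟩)) (lset F π p τ) S := by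
  ext j
  have h := fun e => val_eq_iff π hp e
  have hs : ∀ e, (π e : ℕ) < p + 1 ↔ (π e : ℕ) < p ∨ (π e : ℕ) = p := fun e => by omega
  rcases he : π.symm ⟨p, hp⟩ with i | x
  · have hi : (π (.inl i) : ℕ) = p := by rw [h, he]
    by_cases hj : j = i
    · subst hj
      simp [satL, lset, advance, gain, here, hits, hit, hs, h, hi, he]
      exact or_comm
    · simp [satL, lset, advance, gain, here, hits, hit, hs, h, he, hj]
  · have hx : (π (.inr x) : ℕ) = p := by rw [h, he]
    simp [satL, advance, gain, here, choice, rem, hits, hit, hs, h, he, or_and_right, exists_or]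
    intro hj
    simp only [hj, and_true, or_assoc]
    exact or_congr Iff.rfl or_comm

theorem disjoint_hits {p : ℕ} (hp : p < m + n) (b : Bool) (S S₁ S₂ : Finset (Fin m))
    (τ : Fin n → Bool) :
    Disjoint (satL F π p S τ) (hits F π p (π.symm ⟨p, hp⟩) b S₁ S₂) := by
  rw [Finset.disjoint_left]
  intro j hj hj'
  have h := val_eq_iff π hp (.inl j)
  have h1 : j ∈ here (π.symm ⟨p, hp⟩) := by
    simp only [hits, hit, Finset.mem_union, Finset.mem_inter] at hj'
    tauto
  rcases he : π.symm ⟨p, hp⟩ with i | x <;> rw [he] at h1 h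
  · simp only [here, Finset.mem_singleton] at h1
    subst h1
    simp only [satL, Finset.mem_filter] at hj
    have := h.2 rfl
    omega
  · simp [here] at h1

theorem hits_subset (p : ℕ) (e : Fin m ⊕ Fin n) (b : Bool) (S₁ S₂ : Finset (Fin m)) :
    hits F π p e b S₁ S₂ ⊆ here e :=
  Finset.union_subset Finset.inter_subset_right Finset.inter_subset_right

theorem hits_inl {p : ℕ} {i : Fin m} {b : Bool} {S₁ S₂ : Finset (Fin m)}
    (h : (hits F π p (.inl i) b S₁ S₂ : Finset (Fin m)).Nonempty) :
    hits F π p (.inl i) b S₁ S₂ = {i} :=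
  (Finset.subset_singleton_iff.1 (hits_subset F p (.inl i) b S₁ S₂)).resolve_left h.ne_empty

theorem sum_hits (p : ℕ) (e : Fin m ⊕ Fin n) (b : Bool) (S₁ S₂ : Finset (Fin m)) :
    ∑ j ∈ hits F π p e b S₁ S₂, w j =
      if (hits F π p e b S₁ S₂).Nonempty then weightAt w e else 0 := by
  split_ifs with h
  · rcases e with i | x
    · rw [hits_inl F h, Finset.sum_singleton, weightAt]
    · simp [hits, hit, here] at h
  · rw [Finset.not_nonempty_iff_eq_empty] at h
    simp [h]

/-- The partial assignments up to `p` that give the set `S`. -/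
def block (F : CNF m n) (π : Ordering m n) (p : ℕ) (S : Finset (Fin m)) :
    Finset (Fin n → Bool) :=
  (leftA π p).filter fun τ => lset F π p τ = S

/-- The extensions to `e` by `b` of the partial assignments up to `p` that give the set `S`. -/
def branch (F : CNF m n) (π : Ordering m n) (p : ℕ) (e : Fin m ⊕ Fin n) (b : Bool)
    (S : Finset (Fin m)) : Finset (Fin n → Bool) :=
  (leftA π (p + 1)).filter fun τ => choice τ e = b ∧ lset F π p τ = S

theorem change_mem_leftA {p : ℕ} (hp : p < m + n) (b : Bool) {τ : Fin n → Bool}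
    (hτ : τ ∈ leftA π p) : change (π.symm ⟨p, hp⟩) b τ ∈ leftA π (p + 1) := by
  simp only [leftA, Finset.mem_filter, Finset.mem_univ, true_and] at hτ ⊢
  intro x hx
  rw [change_of_lt π hp b τ (by omega)]
  exact hτ x (by omega)

theorem change_false_mem_leftA {p : ℕ} (hp : p < m + n) {τ : Fin n → Bool}
    (hτ : τ ∈ leftA π (p + 1)) : change (π.symm ⟨p, hp⟩) false τ ∈ leftA π p := by
  simp only [leftA, Finset.mem_filter, Finset.mem_univ, true_and] at hτ ⊢
  intro x hx
  by_cases hxp : (π (.inr x) : ℕ) = p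
  · rw [← (val_eq_iff π hp _).1 hxp]
    simp [change]
  · rw [change_of_lt π hp false τ hxp]
    exact hτ x (by omega)

theorem change_change (e : Fin m ⊕ Fin n) (b b' : Bool) (τ : Fin n → Bool) :
    change e b (change e b' τ) = change e b τ := by
  cases e <;> simp [change]

theorem change_choice (e : Fin m ⊕ Fin n) (τ : Fin n → Bool) : change e (choice τ e) τ = τ := by
  cases e <;> simp [change, choice]

theorem change_false_of_mem_leftA {p : ℕ} (hp : p < m + n) {τ : Fin n → Bool}
    (hτ : τ ∈ leftA π p) : change (π.symm ⟨p, hp⟩) false τ = τ := by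
  rcases he : π.symm ⟨p, hp⟩ with i | x
  · rfl
  · simp only [leftA, Finset.mem_filter, Finset.mem_univ, true_and] at hτ
    have := hτ x ((val_eq_iff π hp _).2 he.symm).ge
    simp [change, ← this]

/-- Partial assignments are normalized to `false` from the cut on, so resetting the value at p to
`false` inverts the extension by b. With `change_injOn` this transports counts and maxima. -/
theorem branch_eq_image {p : ℕ} (hp : p < m + n) {b : Bool}
    (hb : b ∈ choices (π.symm ⟨p, hp⟩)) (S : Finset (Fin m)) :
    branch F π p (π.symm ⟨p, hp⟩) b S =
      (block F π p S).image (change (π.symm ⟨p, hp⟩) b) := by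
  ext τ
  simp only [branch, block, Finset.mem_filter, Finset.mem_image]
  constructor
  · rintro ⟨h1, rfl, rfl⟩
    refine ⟨change (π.symm ⟨p, hp⟩) false τ, ⟨change_false_mem_leftA hp h1, lset_change F π hp _ _⟩,
      ?_⟩
    rw [change_change, change_choice]
  · rintro ⟨τ, ⟨h1, rfl⟩, rfl⟩
    exact ⟨change_mem_leftA hp b h1, choice_change hb τ, lset_change F π hp _ _⟩

theorem change_injOn {p : ℕ} (hp : p < m + n) (b : Bool) (S : Finset (Fin m)) :
    Set.InjOn (change (π.symm ⟨p, hp⟩) b) (block F π p S : Set (Fin n → Bool)) := by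
  intro τ h τ' h' he
  have := congrArg (change (π.symm ⟨p, hp⟩) false) he
  rwa [change_change, change_change, change_false_of_mem_leftA hp (Finset.mem_filter.1 h).1,
    change_false_of_mem_leftA hp (Finset.mem_filter.1 h').1] at this

/-- The variable at p is still `false`, so its digit is 0 and setting it is a single addition. -/
theorem enc_change {p : ℕ} (hp : p < m + n) (b : Bool) {τ : Fin n → Bool} (hτ : τ ∈ leftA π p) :
    enc (change (π.symm ⟨p, hp⟩) b τ) = enc τ + encGain b (π.symm ⟨p, hp⟩) := by
  rcases he : π.symm ⟨p, hp⟩ with i | x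
  · rfl
  · simp only [leftA, Finset.mem_filter, Finset.mem_univ, true_and] at hτ
    have hx := hτ x ((val_eq_iff π hp _).2 he.symm).ge
    cases b
    · simp [change, encGain, ← hx]
    · have : (Finset.univ.filter fun y => Function.update τ x true y = true) =
          (Finset.univ.filter fun y => τ y = true) ∪ {x} := by
        ext y
        by_cases hy : y = x
        · simp [hy]
        · simp [hy]
      rw [enc, change, this, code_union_of_disjoint (by simp [hx])]
      simp [enc, encGain]
      omega

/-- The element at `p` is no unsatisfied clause. -/
def Keep (F : CNF m n) (π : Ordering m n) (p : ℕ) (e : Fin m ⊕ Fin n) (b : Bool)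
    (S₁ S₂ : Finset (Fin m)) : Prop :=
  here e = ∅ ∨ (hits F π p e b S₁ S₂).Nonempty

theorem satL_change_succ {p : ℕ} (hp : p < m + n) {b : Bool}
    (hb : b ∈ choices (π.symm ⟨p, hp⟩)) (S : Finset (Fin m)) (τ : Fin n → Bool) :
    satL F π (p + 1) S (change (π.symm ⟨p, hp⟩) b τ) =
      satL F π p (advance F (rem π p)ᶜ (π.symm ⟨p, hp⟩) b S) τ ∪
      hits F π p (π.symm ⟨p, hp⟩) b (lset F π p τ) S := by
  rw [satL_succ, choice_change hb, satL_change, lset_change]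

-- The satisfied clauses grow by `hits`, which depends on b, S₁ and S₂ but not on the assignment
-- within the block. All weights therefore shift by the same amount and maximizers remain
-- maximizers. The assignments counted all stay, or all drop out when the element is an unsatisfied
-- clause.
open Classical in
theorem Rep.move {p : ℕ} (hp : p < m + n) {b : Bool} (hb : b ∈ choices (π.symm ⟨p, hp⟩))
    {S₁ S₂ : Finset (Fin m)} {c v a : ℤ} (hne : (block F π p S₁).Nonempty)
    (h : Rep F π w p (advance F (rem π p)ᶜ (π.symm ⟨p, hp⟩) b S₂) (block F π p S₁) c v a) :
    Rep F π w (p + 1) S₂ (branch F π p (π.symm ⟨p, hp⟩) b S₁)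
      (if Keep F π p (π.symm ⟨p, hp⟩) b S₁ S₂ then c else 0)
      (v + if Keep F π p (π.symm ⟨p, hp⟩) b S₁ S₂ then weightAt w (π.symm ⟨p, hp⟩) else 0)
      (a + encGain b (π.symm ⟨p, hp⟩)) := by
  have hS : ∀ τ ∈ block F π p S₁, satL F π (p + 1) S₂ (change (π.symm ⟨p, hp⟩) b τ) =
      satL F π p (advance F (rem π p)ᶜ (π.symm ⟨p, hp⟩) b S₂) τ ∪
      hits F π p (π.symm ⟨p, hp⟩) b S₁ S₂ := by
    intro τ hτ
    rw [satL_change_succ F hp hb, (Finset.mem_filter.1 hτ).2]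
  have hw : ∀ τ ∈ block F π p S₁,
      ∑ j ∈ satL F π (p + 1) S₂ (change (π.symm ⟨p, hp⟩) b τ), w j =
      ∑ j ∈ satL F π p (advance F (rem π p)ᶜ (π.symm ⟨p, hp⟩) b S₂) τ, w j +
      if Keep F π p (π.symm ⟨p, hp⟩) b S₁ S₂ then weightAt w (π.symm ⟨p, hp⟩) else 0 := by
    intro τ hτ
    rw [hS τ hτ, Finset.sum_union (disjoint_hits F hp _ _ _ _ _), sum_hits]
    congr 1
    -- At a variable `Keep` holds while `hits` is empty, but there the weight is 0, so the two
    -- conditions give the same summand.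
    unfold Keep
    rcases π.symm ⟨p, hp⟩ with i | x <;> simp [here, weightAt]
  have hfull : ∀ τ ∈ block F π p S₁,
      (satL F π (p + 1) S₂ (change (π.symm ⟨p, hp⟩) b τ) = (rem π (p + 1))ᶜ ↔
      Keep F π p (π.symm ⟨p, hp⟩) b S₁ S₂ ∧
      satL F π p (advance F (rem π p)ᶜ (π.symm ⟨p, hp⟩) b S₂) τ = (rem π p)ᶜ) := by
    intro τ hτ
    rw [hS τ hτ, rem_succ π hp]
    have hd := disjoint_hits F (π := π) hp b (advance F (rem π p)ᶜ (π.symm ⟨p, hp⟩) b S₂) S₁ S₂ τ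
    have hsub := satL_subset F π p (advance F (rem π p)ᶜ (π.symm ⟨p, hp⟩) b S₂) τ
    have hh := hits_subset F (π := π) p (π.symm ⟨p, hp⟩) b S₁ S₂
    generalize satL F π p (advance F (rem π p)ᶜ (π.symm ⟨p, hp⟩) b S₂) τ = T at *
    unfold Keep
    have hpe := val_eq_iff π hp
    rcases he : π.symm ⟨p, hp⟩ with i | x <;> rw [he] at hd hh
    · have hi : i ∈ rem π p := by simp [rem, (hpe (.inl i)).2 he.symm]
      have hiT : i ∉ T := fun hT => by simpa [hi] using hsub hT
      have hc : (rem π p \ here (n := n) (.inl i))ᶜ = insert i (rem π p)ᶜ := by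
        ext j; by_cases hj : j = i <;> simp [here, hj]
      rw [hc]
      by_cases hn : (hits F π p (.inl i) b S₁ S₂ : Finset (Fin m)).Nonempty
      · rw [hits_inl F hn, Finset.union_comm, ← Finset.insert_eq]
        simp only [here, Finset.singleton_nonempty, or_true, true_and]
        constructor
        · intro h
          rw [← Finset.erase_insert hiT, h, Finset.erase_insert (by simpa using hi)]
        · rintro rfl; rfl
      · rw [Finset.not_nonempty_iff_eq_empty] at hn
        rw [hn, Finset.union_empty]
        simp only [here, Finset.singleton_ne_empty, Finset.not_nonempty_empty, or_self, false_and,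
          iff_false]
        rintro rfl
        exact hiT (Finset.mem_insert_self _ _)
    · rw [Finset.subset_empty.1 hh]
      simp [here]
  rw [branch_eq_image F hp hb]
  constructor
  · rw [Finset.filter_image, Finset.card_image_of_injOn
      ((change_injOn F hp b S₁).mono (Finset.coe_subset.2 (Finset.filter_subset _ _))),
      Finset.filter_congr hfull]
    split_ifs with hk
    · simp only [hk, true_and]
      exact h.count
    · simp [hk]
  · intro he
    exact absurd (Finset.image_eq_empty.1 he) hne.ne_empty
  · intro _
    obtain ⟨τ, hτ, rfl, rfl, hmax⟩ := h.best hne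
    refine ⟨_, Finset.mem_image_of_mem _ hτ, ?_, (hw τ hτ).symm, ?_⟩
    · rw [enc_change hp b (Finset.mem_filter.1 hτ).1]
      push_cast; rfl
    · intro τ' hτ'
      obtain ⟨τ₀, h0, rfl⟩ := Finset.mem_image.1 hτ'
      rw [hw τ₀ h0]
      exact add_le_add_left (hmax τ₀ h0) _

theorem enc_pos (τ : Fin n → Bool) : 0 < enc τ := Nat.succ_pos _

/-- Weights may be negative, so no initial weight can stand for an empty set of assignments. That
role is played by a = 0, since codes of assignments are positive. Disjointness matters for the
count, not for the maximum. -/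
theorem Rep.union {p : ℕ} {S : Finset (Fin m)} {X Y : Finset (Fin n → Bool)}
    {c v a c' v' a' : ℤ} (h : Rep F π w p S X c v a) (h' : Rep F π w p S Y c' v' a')
    (hd : Disjoint X Y) (hY : Y.Nonempty) :
    Rep F π w p S (X ∪ Y) (c + c') (if 0 < a ∧ ¬ 0 < v' - v then v else v')
      (if 0 < a ∧ ¬ 0 < v' - v then a else a') := by
  constructor
  · rw [h.count, h'.count, Finset.filter_union, Finset.card_union_of_disjoint
      (Finset.disjoint_filter_filter hd)]
    push_cast; rfl
  · intro he
    exact absurd (Finset.union_eq_empty.1 he).2 hY.ne_empty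
  · intro _
    obtain ⟨τ', hτ', ha', hv', hm'⟩ := h'.best hY
    split_ifs with hc
    · have hX : X.Nonempty := by
        rw [Finset.nonempty_iff_ne_empty]
        intro he
        have := h.empty he
        omega
      obtain ⟨τ, hτ, ha, hv, hm⟩ := h.best hX
      refine ⟨τ, Finset.mem_union_left _ hτ, ha, hv, fun σ hσ => ?_⟩
      rcases Finset.mem_union.1 hσ with hσ | hσ
      · exact hm σ hσ
      · have := hm' σ hσ
        omega
    · refine ⟨τ', Finset.mem_union_right _ hτ', ha', hv', fun σ hσ => ?_⟩
      rcases Finset.mem_union.1 hσ with hσ | hσ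
      · obtain ⟨τ, hτ, ha, hv, hm⟩ := h.best ⟨σ, hσ⟩
        have := hm σ hσ
        have := enc_pos τ
        have : ¬ (0 < v' - v → False) := fun hh => hc ⟨by omega, hh⟩
        omega
      · exact hm' σ hσ

theorem Rep.zero (p : ℕ) (S : Finset (Fin m)) (v : ℤ) : Rep F π w p S ∅ 0 v 0 :=
  ⟨by simp, fun _ => rfl, fun h => absurd h (by simp)⟩

theorem Rep.first : Rep F π w 0 ∅ (block F π 0 ∅) 1 0 1 := by
  have hb : block F π 0 ∅ = {fun _ => false} := by
    ext τ
    simp [block, leftA, lset_zero, funext_iff]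
  have hs : ∀ τ, satL F π 0 ∅ τ = ∅ := by intro τ; simp [satL]
  rw [hb]
  constructor
  · simp [hs, rem_zero, Finset.filter_singleton]
  · simp
  · intro _
    exact ⟨_, Finset.mem_singleton_self _, by simp [enc], by simp [hs], by simp [hs]⟩

theorem mem_satL_last (τ : Fin n → Bool) (j : Fin m) :
    j ∈ satL F π (m + n) ∅ τ ↔ F.SatClause τ j := by
  simp only [satL, Finset.mem_filter, Finset.mem_univ, Fin.is_lt, true_and, Finset.notMem_empty,
    false_or, CNF.SatClause]
  constructor
  · rintro ⟨x, hx⟩; exact ⟨_, hx, rfl⟩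
  · rintro ⟨⟨x, b⟩, hx, hb⟩
    dsimp only at hb
    subst hb
    exact ⟨x, hx⟩

/-- After the last element nothing is normalized and nothing is promised: the block consists of all
assignments, and `satL` is the set of clauses that are really satisfied. -/
theorem Rep.last {c v a : ℤ} (h : Rep F π w (m + n) ∅ (block F π (m + n) ∅) c v a) :
    c = F.numSat ∧ ∃ τ : Fin n → Bool, a = enc τ ∧ v = F.satWeight w τ ∧
      ∀ τ', F.satWeight w τ' ≤ F.satWeight w τ := by
  have hb : block F π (m + n) ∅ = Finset.univ := by
    ext τ
    simp only [block, leftA, lset_last, Finset.mem_filter, Finset.mem_univ, true_and, and_true,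
      iff_true]
    intro x hx
    have := (π (.inr x)).2
    omega
  have hs : ∀ τ, satL F π (m + n) ∅ τ = Finset.univ.filter fun j => F.SatClause τ j := by
    intro τ; ext j; simp [mem_satL_last]
  rw [hb] at h
  constructor
  · rw [h.count, CNF.numSat]
    congr 2
    ext τ
    simp [rem_last, hs, Finset.filter_eq_self]
  · obtain ⟨τ, -, ha, hv, hmax⟩ := h.best Finset.univ_nonempty
    refine ⟨τ, ha, by rw [hv, hs]; rfl, fun τ' => ?_⟩
    have := hmax τ' (Finset.mem_univ _)
    rw [hv, hs, hs] at this
    exact this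

end Tables

end KInterval

namespace KInterval

/-! ### Memory layout -/

section Layout

/-- The address of the entry `c` of row `z` of a table with rows of length `W`, stored downwards from
`-D`. -/
def cell (D W z c : ℕ) : ℤ := -((D + W * z + c : ℕ) : ℤ)

theorem cell_le (D W z c : ℕ) : cell D W z c ≤ -D := by
  unfold cell; push_cast; nlinarith [Nat.zero_le (W * z)]

theorem cell_inj {D W z z' c c' : ℕ} (hc : c < W) (hc' : c' < W)
    (h : cell D W z c = cell D W z' c') : z = z' ∧ c = c' := by
  have h1 : W * z + c = W * z' + c' := by unfold cell at h; push_cast at h; zify; linarith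
  have hW : 0 < W := by omega
  have hz : z = z' := by
    have := congrArg (· / W) h1
    simpa [Nat.mul_add_div hW, Nat.div_eq_of_lt hc, Nat.div_eq_of_lt hc'] using this
  subst hz
  exact ⟨rfl, by omega⟩

theorem cell_sub (D W z c c' : ℕ) : cell D W z c - c' = cell D W z (c + c') := by
  unfold cell; push_cast; ring

theorem cell_sub_row (D W z k c : ℕ) : cell D W z c - W * k = cell D W (z + k) c := by
  unfold cell; push_cast; ring

variable {m n : ℕ}

/-- The address of entry `c` of row `z`. -/
def loc (m n z c : ℕ) : ℤ := cell (3 * n + 2) (2 ^ m + 1) z c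

/-- All statements that a write leaves other entries alone come from here. Row 5p holds the family
of the ordering at p, row 5p + 1 that of the reversed ordering at its position p, and rows 5p + 2,
5p + 3, 5p + 4 hold count, weight and assignment. The extra column leaves room for the head of a
list. -/
theorem loc_inj {z z' c c' : ℕ} (hc : c < 2 ^ m + 1) (hc' : c' < 2 ^ m + 1)
    (h : loc m n z c = loc m n z' c') : z = z' ∧ c = c' := cell_inj hc hc' h

theorem loc_sub (z c c' : ℕ) : loc m n z c - c' = loc m n z (c + c') := cell_sub _ _ _ _ _

end Layout

/-! ### Linked lists -/

section Lists

variable {m : ℕ}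

/-- The cells of `f` link the entries of `l`, starting with the cell `c`. -/
def Chain (f : ℕ → ℤ) : ℕ → List (Finset (Fin m)) → Prop
  | c, [] => c = 0
  | c, S :: l => c = code S + 1 ∧ ∃ c' : ℕ, f c = c' + 1 ∧ Chain f c' l

/-- The row `f` holds the linked list `l`. -/
structure ListRow (f : ℕ → ℤ) (l : List (Finset (Fin m))) : Prop where
  chain : ∃ c : ℕ, f 0 = c + 1 ∧ Chain f c l
  absent : ∀ S, S ∉ l → f (code S + 1) = 0
  nodup : l.Nodup

theorem Chain.congr {f g : ℕ → ℤ} {c : ℕ} {l : List (Finset (Fin m))} (h : Chain f c l)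
    (hfg : ∀ S ∈ l, f (code S + 1) = g (code S + 1)) : Chain g c l := by
  induction l generalizing c with
  | nil => exact h
  | cons S l ih =>
    obtain ⟨rfl, c', h1, h2⟩ := h
    refine ⟨rfl, c', ?_, ih h2 fun S' hS' => hfg S' (List.mem_cons_of_mem _ hS')⟩
    rw [← hfg S List.mem_cons_self, h1]

theorem Chain.pos {f : ℕ → ℤ} {c : ℕ} {l : List (Finset (Fin m))} (h : Chain f c l)
    {S : Finset (Fin m)} (hS : S ∈ l) : 0 < f (code S + 1) := by
  induction l generalizing c with
  | nil => simp at hS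
  | cons S' l ih =>
    obtain ⟨rfl, c', h1, h2⟩ := h
    rcases List.mem_cons.1 hS with rfl | hS
    · rw [h1]; omega
    · exact ih h2 hS

theorem ListRow.congr {f g : ℕ → ℤ} {l : List (Finset (Fin m))} (h : ListRow f l)
    (hfg : ∀ c < 2 ^ m + 1, f c = g c) : ListRow g l := by
  have hfg' : ∀ S : Finset (Fin m), f (code S + 1) = g (code S + 1) := fun S =>
    hfg _ (by have := code_lt S; omega)
  obtain ⟨c, h1, h2⟩ := h.chain
  exact ⟨⟨c, by rw [← hfg 0 (Nat.succ_pos _), h1], h2.congr fun S _ => hfg' S⟩,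
    fun S hS => by rw [← hfg' S, h.absent S hS], h.nodup⟩

/-- A link is stored increased by 1, so even the last entry has a positive cell and 0 is free to
mean absence. Membership is thus tested by one memory access in a row that needed no initialization.
-/
theorem ListRow.pos_iff {f : ℕ → ℤ} {l : List (Finset (Fin m))} (h : ListRow f l)
    (S : Finset (Fin m)) : 0 < f (code S + 1) ↔ S ∈ l := by
  constructor
  · intro hp
    by_contra hS
    rw [h.absent S hS] at hp
    exact lt_irrefl _ hp
  · obtain ⟨c, -, h2⟩ := h.chain
    exact h2.pos

theorem ListRow.cons {f g : ℕ → ℤ} {l : List (Finset (Fin m))} (h : ListRow f l)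
    {S : Finset (Fin m)} (hS : S ∉ l) (h0 : g 0 = code S + 2) (h1 : g (code S + 1) = f 0)
    (h2 : ∀ S', S' ≠ S → g (code S' + 1) = f (code S' + 1)) : ListRow g (S :: l) := by
  obtain ⟨c, hc, hl⟩ := h.chain
  refine ⟨⟨code S + 1, by rw [h0]; push_cast; ring, rfl, c, by rw [h1, hc], hl.congr ?_⟩, ?_,
    List.nodup_cons.2 ⟨hS, h.nodup⟩⟩
  · intro S' hS'
    exact (h2 S' fun he => hS (he ▸ hS')).symm
  · intro S' hS'
    rw [List.mem_cons, not_or] at hS'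
    rw [h2 S' hS'.1, h.absent S' hS'.2]

theorem ListRow.nil {f : ℕ → ℤ} (h0 : f 0 = 1)
    (h : ∀ S : Finset (Fin m), f (code S + 1) = 0) : ListRow f ([] : List (Finset (Fin m))) :=
  ⟨⟨0, by simp [h0], rfl⟩, fun S _ => h S, List.nodup_nil⟩

/-- For each entry of the linked list in the row with the address in register `base`, run `body`
with the code of the entry in register `S`. -/
def forList (base c S a : ℕ) (body : Prog) : Prog := seqs
  [.load c base, .sub c c 5,
   .whilePos c (seqs [.sub S c 5, body, .sub a base c, .load c a, .sub c c 5])]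

/-- `J` is an invariant of the memory alone, indexed by the entries already treated; it must keep
the traversed row intact. The body may use the registers from k' on, the loop as a whole those from
k on, so loops nest with increasing bounds. -/
theorem wp_forList {base c S a k k' : ℕ} {body : Prog} {s₀ : State} {f : ℕ → ℤ}
    {l : List (Finset (Fin m))} (T : ℕ) (J : List (Finset (Fin m)) → (ℤ → ℤ) → Prop)
    (hk : base < k ∧ 5 < k ∧ k ≤ c ∧ k ≤ S ∧ k ≤ a ∧ c ≠ S ∧ c ≠ a ∧ c < k')
    (hf : ListRow f l) (h5 : s₀.reg 5 = 1)
    (hrow : ∀ d mem, J d mem → ∀ x < 2 ^ m + 1, mem (s₀.reg base - (x : ℕ)) = f x)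
    (h0 : J [] s₀.mem)
    (hbody : ∀ d A r s, l = d ++ A :: r → Same k s₀ s → s.reg S = code A → J d s.mem →
      Wp body s (fun t s' => t ≤ T ∧ Same k' s s' ∧ J (d ++ [A]) s'.mem)) :
    Wp (forList base c S a body) s₀
      (fun t s' => t ≤ l.length * (T + 5 + 1) + 5 ∧ Same k s₀ s' ∧ J l s'.mem) := by
  obtain ⟨k1, k2, k3, k4, k5, k6, k7, k8⟩ := hk
  have e1 : base ≠ c := by omega
  have e2 : base ≠ a := by omega
  have e3 : 5 ≠ c := by omega
  have e4 : 5 ≠ a := by omega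
  have e5 : c ≠ base := by omega
  have e6 : 5 ≠ S := by omega
  have e7 : base ≠ S := by omega
  simp only [forList, wp_seqs_cons, wp_load, wp_sub, wp_seqs_nil]
  obtain ⟨c₀, hc₀, hch⟩ := hf.chain
  have hfst := hrow [] _ h0 0 (Nat.succ_pos _)
  simp only [Nat.cast_zero, sub_zero] at hfst
  refine (wp_while_list (fun d r s => l = d ++ r ∧ Same k s₀ s ∧ J d s.mem ∧
    ∃ x : ℕ, s.reg c = x ∧ Chain f x r) (T + 5) ?_ ?_ ?_ ?_ (l := l)).mono ?_
  · rintro d A r s ⟨-, -, -, x, hx, rfl, -⟩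
    rw [hx]; positivity
  · rintro d s ⟨-, -, -, x, hx, rfl⟩
    simp [hx]
  · rintro d A r s ⟨hl, hs, hJ, x, hx, rfl, x', hx', hr⟩
    simp only [wp_seqs_cons, wp_load, wp_sub, wp_seqs_nil]
    refine (hbody d A r _ hl ((same_setReg k4).2 hs) ?_ hJ).mono ?_
    · simp [hx, hs 5 k2, h5]
    · rintro t s' ⟨ht, hs', hJ'⟩
      have hs'' : Same k s₀ s' := ((same_setReg k4).2 hs).trans (hs'.mono (by omega))
      have hc' : s'.reg c = code A + 1 := by
        rw [hs' c k8, reg_setReg, if_neg k6, hx]; push_cast; rfl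
      have hcell : s'.mem (s₀.reg base - (code A + 1)) = x' + 1 := by
        have h := hrow _ _ hJ' (code A + 1) (by have := code_lt A; omega)
        rw [hx'] at h
        rw [← h]; push_cast; rfl
      refine ⟨by omega, by simp [hl], ?_, ?_, x', ?_, hr⟩
      · simp only [same_setReg, k3, k5, hs'']
      · simpa using hJ'
      · simp [e3, e4, hs'' base k1, hs'' 5 k2, h5, hc', hcell]
  · refine ⟨by simp, by simp [same_setReg, k3], by simpa using h0, c₀, ?_, hch⟩
    simp [e3, hfst, hc₀, h5]
  · rintro t s' ⟨ht, -, hs, hJ, -⟩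
    exact ⟨by omega, hs, hJ⟩

/-- Insert the set coded in register `43` into the linked list in the row with the address in
register `19`. -/
def insertProg : Prog := seqs
  [.add 60 43 5, .sub 61 19 60, .load 62 61,
   .ifPos 62 .skip (seqs [.load 63 19, .store 61 63, .add 64 60 5, .store 19 64])]

theorem wp_insert {n z : ℕ} {s : State} {l : List (Finset (Fin m))} (S : Finset (Fin m))
    (h5 : s.reg 5 = 1) (h19 : s.reg 19 = loc m n z 0) (h43 : s.reg 43 = code S)
    (hl : ListRow (fun c => s.mem (loc m n z c)) l) :
    Wp insertProg s (fun t s' => t ≤ 10 ∧ Same 60 s s' ∧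
      (∃ l', ListRow (fun c => s'.mem (loc m n z c)) l' ∧ ∀ A, A ∈ l' ↔ A ∈ l ∨ A = S) ∧
      ∀ x, (∀ c < 2 ^ m + 1, x ≠ loc m n z c) → s'.mem x = s.mem x) := by
  have hS := code_lt S
  have haddr : loc m n z 0 - ((code S : ℤ) + 1) = loc m n z (code S + 1) := by
    have := loc_sub (m := m) (n := n) z 0 (code S + 1)
    rw [zero_add] at this
    rw [← this]; push_cast; rfl
  simp only [insertProg, wp_seqs_cons, wp_add, wp_sub, wp_load, wp_store, wp_ifPos, wp_skip,
    wp_seqs_nil, reg_setReg, mem_setReg, reg_setMem, mem_setMem, Nat.reduceEqDiff, if_true,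
    if_false, h5, h19, h43, haddr]
  have hp := hl.pos_iff S
  split_ifs with h
  · refine ⟨by omega, by simp [same_setReg], ⟨l, hl, fun A => ?_⟩, fun _ _ => trivial⟩
    have := hp.1 h
    exact ⟨Or.inl, fun h => h.elim id fun h => by rwa [h]⟩
  · refine ⟨by omega, by simp [same_setReg], ⟨S :: l, hl.cons (fun hh => h (hp.2 hh)) ?_ ?_ ?_,
      fun A => by simp [or_comm]⟩, fun x hx => ?_⟩
    · simp; ring
    · have hne : loc m n z (code S + 1) ≠ loc m n z 0 := fun he => by
        have := (loc_inj (by omega) (by omega) he).2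
        omega
      simp [hne]
    · intro S' hS'
      have hS'' := code_lt S'
      have hne : loc m n z (code S' + 1) ≠ loc m n z 0 := fun he => by
        have := (loc_inj (by omega) (by omega) he).2
        omega
      have hne' : loc m n z (code S' + 1) ≠ loc m n z (code S + 1) :=
        fun he => hS' (code_injective (by
          have := (loc_inj (by omega) (by omega) he).2
          omega))
      simp [hne, hne']
    · rw [Function.update_of_ne (hx 0 (by omega)), Function.update_of_ne (hx _ (by omega))]

/-- With codes of `S`, `X`, `B` in registers `80`, `81`, `22`, compute the codes of `(S ∪ X) \ B` in
`82` and of `(S ∪ X) ∩ B` in `83`. -/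
def applyProg : Prog := seqs
  [mov 100 80, mov 101 81, interProg, .add 84 80 81, .sub 84 84 102, mov 100 84, mov 101 22,
   interProg, mov 83 102, .sub 82 84 102]

/-- The union is a sum minus an intersection, and the difference is a subtraction of an
intersection, so two digit loops suffice. With X a gain and B the clause at the element, the results
are `advance` and `hit`. -/
theorem wp_apply {n : ℕ} {s : State} (S X B : Finset (Fin m)) (hg : Glob m n s)
    (hS : s.reg 80 = code S) (hX : s.reg 81 = code X) (hB : s.reg 22 = code B) :
    Wp applyProg s (fun t s' => t ≤ 60 * (m + 1) ∧ s'.mem = s.mem ∧ Same 80 s s' ∧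
      s'.reg 82 = code ((S ∪ X) \ B) ∧ s'.reg 83 = code ((S ∪ X) ∩ B)) := by
  obtain ⟨h1, -, h3, h5, h6, -, -, -⟩ := hg
  simp only [applyProg, wp_seqs_cons, wp_add]
  refine (wp_inter S X (by simp [h1]) (by simp [h3]) (by simp [h5]) (by simp [h6])
    (by simp [h6, hS]) (by simp [h6, hX])).mono ?_
  rintro t s₁ ⟨ht, hm, hs, hr⟩
  simp only [wp_sub]
  have f1 : s₁.reg 1 = m := by rw [hs 1 (by norm_num)]; simp [h1]
  have f3 : s₁.reg 3 = 2 ^ m := by rw [hs 3 (by norm_num)]; simp [h3]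
  have f5 : s₁.reg 5 = 1 := by rw [hs 5 (by norm_num)]; simp [h5]
  have f6 : s₁.reg 6 = 0 := by rw [hs 6 (by norm_num)]; simp [h6]
  have f22 : s₁.reg 22 = code B := by rw [hs 22 (by norm_num)]; simp [hB]
  have f80 : s₁.reg 80 = code S := by rw [hs 80 (by norm_num)]; simp [hS]
  have f81 : s₁.reg 81 = code X := by rw [hs 81 (by norm_num)]; simp [hX]
  have hu : (code S + code X - code (S ∩ X) : ℤ) = code (S ∪ X) := by
    have := code_union_add_inter S X
    omega
  have hu' : ((code (S ∪ X) : ℕ) - code ((S ∪ X) ∩ B) : ℤ) = code ((S ∪ X) \ B) := by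
    have := code_sdiff_add_inter (S ∪ X) B
    omega
  refine (wp_inter (S ∪ X) B (by simp [f1]) (by simp [f3]) (by simp [f5]) (by simp [f6])
    (by simp [f6, f80, f81, hr, hu]) (by simp [f6, f22])).mono ?_
  rintro t' s₂ ⟨ht', hm', hs', hr'⟩
  have g6 : s₂.reg 6 = 0 := by rw [hs' 6 (by norm_num)]; simp [f6]
  have g84 : s₂.reg 84 = code (S ∪ X) := by
    rw [hs' 84 (by norm_num)]; simp [f80, f81, hr, hu]
  have hsame : Same 80 s s₂ := by
    have h1 : Same 80 s s₁ := by
      refine Same.trans ?_ (hs.mono (by norm_num)); simp [same_setReg]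
    refine h1.trans (Same.trans ?_ (hs'.mono (by norm_num))); simp [same_setReg]
  simp only [wp_seqs_nil]
  refine ⟨by omega, by simp [hm, hm'], by simp [same_setReg, hsame], ?_, ?_⟩
  · simp [g84, hr', hu']
  · simp [hr', g6]

end Lists

end KInterval

namespace KInterval

/-! ### Steps along the ordering -/

section Moves

variable {m n : ℕ}

/-- The part of the memory that holds the tables of the input. -/
structure Low (F : CNF m n) (w : Fin m → ℤ) (π : Ordering m n) (mem : ℤ → ℤ) : Prop where
  lit : ∀ l, mem (-(n + 1) + encodeLiteral l) = code (lits F l.1 l.2)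
  pow : ∀ x : Fin n, mem (-(n + 1) - n - (x + 1)) = 2 ^ (x : ℕ)
  weight : ∀ j : Fin m, mem (m + n + 1 + (j + 1)) = w j
  order : ∀ p : Fin (m + n), mem (2 + p) = encodeElement (π.symm p)

/-- The memory outside of the tables is unchanged. -/
def SameLow (n : ℕ) (mem mem' : ℤ → ℤ) : Prop :=
  ∀ a : ℤ, -((3 * n + 2 : ℕ) : ℤ) < a → mem' a = mem a

theorem Low.congr {F : CNF m n} {w : Fin m → ℤ} {π : Ordering m n} {mem mem' : ℤ → ℤ}
    (h : Low F w π mem) (h' : SameLow n mem mem') : Low F w π mem' := by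
  constructor
  · rintro ⟨x, b⟩
    rw [h' _ ?_, h.lit]
    unfold encodeLiteral
    push_cast
    have := x.2
    cases b <;> simp <;> omega
  · intro x
    rw [h' _ ?_, h.pow]
    have := x.2
    push_cast; omega
  · intro j; rw [h' _ (by push_cast; omega), h.weight]
  · intro p; rw [h' _ (by push_cast; omega), h.order]

/-- The registers describe the value `b` at the element `e`. -/
structure MoveRegs (F : CNF m n) (w : Fin m → ℤ) (R : Finset (Fin m)) (e : Fin m ⊕ Fin n)
    (b : Bool) (s : State) : Prop where
  r20 : s.reg 20 = code (gain F R b e)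
  r21 : s.reg 21 = code (gain F Rᶜ b e)
  r22 : s.reg 22 = code (here e)
  r23 : s.reg 23 = if here e = ∅ then 1 else 0
  r24 : s.reg 24 = encGain b e
  r25 : s.reg 25 = weightAt w e

/-- The gains of the literal with the table entry addressed by register `27`, split by the
set in register `28`. -/
def gainProg : Prog := seqs
  [.load 100 27, mov 101 28, mov 21 100, interProg, mov 20 102, .sub 21 21 20]

theorem wp_gain {s : State} (A R : Finset (Fin m)) (hg : Glob m n s)
    (hA : s.mem (s.reg 27) = code A) (hR : s.reg 28 = code R) :
    Wp gainProg s (fun t s' => t ≤ 30 * (m + 1) ∧ s'.mem = s.mem ∧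
      (∀ r < 40, r ≠ 20 → r ≠ 21 → s'.reg r = s.reg r) ∧ s'.reg 20 = code (A ∩ R) ∧
      s'.reg 21 = code (A ∩ Rᶜ)) := by
  obtain ⟨h1, -, h3, h5, h6, -, -, -⟩ := hg
  simp only [gainProg, wp_seqs_cons, wp_add, wp_load]
  refine (wp_inter A R (by simp [h1]) (by simp [h3]) (by simp [h5]) (by simp [h6])
    (by simp [hA]) (by simp [h6, hR])).mono ?_
  rintro t s₁ ⟨ht, hm, hs, hr⟩
  have f6 : s₁.reg 6 = 0 := by rw [hs 6 (by norm_num)]; simp [h6]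
  have f21 : s₁.reg 21 = code A := by rw [hs 21 (by norm_num)]; simp [h6, hA]
  have hd : (code A - code (A ∩ R) : ℤ) = code (A ∩ Rᶜ) := by
    rw [← Finset.sdiff_eq_inter_compl]
    have := code_sdiff_add_inter A R
    omega
  simp only [wp_sub, wp_seqs_nil]
  refine ⟨by omega, by simp [hm], fun r hr h20 h21 => ?_, by simp [hr, f6], by simp [f6, f21, hr, hd]⟩
  simp only [reg_setReg, h20, h21, if_false, hs r (by omega)]
  rw [if_neg (by omega), if_neg (by omega)]

/-- Run `body` for each value to be tried at the element addressed by register `11`; register `28`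
holds the set of the clauses not yet passed. -/
def forMoves (body : Prog) : Prog := seqs
  [.load 26 11,
   .ifPos 26
    (seqs [.const 22 0, .const 23 1, .const 24 0, .const 25 0, .sub 27 7 26, gainProg, body,
      .sub 27 7 2, .sub 27 27 26, .load 24 27, .add 27 7 26, gainProg, body])
    (seqs [.sub 27 6 26, .add 25 9 27, .load 25 25, .sub 100 27 5, powProg, mov 22 101,
      .const 23 0, .const 24 0, .const 20 0, .const 21 0, body, .sub 28 28 22])]

/-- `J` is indexed by the values already tried and must preserve the input tables, which are read
again for the second value. Registers below 20 are kept throughout, those from 20 to 39 describe the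
move, and the body works from 40 on. -/
theorem wp_forMoves {body : Prog} {F : CNF m n} {w : Fin m → ℤ} {π : Ordering m n} {s₀ : State}
    {e : Fin m ⊕ Fin n} {R : Finset (Fin m)} (T : ℕ) (J : List Bool → (ℤ → ℤ) → Prop)
    (hg : Glob m n s₀) (hJ : ∀ d mem, J d mem → Low F w π mem)
    (he : s₀.mem (s₀.reg 11) = encodeElement e) (hR : s₀.reg 28 = code R) (heR : here e ⊆ R)
    (h0 : J [] s₀.mem)
    (hbody : ∀ d b r s, choices e = d ++ b :: r → Same 20 s₀ s → MoveRegs F w R e b s →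
      J d s.mem → Wp body s (fun t s' => t ≤ T ∧ Same 40 s s' ∧ J (d ++ [b]) s'.mem)) :
    Wp (forMoves body) s₀ (fun t s' => t ≤ 2 * T + 100 * (m + 1) ∧ Same 20 s₀ s' ∧
      s'.reg 28 = code (R \ here e) ∧ J (choices e) s'.mem) := by
  have hg' := hg
  obtain ⟨h1, h2, h3, h5, h6, h7, h8, h9⟩ := hg
  have hlow := hJ _ _ h0
  simp only [forMoves, wp_seqs_cons, wp_load, wp_ifPos]
  rcases e with j | x
  · have hneg : ¬ (0 < (s₀.setReg 26 (s₀.mem (s₀.reg 11))).reg 26) := by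
      simp [he, encodeElement]
    rw [if_neg hneg]
    simp only [wp_sub, wp_add]
    refine (wp_pow (j : ℕ) (by simp [h5]) (by simp [h6, he, encodeElement, h5])).mono ?_
    rintro t s₁ ⟨ht, hm, hs, hr⟩
    have hw : s₀.mem (m + n + 1 + ((j : ℤ) + 1)) = w j := hlow.weight j
    have f6 : s₁.reg 6 = 0 := by rw [hs 6 (by norm_num)]; simp [h6]
    have f25 : s₁.reg 25 = w j := by
      rw [hs 25 (by norm_num)]; simp [h6, h9, he, encodeElement, ← hw]
    have f28 : s₁.reg 28 = code R := by rw [hs 28 (by norm_num)]; simp [hR]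
    have hs1 : Same 20 s₀ s₁ := by
      refine Same.trans ?_ (hs.mono (by norm_num)); simp [same_setReg]
    simp only [wp_const]
    refine (hbody [] false [] _ rfl (by simp [same_setReg, hs1]) ?_ (by simpa [hm] using h0)).mono ?_
    · constructor <;> simp [gain, here, encGain, weightAt, hr, f6, f25]
    · rintro t' s₂ ⟨ht', hs', hJ'⟩
      have hj := j.2
      simp only [wp_seqs_nil]
      refine ⟨by omega, ?_, ?_, by simpa [choices] using hJ'⟩
      · simp only [same_setReg, Nat.reduceLeDiff]
        refine Same.trans ?_ (hs'.mono (by norm_num))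
        simp [same_setReg, hs1]
      · have g22 : s₂.reg 22 = 2 ^ (j : ℕ) := by rw [hs' 22 (by norm_num)]; simp [hr, f6]
        have g28 : s₂.reg 28 = code R := by rw [hs' 28 (by norm_num)]; simp [f28]
        -- The clause at this element is in R, so subtracting 2^j clears exactly its digit.
        have hin : R ∩ {j} = {j} := Finset.inter_eq_right.2 heR
        have := code_sdiff_add_inter R {j}
        rw [hin, code_singleton] at this
        simp only [here, reg_setReg, if_true, g22, g28, ← this]
        push_cast; ring
  · have hpos : 0 < (s₀.setReg 26 (s₀.mem (s₀.reg 11))).reg 26 := by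
      simp [he, encodeElement]
    rw [if_pos hpos]
    simp only [wp_const, wp_sub]
    have hl0 : s₀.mem (-(n + 1) - ((x : ℤ) + 1)) = code (lits F x false) := by
      rw [← hlow.lit (x, false)]; simp [encodeLiteral, sub_eq_add_neg]
    refine (wp_gain (lits F x false) R (hg'.congr (by simp [same_setReg])) ?_ (by simp [hR])).mono ?_
    · simp [h7, he, encodeElement, ← hl0]
    rintro t s₁ ⟨ht, hm, hs, hr, hr'⟩
    have fs : Same 20 s₀ s₁ := by
      intro r hr
      rw [hs r (by omega) (by omega) (by omega)]
      simp only [reg_setReg]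
      rw [if_neg (by omega), if_neg (by omega), if_neg (by omega), if_neg (by omega),
        if_neg (by omega), if_neg (by omega)]
    refine (hbody [] false [true] _ rfl fs ?_ (by simpa [hm] using h0)).mono ?_
    · constructor <;> first
        | simpa [gain] using hr
        | simpa [gain] using hr'
        | (rw [hs _ (by norm_num) (by norm_num) (by norm_num)]; simp [here, encGain, weightAt])
    · rintro t' s₂ ⟨ht', hs', hJ'⟩
      have gs : Same 20 s₀ s₂ := fs.trans (hs'.mono (by norm_num))
      have hlow' := hJ _ _ hJ'
      have g7 : s₂.reg 7 = -(n + 1) := by rw [gs 7 (by norm_num), h7]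
      have g2 : s₂.reg 2 = n := by rw [gs 2 (by norm_num), h2]
      have g26 : s₂.reg 26 = x + 1 := by
        rw [hs' 26 (by norm_num), hs 26 (by norm_num) (by norm_num) (by norm_num)]
        simp [he, encodeElement]
      have g28 : s₂.reg 28 = code R := by
        rw [hs' 28 (by norm_num), hs 28 (by norm_num) (by norm_num) (by norm_num)]; simp [hR]
      have g22 : s₂.reg 22 = 0 := by
        rw [hs' 22 (by norm_num), hs 22 (by norm_num) (by norm_num) (by norm_num)]; simp
      have g23 : s₂.reg 23 = 1 := by
        rw [hs' 23 (by norm_num), hs 23 (by norm_num) (by norm_num) (by norm_num)]; simp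
      have g25 : s₂.reg 25 = 0 := by
        rw [hs' 25 (by norm_num), hs 25 (by norm_num) (by norm_num) (by norm_num)]; simp
      simp only [wp_add]
      have hl1 : s₂.mem (-(n + 1) + ((x : ℤ) + 1)) = code (lits F x true) := by
        rw [← hlow'.lit (x, true)]; simp [encodeLiteral]
      have hp : s₂.mem (-1 + -(n : ℤ) - n - (x + 1)) = 2 ^ (x : ℕ) := by
        rw [← hlow'.pow x]; congr 1; ring
      refine (wp_gain (lits F x true) R
        (hg'.congr (by simp [same_setReg, gs.mono (show 10 ≤ 20 by norm_num)])) ?_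
        (by simp [g28])).mono ?_
      · simp [g7, g26, ← hl1]
      rintro t'' s₃ ⟨ht'', hm'', hs'', hr'', hr'''⟩
      have is : Same 20 s₀ s₃ := by
        intro r hr
        rw [hs'' r (by omega) (by omega) (by omega)]
        simp only [reg_setReg]
        rw [if_neg (by omega), if_neg (by omega), if_neg (by omega), if_neg (by omega), gs r hr]
      refine (hbody [false] true [] _ rfl is ?_ (by simpa [hm''] using hJ')).mono ?_
      · constructor <;> first
          | simpa [gain] using hr''
          | simpa [gain] using hr'''
          | (rw [hs'' _ (by norm_num) (by norm_num) (by norm_num)]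
             simp [here, encGain, weightAt, g22, g23, g25, g7, g2, g26, hp])
      · rintro t₄ s₄ ⟨ht₄, hs₄, hJ₄⟩
        simp only [wp_seqs_nil]
        refine ⟨by omega, is.trans (hs₄.mono (by norm_num)), ?_, hJ₄⟩
        rw [hs₄ 28 (by norm_num), hs'' 28 (by norm_num) (by norm_num) (by norm_num)]
        simp [g28, here]

end Moves
end KInterval

namespace KInterval

/-! ### Generating the families of sets -/

section ListPhase

variable {m n : ℕ}

theorem sameLow_of_loc {mem mem' : ℤ → ℤ}
    (h : ∀ a, (∀ z c, a ≠ loc m n z c) → mem' a = mem a) : SameLow n mem mem' := by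
  intro a ha
  refine h a fun z c he => ?_
  have := cell_le (3 * n + 2) (2 ^ m + 1) z c
  unfold loc at he
  omega

/-- For each entry `S` of the list at `18` insert its successor in the list at `19`. -/
def listBody : Prog :=
  forList 18 40 41 42 (seqs [mov 80 41, mov 81 20, applyProg, mov 43 82, insertProg])

theorem wp_listBody {F : CNF m n} {w : Fin m → ℤ} {R : Finset (Fin m)} {e : Fin m ⊕ Fin n}
    {b : Bool} {s₀ : State} {z z' : ℕ} {l l₀ : List (Finset (Fin m))} (hz : z ≠ z')
    (hg : Glob m n s₀) (hmv : MoveRegs F w R e b s₀) (h18 : s₀.reg 18 = loc m n z 0)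
    (h19 : s₀.reg 19 = loc m n z' 0) (hl : ListRow (fun c => s₀.mem (loc m n z c)) l)
    (hl₀ : ListRow (fun c => s₀.mem (loc m n z' c)) l₀) :
    Wp listBody s₀ (fun t s' => t ≤ l.length * (80 * (m + 1) + 6) + 5 ∧ Same 40 s₀ s' ∧
      (∃ l', ListRow (fun c => s'.mem (loc m n z' c)) l' ∧
        ∀ A, A ∈ l' ↔ A ∈ l₀ ∨ ∃ S ∈ l, advance F R e b S = A) ∧
      ∀ x, (∀ c < 2 ^ m + 1, x ≠ loc m n z' c) → s'.mem x = s₀.mem x) := by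
  refine (wp_forList (k := 40) (k' := 41) (80 * (m + 1)) (fun d mem =>
    (∃ l', ListRow (fun c => mem (loc m n z' c)) l' ∧
        ∀ A, A ∈ l' ↔ A ∈ l₀ ∨ ∃ S ∈ d, advance F R e b S = A) ∧
      ∀ x, (∀ c < 2 ^ m + 1, x ≠ loc m n z' c) → mem x = s₀.mem x)
    (by norm_num) hl hg.r5 ?_ ?_ ?_).mono ?_
  · rintro d mem ⟨-, hmem⟩ x hx
    rw [h18, loc_sub, zero_add]
    exact hmem _ fun c hc he => hz (loc_inj hx hc he).1
  · exact ⟨⟨l₀, hl₀, by simp⟩, fun _ _ => rfl⟩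
  · rintro d A r s - hs hA ⟨⟨l', hl', hmem'⟩, hfr⟩
    have hg1 : Glob m n s := hg.congr (hs.mono (by norm_num))
    simp only [wp_seqs_cons, wp_add]
    refine (wp_apply A (gain F R b e) (here e) (hg1.congr (by simp [same_setReg]))
      (by simp [hA, hg1.r6]) (by simp [hg1.r6, hs 20, hmv.r20]) (by simp [hs 22, hmv.r22])).mono ?_
    rintro t s₁ ⟨ht, hm1, hs1, h82, -⟩
    have hs1' : Same 41 s s₁ := by
      refine Same.trans ?_ (hs1.mono (by norm_num)); simp [same_setReg]
    have g6 : s₁.reg 6 = 0 := by rw [hs1' 6 (by norm_num), hg1.r6]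
    refine (wp_insert (n := n) (z := z') (l := l') (advance F R e b A) ?_ ?_ ?_ ?_).mono ?_
    · simp [hs1' 5, hg1.r5]
    · simp [hs1' 19, hs 19, h19]
    · simp [g6, h82, advance]
    · simpa [hm1] using hl'
    · rintro t' s₂ ⟨ht', hs2, ⟨l'', hl'', hmem''⟩, hfr'⟩
      simp only [wp_seqs_nil]
      refine ⟨by omega, ?_, ⟨l'', hl'', fun B => ?_⟩, fun x hx => ?_⟩
      · refine hs1'.trans (Same.trans ?_ (hs2.mono (by norm_num))); simp [same_setReg]
      · rw [hmem'', hmem']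
        simp only [List.mem_append, List.mem_singleton, or_and_right, exists_or, exists_eq_left,
          or_assoc, eq_comm (a := B)]
      · rw [hfr' x hx, ← hfr x hx]
        simp [hm1]
  · rintro t s' ⟨ht, hs, h1, h2⟩
    exact ⟨ht, hs, h1, h2⟩

/-- One step along the ordering. -/
def listStep : Prog := seqs
  [.sub 19 18 14, .store 19 5, forMoves listBody, mov 18 19, .add 11 11 12, .sub 10 10 5]

/-- Generate the lists for all positions. -/
def listPhase : Prog := seqs
  [.store 18 5, mov 19 18, .const 43 0, insertProg, .whilePos 10 listStep]

/-- The lists for the positions up to `i` are complete, in the rows `κ + 5 * i`. -/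
structure ListInv (F : CNF m n) (σ : Ordering m n) (κ : ℕ) (mem₀ : ℤ → ℤ) (i : ℕ)
    (mem : ℤ → ℤ) : Prop where
  done : ∀ j ≤ i, ∃ l, ListRow (fun c => mem (loc m n (κ + 5 * j) c)) l ∧
    ∀ S, S ∈ l ↔ S ∈ fam F σ j
  fresh : ∀ j > i, ∀ c < 2 ^ m + 1, mem (loc m n (κ + 5 * j) c) = 0
  frame : ∀ a, (∀ j c, c < 2 ^ m + 1 → a ≠ loc m n (κ + 5 * j) c) → mem a = mem₀ a

theorem ListInv.sameLow {F : CNF m n} {σ : Ordering m n} {κ i : ℕ} {mem₀ mem : ℤ → ℤ}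
    (h : ListInv F σ κ mem₀ i mem) : SameLow n mem₀ mem :=
  sameLow_of_loc (m := m) fun a ha => h.frame a fun _ _ _ => ha _ _

theorem length_le_of_mem_iff {l : List (Finset (Fin m))} {X : Finset (Finset (Fin m))} {K : ℕ}
    (hl : l.Nodup) (h : ∀ S, S ∈ l ↔ S ∈ X) (hX : X.card ≤ K) : l.length ≤ K := by
  rw [← List.toFinset_card_of_nodup hl, show l.toFinset = X by ext; simp [h]]
  exact hX

/-- The registers at position `i` of the list phase. -/
structure ListRegs (n : ℕ) (σ : Ordering m n) (κ : ℕ) (a d : ℤ) (i : ℕ) (s : State) : Prop where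
  glob : Glob m n s
  r10 : s.reg 10 = m + n - i
  r11 : s.reg 11 = a + d * i
  r12 : s.reg 12 = d
  r14 : s.reg 14 = 5 * (2 ^ m + 1)
  r18 : s.reg 18 = loc m n (κ + 5 * i) 0
  r28 : s.reg 28 = code (rem σ i)

theorem here_subset_rem {σ : Ordering m n} {i : ℕ} (hi : i < m + n) :
    here (σ.symm ⟨i, hi⟩) ⊆ rem σ i := by
  intro j hj
  have h := val_eq_iff σ hi (.inl j)
  rcases he : σ.symm ⟨i, hi⟩ with j' | x <;> rw [he] at hj h
  · simp only [here, Finset.mem_singleton] at hj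
    subst hj
    simp [rem, h.2 rfl]
  · simp [here] at hj

/-- π is the ordering as it stands in memory, σ the one along which families are generated. Both
directions read the same cells, at addresses a + d * i with d = 1 or d = -1, and write to rows of
different residue modulo 5. -/
theorem wp_listStep {F : CNF m n} {w : Fin m → ℤ} {π σ : Ordering m n} {κ K i : ℕ} {a d : ℤ}
    {mem₀ : ℤ → ℤ} {s₀ : State} (hi : i < m + n) (hlow : Low F w π mem₀)
    (hord : s₀.reg 11 > -((3 * n + 2 : ℕ) : ℤ) ∧
      mem₀ (s₀.reg 11) = encodeElement (σ.symm ⟨i, hi⟩))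
    (hK : 1 ≤ K) (hcard : (fam F σ i).card ≤ K) (hr : ListRegs n σ κ a d i s₀)
    (hm : ListInv F σ κ mem₀ i s₀.mem) :
    Wp listStep s₀ (fun t s' => t ≤ 300 * (K * (m + 1)) ∧ ListRegs n σ κ a d (i + 1) s' ∧
      ListInv F σ κ mem₀ (i + 1) s'.mem) := by
  obtain ⟨hg, h10, h11, h12, h14, h18, h28⟩ := hr
  have hsl := hm.sameLow
  obtain ⟨l, hl, hlmem⟩ := hm.done i le_rfl
  have hlen := length_le_of_mem_iff hl.nodup hlmem hcard
  have hbase : s₀.reg 18 - s₀.reg 14 = loc m n (κ + 5 * (i + 1)) 0 := by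
    rw [h18, h14]
    have := cell_sub_row (3 * n + 2) (2 ^ m + 1) (κ + 5 * i) 5 0
    rw [loc, loc, show κ + 5 * (i + 1) = κ + 5 * i + 5 by ring, ← this]
    push_cast; ring
  have hne : ∀ j c c', j ≤ i → c < 2 ^ m + 1 → c' < 2 ^ m + 1 →
      loc m n (κ + 5 * j) c ≠ loc m n (κ + 5 * (i + 1)) c' := by
    intro j c c' hj hc hc' he
    have := (loc_inj hc hc' he).1
    omega
  have hne0 : ∀ S : Finset (Fin m),
      loc m n (κ + 5 * (i + 1)) (code S + 1) ≠ loc m n (κ + 5 * (i + 1)) 0 := by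
    intro S he
    have := code_lt S
    have := (loc_inj (by omega) (by omega) he).2
    omega
  simp only [listStep, wp_seqs_cons, wp_sub, wp_store]
  set s₁ : State := (s₀.setReg 19 (s₀.reg 18 - s₀.reg 14)).setMem
    ((s₀.setReg 19 (s₀.reg 18 - s₀.reg 14)).reg 19) ((s₀.setReg 19 (s₀.reg 18 - s₀.reg 14)).reg 5)
    with hs₁
  have hg1 : Glob m n s₁ := hg.congr (by simp [hs₁, same_setReg])
  have hm1 : s₁.mem = Function.update s₀.mem (loc m n (κ + 5 * (i + 1)) 0) 1 := by
    simp [hs₁, hbase, hg.r5]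
  have hfr1 : ∀ x, (∀ c < 2 ^ m + 1, x ≠ loc m n (κ + 5 * (i + 1)) c) → s₁.mem x = s₀.mem x := by
    intro x hx
    rw [hm1, Function.update_of_ne (hx 0 (Nat.succ_pos _))]
  have hsl1 : SameLow n s₀.mem s₁.mem := sameLow_of_loc (m := m) fun x hx => hfr1 x fun c _ => hx _ c
  have hcur : ∀ mem : ℤ → ℤ, (∀ x, (∀ c < 2 ^ m + 1, x ≠ loc m n (κ + 5 * (i + 1)) c) → mem x = s₀.mem x) →
      ListRow (fun c => mem (loc m n (κ + 5 * i) c)) l := by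
    intro mem hmem
    exact hl.congr fun c hc => (hmem _ fun c' hc' => hne i c c' le_rfl hc hc').symm
  refine (wp_forMoves (F := F) (w := w) (π := π) (e := σ.symm ⟨i, hi⟩) (R := rem σ i)
    (90 * (K * (m + 1)) + 5) (fun d mem =>
      (∃ l', ListRow (fun c => mem (loc m n (κ + 5 * (i + 1)) c)) l' ∧
        ∀ A, A ∈ l' ↔ ∃ b ∈ d, ∃ S ∈ l, advance F (rem σ i) (σ.symm ⟨i, hi⟩) b S = A) ∧
      ∀ x, (∀ c < 2 ^ m + 1, x ≠ loc m n (κ + 5 * (i + 1)) c) → mem x = s₀.mem x)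
    hg1 ?_ ?_ ?_ (here_subset_rem hi) ?_ ?_).mono ?_
  · rintro d mem ⟨-, hfr⟩
    refine hlow.congr fun x hx => ?_
    rw [← hsl x hx]
    exact sameLow_of_loc (m := m) (fun y hy => hfr y fun c _ => hy _ c) x hx
  · have : s₁.reg 11 = s₀.reg 11 := by simp [hs₁]
    rw [this, hsl1 _ hord.1, hsl _ hord.1, hord.2]
  · simp [hs₁, h28]
  · refine ⟨⟨[], ListRow.nil (by simp [hm1]) fun S => ?_, by simp⟩, hfr1⟩
    rw [hm1, Function.update_of_ne (hne0 S)]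
    exact hm.fresh _ (by omega) _ (by have := code_lt S; omega)
  · rintro d b r s hd hs hmv ⟨⟨l', hl', hmem'⟩, hfr⟩
    refine (wp_listBody (z := κ + 5 * i) (z' := κ + 5 * (i + 1)) (by omega)
      (hg1.congr (hs.mono (by norm_num))) hmv ?_ ?_ (hcur _ hfr) hl').mono ?_
    · simp [hs 18, hs₁, h18]
    · simp [hs 19, hs₁, hbase]
    · rintro t s' ⟨ht, hs', ⟨l'', hl'', hmem''⟩, hfr'⟩
      refine ⟨?_, hs', ⟨l'', hl'', fun A => ?_⟩, fun x hx => by rw [hfr' x hx, hfr x hx]⟩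
      · have : l.length * (80 * (m + 1) + 6) ≤ K * (90 * (m + 1)) :=
          Nat.mul_le_mul hlen (by omega)
        have h2 : K * (90 * (m + 1)) = 90 * (K * (m + 1)) := by ring
        omega
      · rw [hmem'', hmem']
        simp only [List.mem_append, List.mem_singleton, or_and_right, exists_or, exists_eq_left]
  · rintro t s' ⟨ht, hs', h28', ⟨l', hl', hmem'⟩, hfr⟩
    have f : ∀ r < 20, r ≠ 19 → s'.reg r = s₀.reg r := by
      intro r hr hr'
      rw [hs' r hr]; simp [hs₁, hr']
    have f19 : s'.reg 19 = loc m n (κ + 5 * (i + 1)) 0 := by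
      rw [hs' 19 (by norm_num)]; simp [hs₁, hbase]
    have f6 : s'.reg 6 = 0 := by rw [f 6 (by norm_num) (by norm_num), hg.r6]
    simp only [wp_add, wp_seqs_nil]
    refine ⟨?_, ⟨hg.congr fun r hr => ?_, ?_, ?_, ?_, ?_, ?_, ?_⟩, ?_, ?_, ?_⟩
    · have : m + 1 ≤ K * (m + 1) := Nat.le_mul_of_pos_left _ hK
      omega
    · simp only [reg_setReg]
      rw [if_neg (by omega), if_neg (by omega), if_neg (by omega), f r (by omega) (by omega)]
    · simp [f 10, f 5, hg.r5, h10]; ring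
    · simp [f 11, f 12, h11, h12]; ring
    · simp [f 12, h12]
    · simp [f 14, h14]
    · simp [f19, f6]
    · simp [h28', rem_succ σ hi]
    · intro j hj
      rcases Nat.lt_or_ge i j with hij | hij
      · obtain rfl : j = i + 1 := by omega
        refine ⟨l', hl', fun A => ?_⟩
        rw [hmem', mem_fam_succ F σ hi]
        simp only [hlmem]
      · obtain ⟨l₂, hl₂, hm₂⟩ := hm.done j hij
        exact ⟨l₂, hl₂.congr fun c hc => (hfr _ fun c' hc' => hne j c c' hij hc hc').symm, hm₂⟩
    · intro j hj c hc
      rw [← hm.fresh j (by omega) c hc]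
      refine hfr _ fun c' hc' he => ?_
      have := (loc_inj hc hc' he).1
      omega
    · intro x hx
      rw [← hm.frame x hx]
      exact hfr x fun c hc => hx _ c hc

theorem wp_listPhase {F : CNF m n} {w : Fin m → ℤ} {π σ : Ordering m n} {κ K : ℕ} {a d : ℤ}
    {s₀ : State} (hlow : Low F w π s₀.mem)
    (hord : ∀ i (hi : i < m + n), a + d * i > -((3 * n + 2 : ℕ) : ℤ) ∧
      s₀.mem (a + d * i) = encodeElement (σ.symm ⟨i, hi⟩))
    (hK : 1 ≤ K) (hcard : ∀ i, (fam F σ i).card ≤ K) (hr : ListRegs n σ κ a d 0 s₀)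
    (hfresh : ∀ j c, c < 2 ^ m + 1 → s₀.mem (loc m n (κ + 5 * j) c) = 0) :
    Wp listPhase s₀ (fun t s' => t ≤ (m + n) * (300 * (K * (m + 1)) + 1) + 20 ∧
      ListRegs n σ κ a d (m + n) s' ∧ ListInv F σ κ s₀.mem (m + n) s'.mem) := by
  have hr' := hr
  obtain ⟨hg, h10, h11, h12, h14, h18, h28⟩ := hr
  simp only [mul_zero, add_zero] at h18
  simp only [listPhase, wp_seqs_cons, wp_store, wp_add, wp_const]
  have hne0 : ∀ S : Finset (Fin m), loc m n κ (code S + 1) ≠ loc m n κ 0 := by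
    intro S he
    have := code_lt S
    have := (loc_inj (by omega) (by omega) he).2
    omega
  refine (wp_insert (n := n) (z := κ) (l := []) (∅ : Finset (Fin m)) ?_ ?_ ?_ ?_).mono ?_
  · simp [hg.r5]
  · simp [h18, hg.r6]
  · simp
  -- The 1 written to the head is the end marker 0 increased by 1: an empty list, which then
  -- receives ∅, the only set at position 0.
  · refine ListRow.nil ?_ fun S => ?_
    · simp [h18, hg.r5]
    · simp only [mem_setReg, mem_setMem, h18]
      exact (Function.update_of_ne (hne0 S) _ _).trans
        (by simpa using hfresh 0 (code S + 1) (by have := code_lt S; omega))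
  rintro t s₁ ⟨ht, hs, ⟨l, hl, hlmem⟩, hfr⟩
  have f : ∀ r < 40, r ≠ 19 → s₁.reg r = s₀.reg r := by
    intro r hr hr'
    rw [hs r (by omega)]
    simp only [reg_setReg, reg_setMem]
    rw [if_neg (by omega), if_neg (by omega)]
  have hfr1 : ∀ x, (∀ c < 2 ^ m + 1, x ≠ loc m n κ c) → s₁.mem x = s₀.mem x := by
    intro x hx
    rw [hfr x hx]
    simp only [mem_setReg, mem_setMem, h18]
    exact Function.update_of_ne (hx 0 (Nat.succ_pos _)) _ _
  refine (wp_while (fun i s => ListRegs n σ κ a d i s ∧ ListInv F σ κ s₀.mem i s.mem) (m + n)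
    (300 * (K * (m + 1))) ?_ ?_ ?_ ?_).mono ?_
  · rintro i s hi ⟨hr, -⟩
    rw [hr.r10]; omega
  · rintro s ⟨hr, -⟩
    rw [hr.r10]; push_cast; omega
  · rintro i s hi ⟨hr, hm⟩
    exact wp_listStep hi hlow (by rw [hr.r11]; exact hord i hi) hK (hcard i) hr hm
  · refine ⟨⟨hg.congr fun r hr => f r (by omega) (by omega), ?_, ?_, ?_, ?_, ?_, ?_⟩, ?_, ?_, ?_⟩
    · rw [f 10 (by norm_num) (by norm_num), h10]
    · rw [f 11 (by norm_num) (by norm_num), h11]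
    · rw [f 12 (by norm_num) (by norm_num), h12]
    · rw [f 14 (by norm_num) (by norm_num), h14]
    · rw [f 18 (by norm_num) (by norm_num), h18]; rfl
    · rw [f 28 (by norm_num) (by norm_num), h28]
    · intro j hj
      obtain rfl : j = 0 := by omega
      refine ⟨l, hl, fun S => ?_⟩
      rw [hlmem, fam_zero]; simp
    · intro j hj c hc
      rw [← hfresh j c hc]
      refine hfr1 _ fun c' hc' he => ?_
      have := (loc_inj hc hc' he).1
      omega
    · intro x hx
      exact hfr1 x fun c hc => by simpa using hx 0 c hc
  · rintro t' s' ⟨ht', hr, hm⟩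
    simp only [wp_seqs_nil]
    exact ⟨by omega, hr, hm⟩

end ListPhase

end KInterval

namespace KInterval

/-! ### Filling the tables -/

section TablePhase

variable {m n : ℕ}

/-- Combine the entry for `R[41] + R[82]` of the current table into the entry for `R[43] + R[51]`
of the next table. -/
def combineProg : Prog := seqs
  [.add 60 41 82, .sub 60 13 60, .sub 61 60 8, .sub 62 61 8,
   .add 63 43 51, .sub 63 13 63, .sub 63 63 14, .sub 64 63 8, .sub 65 64 8,
   .add 66 44 83, .add 66 66 23, .load 67 61, .load 68 62, .add 68 68 24,
   .ifPos 66
    (seqs [.add 67 67 25, .load 69 60, .load 70 63, .add 70 70 69, .store 63 70]) .skip,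
   .load 70 65,
   .ifPos 70
    (seqs [.load 69 64, .sub 69 67 69, .ifPos 69 (.seq (.store 64 67) (.store 65 68)) .skip])
    (.seq (.store 64 67) (.store 65 68))]

-- The equations for the three target cells are those of `Rep.move` followed by `Rep.union`, with U
-- the source and V the target.
set_option linter.unusedSimpArgs false in
open Classical in
theorem wp_combine {p : ℕ} {s : State} {keep : Prop} (U V : Finset (Fin m)) (hg : Glob m n s)
    (h13 : s.reg 13 = loc m n (5 * p + 2) 0) (h14 : s.reg 14 = 5 * (2 ^ m + 1))
    (hU : s.reg 41 + s.reg 82 = code U) (hV : s.reg 43 + s.reg 51 = code V)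
    (hk : 0 < s.reg 44 + s.reg 83 + s.reg 23 ↔ keep) :
    Wp combineProg s (fun t s' => t ≤ 60 ∧ Same 60 s s' ∧
      (∀ x, x ≠ loc m n (5 * (p + 1) + 2) (code V) → x ≠ loc m n (5 * (p + 1) + 3) (code V) →
        x ≠ loc m n (5 * (p + 1) + 4) (code V) → s'.mem x = s.mem x) ∧
      s'.mem (loc m n (5 * (p + 1) + 2) (code V)) =
        s.mem (loc m n (5 * (p + 1) + 2) (code V)) +
          (if keep then s.mem (loc m n (5 * p + 2) (code U)) else 0) ∧
      s'.mem (loc m n (5 * (p + 1) + 3) (code V)) =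
        (if 0 < s.mem (loc m n (5 * (p + 1) + 4) (code V)) ∧
          ¬ 0 < (s.mem (loc m n (5 * p + 3) (code U)) + if keep then s.reg 25 else 0) -
            s.mem (loc m n (5 * (p + 1) + 3) (code V))
        then s.mem (loc m n (5 * (p + 1) + 3) (code V))
        else s.mem (loc m n (5 * p + 3) (code U)) + if keep then s.reg 25 else 0) ∧
      s'.mem (loc m n (5 * (p + 1) + 4) (code V)) =
        (if 0 < s.mem (loc m n (5 * (p + 1) + 4) (code V)) ∧
          ¬ 0 < (s.mem (loc m n (5 * p + 3) (code U)) + if keep then s.reg 25 else 0) -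
            s.mem (loc m n (5 * (p + 1) + 3) (code V))
        then s.mem (loc m n (5 * (p + 1) + 4) (code V))
        else s.mem (loc m n (5 * p + 4) (code U)) + s.reg 24)) := by
  have hV' := code_lt V
  have hrow : ∀ z c, loc m n z c - (2 ^ m + 1) = loc m n (z + 1) c := by
    intro z c
    have := cell_sub_row (3 * n + 2) (2 ^ m + 1) z 1 c
    rw [loc, loc, ← this]; push_cast; ring
  have hrow5 : ∀ z c, loc m n z c - 5 * (2 ^ m + 1) = loc m n (z + 5) c := by
    intro z c
    have := cell_sub_row (3 * n + 2) (2 ^ m + 1) z 5 c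
    rw [loc, loc, ← this]; push_cast; ring
  have hcol : ∀ z (A : Finset (Fin m)), loc m n z 0 - code A = loc m n z (code A) := by
    intro z A
    rw [loc_sub, zero_add]
  have e5 : 5 * (p + 1) + 2 = 5 * p + 2 + 5 := by ring
  have e51 : 5 * (p + 1) + 3 = 5 * p + 2 + 5 + 1 := by ring
  have e52 : 5 * (p + 1) + 4 = 5 * p + 2 + 5 + 1 + 1 := by ring
  have e1 : 5 * p + 3 = 5 * p + 2 + 1 := by ring
  have e2 : 5 * p + 4 = 5 * p + 2 + 1 + 1 := by ring
  rw [e5, e51, e52, e1, e2]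
  have n1 : loc m n (5 * p + 2 + 5 + 1) (code V) ≠ loc m n (5 * p + 2 + 5) (code V) := fun he => by
    have := (loc_inj (by omega) (by omega) he).1; omega
  have n2 : loc m n (5 * p + 2 + 5 + 1 + 1) (code V) ≠ loc m n (5 * p + 2 + 5) (code V) :=
    fun he => by have := (loc_inj (by omega) (by omega) he).1; omega
  have n3 : loc m n (5 * p + 2 + 5 + 1 + 1) (code V) ≠ loc m n (5 * p + 2 + 5 + 1) (code V) :=
    fun he => by have := (loc_inj (by omega) (by omega) he).1; omega
  simp only [combineProg, wp_seqs_cons, wp_add, wp_sub, wp_load, reg_setReg, mem_setReg,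
    Nat.reduceEqDiff, if_true, if_false, h13, h14, hU, hV, hg.r8, hcol, hrow, hrow5, wp_ifPos, hk]
  generalize loc m n (5 * p + 2 + 5 + 1 + 1) (code V) = d2 at *
  generalize loc m n (5 * p + 2 + 5 + 1) (code V) = d1 at *
  generalize loc m n (5 * p + 2 + 5) (code V) = d0 at *
  generalize loc m n (5 * p + 2 + 1 + 1) (code U) = a2 at *
  generalize loc m n (5 * p + 2 + 1) (code U) = a1 at *
  generalize loc m n (5 * p + 2) (code U) = a0 at *
  by_cases hkeep : keep <;> simp only [hkeep, if_true, if_false, wp_seqs_cons, wp_add, wp_sub,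
    wp_load, wp_store, wp_skip, wp_seqs_nil, wp_ifPos, wp_seq, reg_setReg, mem_setReg, reg_setMem,
    mem_setMem, Nat.reduceEqDiff, Function.update_of_ne n1, Function.update_of_ne n2] <;>
    by_cases ha : 0 < s.mem d2 <;>
    simp only [ha, if_true, if_false, true_and, false_and] <;>
    (try split_ifs) <;>
    simp_all [same_setReg, n1.symm, n2.symm, n3.symm]
  omega

theorem block_nonempty {F : CNF m n} {π : Ordering m n} {p : ℕ} {S : Finset (Fin m)}
    (h : S ∈ fam F π p) : (block F π p S).Nonempty := by
  obtain ⟨τ, -, rfl⟩ := Finset.mem_image.1 h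
  refine ⟨fun x => if (π (.inr x) : ℕ) < p then τ x else false, ?_⟩
  simp only [block, leftA, Finset.mem_filter, Finset.mem_univ, true_and]
  refine ⟨fun x hx => by simp [not_lt.2 hx], lset_congr F π fun x hx => by simp [hx]⟩

/-- The entries for `U` in the tables of position `p` describe `X`. -/
def Entry (F : CNF m n) (π : Ordering m n) (w : Fin m → ℤ) (p : ℕ) (S : Finset (Fin m))
    (X : Finset (Fin n → Bool)) (mem : ℤ → ℤ) (U : Finset (Fin m)) : Prop :=
  Rep F π w p S X (mem (loc m n (5 * p + 2) (code U))) (mem (loc m n (5 * p + 3) (code U)))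
    (mem (loc m n (5 * p + 4) (code U)))

/-- The tables of position `p` are complete. -/
def TabOK (F : CNF m n) (π : Ordering m n) (w : Fin m → ℤ) (p : ℕ) (mem : ℤ → ℤ) : Prop :=
  ∀ U, U ∩ (rem π p)ᶜ ∈ fam F (rev π) (m + n - p) →
    Entry F π w p (U ∩ (rem π p)ᶜ) (block F π p (U ∩ rem π p)) mem U

open Classical in
/-- The partial assignments up to `p + 1` that belong to `V` and to which `P` applies. -/
noncomputable def part (F : CNF m n) (π : Ordering m n) (p : ℕ) (e : Fin m ⊕ Fin n)
    (P : Bool → Finset (Fin m) → Finset (Fin m) → Prop) (V : Finset (Fin m)) :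
    Finset (Fin n → Bool) :=
  (leftA π (p + 1)).filter fun τ => lset F π (p + 1) τ = V ∩ rem π (p + 1) ∧
    P (choice τ e) (lset F π p τ) (V ∩ (rem π (p + 1))ᶜ)

theorem mem_part {F : CNF m n} {π : Ordering m n} {p : ℕ} {e : Fin m ⊕ Fin n}
    {P : Bool → Finset (Fin m) → Finset (Fin m) → Prop} {V : Finset (Fin m)}
    {τ : Fin n → Bool} : τ ∈ part F π p e P V ↔ τ ∈ leftA π (p + 1) ∧
      lset F π (p + 1) τ = V ∩ rem π (p + 1) ∧
      P (choice τ e) (lset F π p τ) (V ∩ (rem π (p + 1))ᶜ) := by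
  simp [part]

/-- The tables of position `p + 1` describe the partial assignments to which `P` applies. -/
structure TabInv (F : CNF m n) (π : Ordering m n) (w : Fin m → ℤ) (p : ℕ) (e : Fin m ⊕ Fin n)
    (mem₀ : ℤ → ℤ) (P : Bool → Finset (Fin m) → Finset (Fin m) → Prop) (mem : ℤ → ℤ) : Prop where
  frame : ∀ a, (∀ c < 2 ^ m + 1, a ≠ loc m n (5 * (p + 1) + 2) c ∧
    a ≠ loc m n (5 * (p + 1) + 3) c ∧ a ≠ loc m n (5 * (p + 1) + 4) c) → mem a = mem₀ a
  entry : ∀ V, Entry F π w (p + 1) (V ∩ (rem π (p + 1))ᶜ)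
    (part F π p e P V) mem V

theorem TabInv.congr {F : CNF m n} {π : Ordering m n} {w : Fin m → ℤ} {p : ℕ} {e : Fin m ⊕ Fin n}
    {mem₀ mem : ℤ → ℤ} {P Q : Bool → Finset (Fin m) → Finset (Fin m) → Prop}
    (h : TabInv F π w p e mem₀ P mem) (hPQ : ∀ b S₁ S₂, P b S₁ S₂ ↔ Q b S₁ S₂) :
    TabInv F π w p e mem₀ Q mem := by
  have : P = Q := by ext; exact hPQ _ _ _
  exact this ▸ h

theorem loc_row_ne {z z' c c' : ℕ} (hz : z ≠ z') (hc : c < 2 ^ m + 1) (hc' : c' < 2 ^ m + 1) :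
    loc m n z c ≠ loc m n z' c' := fun he => hz (loc_inj hc hc' he).1

theorem TabInv.frame_loc {F : CNF m n} {π : Ordering m n} {w : Fin m → ℤ} {p : ℕ}
    {e : Fin m ⊕ Fin n} {mem₀ mem : ℤ → ℤ} {P : Bool → Finset (Fin m) → Finset (Fin m) → Prop}
    (h : TabInv F π w p e mem₀ P mem) {z c : ℕ} (hc : c < 2 ^ m + 1)
    (hz : z ≠ 5 * (p + 1) + 2 ∧ z ≠ 5 * (p + 1) + 3 ∧ z ≠ 5 * (p + 1) + 4) :
    mem (loc m n z c) = mem₀ (loc m n z c) :=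
  h.frame _ fun _ hc' => ⟨loc_row_ne hz.1 hc hc', loc_row_ne hz.2.1 hc hc',
    loc_row_ne hz.2.2 hc hc'⟩

theorem advance_subset {F : CNF m n} {π : Ordering m n} {p : ℕ} (hp : p < m + n) {b : Bool}
    {S : Finset (Fin m)} (hS : S ∈ fam F π p) (hb : b ∈ choices (π.symm ⟨p, hp⟩)) :
    advance F (rem π p) (π.symm ⟨p, hp⟩) b S ⊆ rem π (p + 1) := by
  have h : advance F (rem π p) (π.symm ⟨p, hp⟩) b S ∈ fam F π (p + 1) :=
    (mem_fam_succ F π hp _).2 ⟨b, hb, S, hS, rfl⟩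
  obtain ⟨τ, -, hτ⟩ := Finset.mem_image.1 h
  rw [← hτ]
  exact lset_subset F π _ _

theorem subset_of_mem_fam {F : CNF m n} {π : Ordering m n} {p : ℕ} {S : Finset (Fin m)}
    (hS : S ∈ fam F π p) : S ⊆ rem π p := by
  obtain ⟨τ, -, rfl⟩ := Finset.mem_image.1 hS
  exact lset_subset F π _ _

theorem subset_of_mem_rfam {F : CNF m n} {π : Ordering m n} {p : ℕ} {S : Finset (Fin m)}
    (hS : S ∈ fam F (rev π) (m + n - p)) : S ⊆ (rem π p)ᶜ := by
  rw [← rem_rev]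
  exact subset_of_mem_fam hS

/-- The two sets of a pair lie on opposite sides of the cut, so the union encodes the pair, and its
code is found by one addition. -/
theorem union_inter_of_subset {A B R : Finset (Fin m)} (hA : A ⊆ R) (hB : B ⊆ Rᶜ) :
    (A ∪ B) ∩ R = A ∧ (A ∪ B) ∩ Rᶜ = B ∧ code (A ∪ B) = code A + code B := by
  have hd : Disjoint R Rᶜ := disjoint_compl_right
  refine ⟨?_, ?_, code_union_of_disjoint (hd.mono hA hB)⟩
  · rw [Finset.union_inter_distrib_right, Finset.inter_eq_left.2 hA,
      Finset.disjoint_iff_inter_eq_empty.1 (hd.symm.mono_left hB), Finset.union_empty]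
  · rw [Finset.union_inter_distrib_right, Finset.inter_eq_left.2 hB,
      Finset.disjoint_iff_inter_eq_empty.1 (hd.mono_left hA), Finset.empty_union]

-- Treating the triple (b, S₁, S₂) changes the entry of V only and adds `branch` to what is recorded
-- there. Nothing is recorded twice: an assignment determines b and S₁, the target V determines S₂,
-- and the triple is new.
open Classical in
theorem TabInv.step {F : CNF m n} {π : Ordering m n} {w : Fin m → ℤ} {p : ℕ} (hp : p < m + n)
    {mem₀ mem mem' : ℤ → ℤ} {P : Bool → Finset (Fin m) → Finset (Fin m) → Prop} {b : Bool}
    {S₁ S₂ : Finset (Fin m)} (h : TabInv F π w p (π.symm ⟨p, hp⟩) mem₀ P mem)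
    (hok : TabOK F π w p mem₀) (hb : b ∈ choices (π.symm ⟨p, hp⟩)) (hS₁ : S₁ ∈ fam F π p)
    (hS₂ : S₂ ∈ fam F (rev π) (m + n - (p + 1))) (hP : ¬ P b S₁ S₂) {U V : Finset (Fin m)}
    (hU : U = S₁ ∪ advance F (rem π p)ᶜ (π.symm ⟨p, hp⟩) b S₂)
    (hV : V = advance F (rem π p) (π.symm ⟨p, hp⟩) b S₁ ∪ S₂)
    (hfr : ∀ x, x ≠ loc m n (5 * (p + 1) + 2) (code V) → x ≠ loc m n (5 * (p + 1) + 3) (code V) →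
        x ≠ loc m n (5 * (p + 1) + 4) (code V) → mem' x = mem x)
    (hc : mem' (loc m n (5 * (p + 1) + 2) (code V)) =
        mem (loc m n (5 * (p + 1) + 2) (code V)) +
          (if Keep F π p (π.symm ⟨p, hp⟩) b S₁ S₂ then
            mem (loc m n (5 * p + 2) (code U)) else 0))
    (hv : mem' (loc m n (5 * (p + 1) + 3) (code V)) =
        (if 0 < mem (loc m n (5 * (p + 1) + 4) (code V)) ∧
          ¬ 0 < (mem (loc m n (5 * p + 3) (code U)) +
            if Keep F π p (π.symm ⟨p, hp⟩) b S₁ S₂ then weightAt w (π.symm ⟨p, hp⟩) else 0) -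
            mem (loc m n (5 * (p + 1) + 3) (code V))
        then mem (loc m n (5 * (p + 1) + 3) (code V))
        else mem (loc m n (5 * p + 3) (code U)) +
          if Keep F π p (π.symm ⟨p, hp⟩) b S₁ S₂ then weightAt w (π.symm ⟨p, hp⟩) else 0))
    (ha : mem' (loc m n (5 * (p + 1) + 4) (code V)) =
        (if 0 < mem (loc m n (5 * (p + 1) + 4) (code V)) ∧
          ¬ 0 < (mem (loc m n (5 * p + 3) (code U)) +
            if Keep F π p (π.symm ⟨p, hp⟩) b S₁ S₂ then weightAt w (π.symm ⟨p, hp⟩) else 0) -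
            mem (loc m n (5 * (p + 1) + 3) (code V))
        then mem (loc m n (5 * (p + 1) + 4) (code V))
        else mem (loc m n (5 * p + 4) (code U)) + encGain b (π.symm ⟨p, hp⟩))) :
    TabInv F π w p (π.symm ⟨p, hp⟩) mem₀
      (fun b' A₁ A₂ => P b' A₁ A₂ ∨ (b' = b ∧ A₁ = S₁ ∧ A₂ = S₂)) mem' := by
  have hVlt := code_lt V
  have hUlt := code_lt U
  have hadv := advance_subset hp hS₁ hb
  have hrf := mem_rfam F π hp hb hS₂
  obtain ⟨hV1, hV2, -⟩ := union_inter_of_subset hadv (subset_of_mem_rfam hS₂)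
  obtain ⟨hU1, hU2, -⟩ := union_inter_of_subset (subset_of_mem_fam hS₁) (subset_of_mem_rfam hrf)
  rw [← hV] at hV1 hV2
  rw [← hU] at hU1 hU2
  have hstep : ∀ τ, choice τ (π.symm ⟨p, hp⟩) = b → lset F π p τ = S₁ →
      lset F π (p + 1) τ = V ∩ rem π (p + 1) := by
    intro τ h1 h2
    rw [lset_succ F π hp, h1, h2, hV1]
  refine ⟨fun x hx => ?_, fun V' => ?_⟩
  · rw [hfr x (hx _ (by omega)).1 (hx _ (by omega)).2.1 (hx _ (by omega)).2.2, h.frame x hx]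
  · by_cases hVV : V' = V
    · subst hVV
      -- The source lies in rows of position p, which the writes at p + 1 do not touch, so its old
      -- description is still valid.
      have hsrc := hok U (by rw [hU2]; exact hrf)
      rw [hU1, hU2, Entry, ← h.frame_loc (by omega) (by omega), ← h.frame_loc (by omega) (by omega),
        ← h.frame_loc (by omega) (by omega)] at hsrc
      have hmv := hsrc.move F w hp hb (block_nonempty hS₁)
      have hdst := h.entry V'
      have hne : (branch F π p (π.symm ⟨p, hp⟩) b S₁).Nonempty := by
        rw [branch_eq_image F hp hb]
        exact (block_nonempty hS₁).image _
      have hun := Rep.union F w hdst (by rw [hV2]; exact hmv) ?_ hne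
      · have hset : part F π p (π.symm ⟨p, hp⟩)
            (fun b' A₁ A₂ => P b' A₁ A₂ ∨ (b' = b ∧ A₁ = S₁ ∧ A₂ = S₂)) V' =
            part F π p (π.symm ⟨p, hp⟩) P V' ∪ branch F π p (π.symm ⟨p, hp⟩) b S₁ := by
          ext τ
          have := hstep τ
          simp only [mem_part, Finset.mem_union, branch, Finset.mem_filter, hV2, and_true]
          tauto
        rw [Entry, hset, hc, hv, ha]
        exact hun
      · rw [Finset.disjoint_left]
        intro τ h1 h2
        simp only [branch, mem_part, Finset.mem_filter] at h1 h2
        rw [h2.2.1, h2.2.2, hV2] at h1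
        exact hP h1.2.2
    · have hcode : code V' ≠ code V := fun he => hVV (code_injective he)
      have hlt := code_lt V'
      have hloc : ∀ z z', loc m n z (code V') ≠ loc m n z' (code V) := fun z z' he =>
        hcode (loc_inj (by omega) (by omega) he).2
      have hent := h.entry V'
      have hset : part F π p (π.symm ⟨p, hp⟩)
          (fun b' A₁ A₂ => P b' A₁ A₂ ∨ (b' = b ∧ A₁ = S₁ ∧ A₂ = S₂)) V' =
          part F π p (π.symm ⟨p, hp⟩) P V' := by
        ext τ
        simp only [mem_part]
        refine and_congr_right fun _ => and_congr_right fun hτ => ?_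
        refine ⟨fun hh => hh.resolve_right ?_, Or.inl⟩
        rintro ⟨h1, h2, h3⟩
        apply hVV
        rw [hstep τ h1 h2] at hτ
        -- An assignment of this triple recorded for V' would make V' agree with V on both sides of
        -- the cut.
        have hsplit : ∀ A : Finset (Fin m),
            A = (A ∩ rem π (p + 1)) ∪ (A ∩ (rem π (p + 1))ᶜ) := fun A => by
          rw [← Finset.inter_union_distrib_left, Finset.union_compl, Finset.inter_univ]
        rw [hsplit V', hsplit V, ← hτ, h3, hV2]
      rw [Entry, hset, hfr _ (hloc _ _) (hloc _ _) (hloc _ _), hfr _ (hloc _ _) (hloc _ _) (hloc _ _),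
        hfr _ (hloc _ _) (hloc _ _) (hloc _ _)]
      exact hent

end TablePhase

end KInterval

namespace KInterval

/-! ### Running the recursion over all pairs of left and right sets -/

section TablePhase

variable {m n : ℕ}

/-- Combine the entries for all sets in the list at `16`. -/
def innerBody : Prog :=
  forList 16 50 51 52 (seqs [mov 80 51, mov 81 21, applyProg, combineProg])

/-- Combine the entries for all sets in the lists at `15` and `16`. -/
def tabBody : Prog :=
  forList 15 40 41 42
    (seqs [mov 80 41, mov 81 20, applyProg, mov 43 82, mov 44 83, innerBody])

/-- The entry being visited has not been visited before. This supplies the newness of triples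
required by `TabInv.step`; a repeated entry would be counted twice. -/
theorem not_mem_of_nodup_append {α : Type*} {l d r : List α} {a : α} (hl : l.Nodup)
    (h : l = d ++ a :: r) : a ∉ d := by
  subst h
  intro ha
  exact (List.nodup_append.1 hl).2.2 a ha a List.mem_cons_self rfl

open Classical in
theorem wp_innerBody {F : CNF m n} {π : Ordering m n} {w : Fin m → ℤ} {p : ℕ} (hp : p < m + n)
    {mem₀ : ℤ → ℤ} {P : Bool → Finset (Fin m) → Finset (Fin m) → Prop} {b : Bool}
    {S₁ : Finset (Fin m)} {s₀ : State} {q : ℕ} {l : List (Finset (Fin m))}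
    (hg : Glob m n s₀) (hmv : MoveRegs F w (rem π p) (π.symm ⟨p, hp⟩) b s₀)
    (h13 : s₀.reg 13 = loc m n (5 * p + 2) 0) (h14 : s₀.reg 14 = 5 * (2 ^ m + 1))
    (h16 : s₀.reg 16 = loc m n (1 + 5 * q) 0)
    (h41 : s₀.reg 41 = code S₁)
    (h43 : s₀.reg 43 = code (advance F (rem π p) (π.symm ⟨p, hp⟩) b S₁))
    (h44 : s₀.reg 44 = code (hit F (rem π p) (π.symm ⟨p, hp⟩) b S₁))
    (hl : ListRow (fun c => mem₀ (loc m n (1 + 5 * q) c)) l)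
    (hlmem : ∀ S, S ∈ l ↔ S ∈ fam F (rev π) (m + n - (p + 1)))
    (h : TabInv F π w p (π.symm ⟨p, hp⟩) mem₀ P s₀.mem) (hok : TabOK F π w p mem₀)
    (hb : b ∈ choices (π.symm ⟨p, hp⟩)) (hS₁ : S₁ ∈ fam F π p) (hP : ∀ S₂, ¬ P b S₁ S₂) :
    Wp innerBody s₀ (fun t s' => t ≤ l.length * (130 * (m + 1) + 5 + 1) + 5 ∧ Same 50 s₀ s' ∧
      TabInv F π w p (π.symm ⟨p, hp⟩) mem₀
        (fun b' A₁ A₂ => P b' A₁ A₂ ∨ (b' = b ∧ A₁ = S₁ ∧ A₂ ∈ l)) s'.mem) := by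
  refine (wp_forList (k := 50) (k' := 51) (130 * (m + 1)) (fun d mem =>
    TabInv F π w p (π.symm ⟨p, hp⟩) mem₀
      (fun b' A₁ A₂ => P b' A₁ A₂ ∨ (b' = b ∧ A₁ = S₁ ∧ A₂ ∈ d)) mem)
    (by norm_num) hl hg.r5 ?_ ?_ ?_)
  · intro d mem hmem x hx
    rw [h16, loc_sub, zero_add]
    exact hmem.frame_loc hx (by omega)
  · exact h.congr fun b' A₁ A₂ => by simp
  · intro d S₂ r s hd hs hA hinv
    have hg1 : Glob m n s := hg.congr (hs.mono (by norm_num))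
    simp only [wp_seqs_cons, wp_add]
    refine (wp_apply S₂ (gain F (rem π p)ᶜ b (π.symm ⟨p, hp⟩)) (here (π.symm ⟨p, hp⟩))
      (hg1.congr (by simp [same_setReg]))
      (by simp [hA, hg1.r6]) (by simp [hg1.r6, hs 21, hmv.r21]) (by simp [hs 22, hmv.r22])).mono ?_
    rintro t s₁ ⟨ht, hm1, hs1, h82, h83⟩
    have hs1' : Same 52 s s₁ := by
      refine Same.trans ?_ (hs1.mono (by norm_num)); simp [same_setReg]
    have hs01 : Same 50 s₀ s₁ := hs.trans (hs1'.mono (by norm_num))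
    have hmem1 : s₁.mem = s.mem := by simp [hm1]
    have hS₂ : S₂ ∈ fam F (rev π) (m + n - (p + 1)) := (hlmem S₂).1 (by simp [hd])
    have hadv := advance_subset hp hS₁ hb
    have hrf := mem_rfam F π hp hb hS₂
    have hV := (union_inter_of_subset hadv (subset_of_mem_rfam hS₂)).2.2
    have hU := (union_inter_of_subset (subset_of_mem_fam hS₁) (subset_of_mem_rfam hrf)).2.2
    have h44' : s₁.reg 44 = code (hit F (rem π p) (π.symm ⟨p, hp⟩) b S₁) := by
      rw [hs01 44 (by norm_num), h44]
    have h83' : s₁.reg 83 = code (hit F (rem π p)ᶜ (π.symm ⟨p, hp⟩) b S₂) := h83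
    have h23' : s₁.reg 23 = if here (π.symm ⟨p, hp⟩) = ∅ then 1 else 0 := by
      rw [hs01 23 (by norm_num), hmv.r23]
    have h24' : s₁.reg 24 = encGain b (π.symm ⟨p, hp⟩) := by rw [hs01 24 (by norm_num), hmv.r24]
    have h25' : s₁.reg 25 = weightAt w (π.symm ⟨p, hp⟩) := by rw [hs01 25 (by norm_num), hmv.r25]
    -- All three summands are nonnegative: the codes of the hits from the left and from the right,
    -- positive exactly for nonempty sets, and a flag that is 1 at a variable.
    have hkeep : 0 < s₁.reg 44 + s₁.reg 83 + s₁.reg 23 ↔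
        Keep F π p (π.symm ⟨p, hp⟩) b S₁ S₂ := by
      rw [h44', h83', h23', Keep, hits, Finset.union_nonempty, ← code_pos, ← code_pos]
      split_ifs with hh
      · exact iff_of_true (by omega) (Or.inl hh)
      · rw [or_iff_right hh]; omega
    refine (wp_combine (p := p) (keep := Keep F π p (π.symm ⟨p, hp⟩) b S₁ S₂)
      (S₁ ∪ advance F (rem π p)ᶜ (π.symm ⟨p, hp⟩) b S₂)
      (advance F (rem π p) (π.symm ⟨p, hp⟩) b S₁ ∪ S₂)
      (hg.congr (hs01.mono (by norm_num))) ?_ ?_ ?_ ?_ hkeep).mono ?_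
    · rw [hs01 13 (by norm_num), h13]
    · rw [hs01 14 (by norm_num), h14]
    · rw [hs01 41 (by norm_num), h41, h82, hU]; push_cast; rfl
    · rw [hs01 43 (by norm_num), h43, hs1' 51 (by norm_num), hA, hV]; push_cast; rfl
    · rintro t' s₂ ⟨ht', hs2, hfr, hc, hv, ha⟩
      rw [hmem1] at hfr hc hv ha
      rw [h25'] at hv ha
      rw [h24'] at ha
      simp only [wp_seqs_nil]
      refine ⟨by omega, hs1'.trans (hs2.mono (by norm_num)) |>.mono (by norm_num), ?_⟩
      refine (hinv.step hp hok hb hS₁ hS₂ ?_ rfl rfl hfr hc hv ha).congr fun b' A₁ A₂ => ?_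
      · rintro (hh | ⟨-, -, hh⟩)
        · exact hP _ hh
        · exact not_mem_of_nodup_append hl.nodup hd hh
      · simp only [List.mem_append, List.mem_singleton]
        tauto

/-- The factor K² of the running time arises here, from two nested traversals of lists of length at
most K. -/
theorem wp_tabBody {F : CNF m n} {π : Ordering m n} {w : Fin m → ℤ} {p K : ℕ} (hp : p < m + n)
    {mem₀ : ℤ → ℤ} {P : Bool → Finset (Fin m) → Finset (Fin m) → Prop} {b : Bool}
    {s₀ : State} {q : ℕ} {l l₂ : List (Finset (Fin m))}
    (hg : Glob m n s₀) (hmv : MoveRegs F w (rem π p) (π.symm ⟨p, hp⟩) b s₀)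
    (h13 : s₀.reg 13 = loc m n (5 * p + 2) 0) (h14 : s₀.reg 14 = 5 * (2 ^ m + 1))
    (h15 : s₀.reg 15 = loc m n (5 * p) 0)
    (h16 : s₀.reg 16 = loc m n (1 + 5 * q) 0)
    (hl : ListRow (fun c => mem₀ (loc m n (5 * p) c)) l)
    (hlmem : ∀ S, S ∈ l ↔ S ∈ fam F π p)
    (hl₂ : ListRow (fun c => mem₀ (loc m n (1 + 5 * q) c)) l₂)
    (hlmem₂ : ∀ S, S ∈ l₂ ↔ S ∈ fam F (rev π) (m + n - (p + 1)))
    (hK : 1 ≤ K) (hlen : l.length ≤ K) (hlen₂ : l₂.length ≤ K)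
    (h : TabInv F π w p (π.symm ⟨p, hp⟩) mem₀ P s₀.mem) (hok : TabOK F π w p mem₀)
    (hb : b ∈ choices (π.symm ⟨p, hp⟩)) (hP : ∀ S₁ S₂, ¬ P b S₁ S₂) :
    Wp tabBody s₀ (fun t s' => t ≤ 250 * (K * K * (m + 1)) ∧ Same 40 s₀ s' ∧
      TabInv F π w p (π.symm ⟨p, hp⟩) mem₀
        (fun b' A₁ A₂ => P b' A₁ A₂ ∨ (b' = b ∧ A₁ ∈ l ∧ A₂ ∈ l₂)) s'.mem) := by
  have hKm : m + 1 ≤ K * (m + 1) := Nat.le_mul_of_pos_left _ hK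
  refine (wp_forList (k := 40) (k' := 41) (220 * (K * (m + 1))) (fun d mem =>
    TabInv F π w p (π.symm ⟨p, hp⟩) mem₀
      (fun b' A₁ A₂ => P b' A₁ A₂ ∨ (b' = b ∧ A₁ ∈ d ∧ A₂ ∈ l₂)) mem)
    (by norm_num) hl hg.r5 ?_ ?_ ?_).mono ?_
  · intro d mem hmem x hx
    rw [h15, loc_sub, zero_add]
    exact hmem.frame_loc hx (by omega)
  · exact h.congr fun b' A₁ A₂ => by simp
  · intro d S₁ r s hd hs hA hinv
    have hg1 : Glob m n s := hg.congr (hs.mono (by norm_num))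
    simp only [wp_seqs_cons, wp_add]
    refine (wp_apply S₁ (gain F (rem π p) b (π.symm ⟨p, hp⟩)) (here (π.symm ⟨p, hp⟩))
      (hg1.congr (by simp [same_setReg]))
      (by simp [hA, hg1.r6]) (by simp [hg1.r6, hs 20, hmv.r20]) (by simp [hs 22, hmv.r22])).mono ?_
    rintro t s₁ ⟨ht, hm1, hs1, h82, h83⟩
    have hs1' : Same 42 s s₁ := by
      refine Same.trans ?_ (hs1.mono (by norm_num)); simp [same_setReg]
    have hs01 : Same 40 s₀ s₁ := hs.trans (hs1'.mono (by norm_num))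
    have hmem1 : s₁.mem = s.mem := by simp [hm1]
    have g6 : s₁.reg 6 = 0 := by rw [hs01 6 (by norm_num), hg.r6]
    refine (wp_innerBody hp (S₁ := S₁) (b := b) (mem₀ := mem₀) (w := w) (q := q) (l := l₂)
      (P := fun b' A₁ A₂ => P b' A₁ A₂ ∨ (b' = b ∧ A₁ ∈ d ∧ A₂ ∈ l₂))
      (hg.congr (s := s₀) ?_) ?_ ?_ ?_ ?_ ?_ ?_ ?_ hl₂ hlmem₂ ?_ hok hb ?_ ?_).mono ?_
    · simp [same_setReg, hs01.mono (show 10 ≤ 40 by norm_num)]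
    · obtain ⟨a0, a1, a2, a3, a4, a5⟩ := hmv
      constructor <;> simp [hs01 20, hs01 21, hs01 22, hs01 23, hs01 24, hs01 25, *]
    · simp [hs01 13, h13]
    · simp [hs01 14, h14]
    · simp [hs01 16, h16]
    · simp [hs1' 41, hA]
    · simp [h82, g6, advance]
    · simp [h83, g6, hit]
    · simpa [hmem1] using hinv
    · exact (hlmem S₁).1 (by simp [hd])
    · rintro S₂ (hh | ⟨-, hh, -⟩)
      · exact hP _ _ hh
      · exact not_mem_of_nodup_append hl.nodup hd hh
    · rintro t' s₂ ⟨ht', hs2, hinv'⟩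
      simp only [wp_seqs_nil]
      refine ⟨?_, ?_, hinv'.congr fun b' A₁ A₂ => ?_⟩
      · have : l₂.length * (130 * (m + 1) + 5 + 1) ≤ K * (136 * (m + 1)) :=
          Nat.mul_le_mul hlen₂ (by omega)
        have h2 : K * (136 * (m + 1)) = 136 * (K * (m + 1)) := by ring
        omega
      · refine (hs1'.mono (by norm_num)).trans (Same.trans ?_ (hs2.mono (by norm_num)))
        simp [same_setReg]
      · simp only [List.mem_append, List.mem_singleton]
        tauto
  · rintro t s' ⟨ht, hs, hinv⟩
    refine ⟨?_, hs, hinv⟩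
    have : l.length * (220 * (K * (m + 1)) + 5 + 1) ≤ K * (226 * (K * (m + 1))) :=
      Nat.mul_le_mul hlen (by omega)
    have h2 : K * (226 * (K * (m + 1))) = 226 * (K * K * (m + 1)) := by ring
    have h3 : K * (m + 1) ≤ K * K * (m + 1) := Nat.mul_le_mul_right _ (Nat.le_mul_of_pos_left _ hK)
    omega

/-- One step of the table phase. -/
def tabStep : Prog := seqs
  [forMoves tabBody, .sub 13 13 14, .sub 15 15 14, .add 16 16 14, .add 11 11 5, .sub 10 10 5]

/-- The registers at position `p` of the table phase. -/
structure TabRegs (n : ℕ) (π : Ordering m n) (p : ℕ) (s : State) : Prop where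
  glob : Glob m n s
  r10 : s.reg 10 = m + n - p
  r11 : s.reg 11 = 2 + p
  r13 : s.reg 13 = loc m n (5 * p + 2) 0
  r14 : s.reg 14 = 5 * (2 ^ m + 1)
  r15 : s.reg 15 = loc m n (5 * p) 0
  r16 : s.reg 16 = loc m n 1 0 - (5 * (2 ^ m + 1)) * (m + n - (p + 1))
  r28 : s.reg 28 = code (rem π p)

/-- The memory at position `p` of the table phase. -/
structure TabMem (F : CNF m n) (π : Ordering m n) (w : Fin m → ℤ) (mem₀ : ℤ → ℤ) (p : ℕ)
    (mem : ℤ → ℤ) : Prop where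
  ok : TabOK F π w p mem
  fresh : ∀ j > p, ∀ c < 2 ^ m + 1, mem (loc m n (5 * j + 2) c) = 0 ∧
    mem (loc m n (5 * j + 3) c) = 0 ∧ mem (loc m n (5 * j + 4) c) = 0
  frame : ∀ a, (∀ j c, c < 2 ^ m + 1 → a ≠ loc m n (5 * j + 2) c ∧ a ≠ loc m n (5 * j + 3) c ∧
    a ≠ loc m n (5 * j + 4) c) → mem a = mem₀ a

theorem TabInv.sameLow {F : CNF m n} {π : Ordering m n} {w : Fin m → ℤ} {p : ℕ}
    {e : Fin m ⊕ Fin n} {mem₀ mem : ℤ → ℤ} {P : Bool → Finset (Fin m) → Finset (Fin m) → Prop}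
    (h : TabInv F π w p e mem₀ P mem) : SameLow n mem₀ mem :=
  sameLow_of_loc (m := m) fun _ ha => h.frame _ fun _ _ => ⟨ha _ _, ha _ _, ha _ _⟩

theorem TabMem.sameLow {F : CNF m n} {π : Ordering m n} {w : Fin m → ℤ} {p : ℕ}
    {mem₀ mem : ℤ → ℤ} (h : TabMem F π w mem₀ p mem) : SameLow n mem₀ mem :=
  sameLow_of_loc (m := m) fun _ ha => h.frame _ fun _ _ _ => ⟨ha _ _, ha _ _, ha _ _⟩

theorem TabMem.frame_loc {F : CNF m n} {π : Ordering m n} {w : Fin m → ℤ} {p : ℕ}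
    {mem₀ mem : ℤ → ℤ} (h : TabMem F π w mem₀ p mem) {z c : ℕ} (hc : c < 2 ^ m + 1)
    (hz : z % 5 < 2) : mem (loc m n z c) = mem₀ (loc m n z c) :=
  h.frame _ fun _ _ hc' => ⟨loc_row_ne (by omega) hc hc', loc_row_ne (by omega) hc hc',
    loc_row_ne (by omega) hc hc'⟩

theorem wp_tabStep {F : CNF m n} {w : Fin m → ℤ} {π : Ordering m n} {K p : ℕ} (hp : p < m + n)
    {mem₀ : ℤ → ℤ} {s₀ : State} (hlow : Low F w π mem₀) {l l₂ : List (Finset (Fin m))}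
    (hl : ListRow (fun c => mem₀ (loc m n (5 * p) c)) l)
    (hlmem : ∀ S, S ∈ l ↔ S ∈ fam F π p)
    (hl₂ : ListRow (fun c => mem₀ (loc m n (1 + 5 * (m + n - (p + 1))) c)) l₂)
    (hlmem₂ : ∀ S, S ∈ l₂ ↔ S ∈ fam F (rev π) (m + n - (p + 1)))
    (hK : 1 ≤ K) (hlen : l.length ≤ K) (hlen₂ : l₂.length ≤ K) (hr : TabRegs n π p s₀)
    (hm : TabMem F π w mem₀ p s₀.mem) :
    Wp tabStep s₀ (fun t s' => t ≤ 620 * (K * K * (m + 1)) ∧ TabRegs n π (p + 1) s' ∧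
      TabMem F π w mem₀ (p + 1) s'.mem) := by
  obtain ⟨hg, h10, h11, h13, h14, h15, h16, h28⟩ := hr
  have hrow5 : ∀ z, loc m n z 0 - 5 * (2 ^ m + 1) = loc m n (z + 5) 0 := by
    intro z
    have := cell_sub_row (3 * n + 2) (2 ^ m + 1) z 5 0
    rw [loc, loc, ← this]; push_cast; ring
  -- The reversed lists are walked backwards. `TabRegs` uses integer subtraction because after the
  -- last step the register no longer points to a row; before a step p + 1 ≤ m + n and it does.
  have h16' : s₀.reg 16 = loc m n (1 + 5 * (m + n - (p + 1))) 0 := by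
    have := cell_sub_row (3 * n + 2) (2 ^ m + 1) 1 (5 * (m + n - (p + 1))) 0
    rw [h16, loc, loc, ← this]
    push_cast [Nat.cast_sub (show p + 1 ≤ m + n from hp)]
    ring
  have hlow0 : Low F w π s₀.mem := hlow.congr hm.sameLow
  simp only [tabStep, wp_seqs_cons, wp_sub, wp_add]
  refine (wp_forMoves (F := F) (w := w) (π := π) (e := π.symm ⟨p, hp⟩) (R := rem π p)
    (250 * (K * K * (m + 1))) (fun d mem => TabInv F π w p (π.symm ⟨p, hp⟩) s₀.mem
      (fun b A₁ A₂ => b ∈ d ∧ A₁ ∈ l ∧ A₂ ∈ l₂) mem) hg ?_ ?_ h28 (here_subset_rem hp) ?_ ?_).mono ?_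
  · intro d mem h
    exact hlow0.congr h.sameLow
  · rw [h11]
    exact hlow0.order ⟨p, hp⟩
  -- No triple has been treated yet, and the zeros of untouched memory describe the empty set of
  -- assignments.
  · refine ⟨fun _ _ => rfl, fun V => ?_⟩
    have hV := code_lt V
    obtain ⟨f1, f2, f3⟩ := hm.fresh (p + 1) (by omega) (code V) (by omega)
    have hpart : part F π p (π.symm ⟨p, hp⟩) (fun b A₁ A₂ => b ∈ [] ∧ A₁ ∈ l ∧ A₂ ∈ l₂) V = ∅ := by
      ext τ; simp [mem_part]
    rw [Entry, hpart, f1, f2, f3]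
    exact Rep.zero F w _ _ _
  · intro d b r s hd hs hmv hinv
    have hb : b ∈ choices (π.symm ⟨p, hp⟩) := by simp [hd]
    have hnd : (choices (π.symm ⟨p, hp⟩)).Nodup := by
      rcases π.symm ⟨p, hp⟩ with j | x <;> simp [choices]
    refine (wp_tabBody hp (hg.congr (hs.mono (by norm_num))) hmv (q := m + n - (p + 1)) (l := l)
      (l₂ := l₂) ?_ ?_ ?_ ?_ (hl.congr fun c hc => (hm.frame_loc hc (by omega)).symm) hlmem
      (hl₂.congr fun c hc => (hm.frame_loc hc (by omega)).symm) hlmem₂ hK hlen hlen₂ hinv hm.ok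
      hb ?_).mono ?_
    · rw [hs 13 (by norm_num), h13]
    · rw [hs 14 (by norm_num), h14]
    · rw [hs 15 (by norm_num), h15]
    · rw [hs 16 (by norm_num), h16']
    · rintro S₁ S₂ ⟨hh, -, -⟩
      exact not_mem_of_nodup_append hnd hd hh
    · rintro t s' ⟨ht, hs', hinv'⟩
      refine ⟨ht, hs', hinv'.congr fun b' A₁ A₂ => ?_⟩
      simp only [List.mem_append, List.mem_singleton]
      tauto
  · rintro t s' ⟨ht, hs, h28', hinv⟩
    have f : ∀ r < 20, s'.reg r = s₀.reg r := hs
    simp only [wp_seqs_nil]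
    refine ⟨?_, ⟨hg.congr fun r hr => ?_, ?_, ?_, ?_, ?_, ?_, ?_, ?_⟩, ?_, ?_, ?_⟩
    · have : m + 1 ≤ K * K * (m + 1) := Nat.le_mul_of_pos_left _ (Nat.mul_pos hK hK)
      omega
    · simp only [reg_setReg]
      rw [if_neg (by omega), if_neg (by omega), if_neg (by omega), if_neg (by omega),
        if_neg (by omega), f r (by omega)]
    · simp [f 10, f 5, hg.r5, h10]; ring
    · simp [f 11, f 5, hg.r5, h11]; ring
    · simp [f 13, f 14, h13, h14, hrow5]; congr 1
    · simp [f 14, h14]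
    · simp [f 15, f 14, h15, h14, hrow5]; congr 1
    · simp [f 16, f 14, h16, h14]; ring
    · simp [h28', rem_succ π hp]
    · intro U hU
      have h := hinv.entry U
      -- Every assignment has its value among the choices and its left set in the list, so nothing
      -- is missed provided the right set of U is in its list. That proviso is the premise in
      -- `TabOK`.
      have hpart : part F π p (π.symm ⟨p, hp⟩)
          (fun b A₁ A₂ => b ∈ choices (π.symm ⟨p, hp⟩) ∧ A₁ ∈ l ∧ A₂ ∈ l₂) U =
          block F π (p + 1) (U ∩ rem π (p + 1)) := by
        ext τ
        have h1 := choice_mem τ (π.symm ⟨p, hp⟩)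
        have h2 : lset F π p τ ∈ l := (hlmem _).2 (Finset.mem_image_of_mem _ (Finset.mem_univ τ))
        have h3 : U ∩ (rem π (p + 1))ᶜ ∈ l₂ := (hlmem₂ _).2 hU
        simp [mem_part, block, h1, h2, h3]
      rw [hpart] at h
      exact h
    · intro j hj c hc
      obtain ⟨f1, f2, f3⟩ := hm.fresh j (by omega) c hc
      refine ⟨?_, ?_, ?_⟩
      · exact (hinv.frame_loc hc (by omega)).trans f1
      · exact (hinv.frame_loc hc (by omega)).trans f2
      · exact (hinv.frame_loc hc (by omega)).trans f3
    · intro x hx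
      exact (hinv.frame x fun c hc => hx _ c hc).trans (hm.frame x hx)

/-- Fill the tables for all positions. -/
def tabPhase : Prog := .whilePos 10 tabStep

theorem wp_tabPhase {F : CNF m n} {w : Fin m → ℤ} {π : Ordering m n} {K : ℕ}
    {mem₀ : ℤ → ℤ} {s₀ : State} (hlow : Low F w π mem₀)
    (hL : ∀ p ≤ m + n, ∃ l, ListRow (fun c => mem₀ (loc m n (5 * p) c)) l ∧
      ∀ S, S ∈ l ↔ S ∈ fam F π p)
    (hR : ∀ p ≤ m + n, ∃ l, ListRow (fun c => mem₀ (loc m n (1 + 5 * p) c)) l ∧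
      ∀ S, S ∈ l ↔ S ∈ fam F (rev π) p)
    (hK : 1 ≤ K) (hcard : ∀ i, (fam F π i).card ≤ K) (hcard' : ∀ i, (fam F (rev π) i).card ≤ K)
    (hr : TabRegs n π 0 s₀) (hm : TabMem F π w mem₀ 0 s₀.mem) :
    Wp tabPhase s₀ (fun t s' => t ≤ (m + n) * (620 * (K * K * (m + 1)) + 1) + 1 ∧
      TabRegs n π (m + n) s' ∧ TabMem F π w mem₀ (m + n) s'.mem) := by
  refine wp_while (fun p s => TabRegs n π p s ∧ TabMem F π w mem₀ p s.mem) (m + n)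
    (620 * (K * K * (m + 1))) ?_ ?_ ?_ ⟨hr, hm⟩
  · rintro i s hi ⟨hr, -⟩
    rw [hr.r10]; omega
  · rintro s ⟨hr, -⟩
    rw [hr.r10]; push_cast; omega
  · rintro p s hp ⟨hr, hm⟩
    obtain ⟨l, hl, hlmem⟩ := hL p hp.le
    obtain ⟨l₂, hl₂, hlmem₂⟩ := hR (m + n - (p + 1)) (by omega)
    exact wp_tabStep hp hlow hl hlmem hl₂ hlmem₂ hK (length_le_of_mem_iff hl.nodup hlmem (hcard _))
      (length_le_of_mem_iff hl₂.nodup hlmem₂ (hcard' _)) hr hm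

end TablePhase

end KInterval

namespace KInterval

/-! ### Reading the input -/

section Input

variable {m n : ℕ}

/-- The memory holds the word `l` from the address `a` on. -/
def Holds (mem : ℤ → ℤ) : ℤ → List ℤ → Prop
  | _, [] => True
  | a, x :: l => mem a = x ∧ Holds mem (a + 1) l

theorem holds_append {mem : ℤ → ℤ} {a : ℤ} {l l' : List ℤ} :
    Holds mem a (l ++ l') ↔ Holds mem a l ∧ Holds mem (a + l.length) l' := by
  induction l generalizing a with
  | nil => simp [Holds]
  | cons x l ih =>
    simp only [List.cons_append, Holds, ih, List.length_cons, and_assoc]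
    rw [show a + ((l.length + 1 : ℕ) : ℤ) = a + 1 + l.length by push_cast; ring]

theorem Holds.get {mem : ℤ → ℤ} {a : ℤ} {l : List ℤ} (h : Holds mem a l) {i : ℕ}
    (hi : i < l.length) : mem (a + i) = l[i] := by
  induction l generalizing a i with
  | nil => simp at hi
  | cons x l ih =>
    cases i with
    | zero => simpa using h.1
    | succ i =>
      have := ih h.2 (i := i) (by simpa using hi)
      rw [show a + ((i + 1 : ℕ) : ℤ) = a + 1 + i by push_cast; ring, this]
      rfl

theorem holds_of_get {mem : ℤ → ℤ} {a : ℤ} {l : List ℤ}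
    (h : ∀ i (hi : i < l.length), mem (a + i) = l[i]) : Holds mem a l := by
  induction l generalizing a with
  | nil => trivial
  | cons x l ih =>
    refine ⟨?_, ih fun i hi => ?_⟩
    · have := h 0 (Nat.succ_pos _)
      rw [Nat.cast_zero, add_zero] at this
      exact this
    · have := h (i + 1) (by simpa using hi)
      rw [show a + ((i + 1 : ℕ) : ℤ) = a + 1 + i by push_cast; ring] at this
      simpa using this

theorem Holds.congr {mem mem' : ℤ → ℤ} {a : ℤ} {l : List ℤ} (h : Holds mem a l) (ha : 0 ≤ a)
    (hm : ∀ x, 0 ≤ x → mem' x = mem x) : Holds mem' a l := by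
  induction l generalizing a with
  | nil => trivial
  | cons x l ih => exact ⟨by rw [hm a ha, h.1], ih h.2 (by omega)⟩

theorem holds_initState (l : List ℤ) : Holds (initState l).mem 0 l := by
  refine holds_of_get fun i hi => ?_
  simp [initState, hi]

/-- A clause as it stands in the input. -/
def clauseWord (c : List (Fin n × Bool)) : List ℤ := c.map encodeLiteral ++ [0]

/-- The input as it stands in the memory, the clauses from the address `off` on. -/
structure Input (F : CNF m n) (w : Fin m → ℤ) (π : Ordering m n) (off : ℕ) (mem : ℤ → ℤ) :
    Prop where
  numClauses : mem 0 = m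
  numVars : mem 1 = n
  order : ∀ p : Fin (m + n), mem (2 + p) = encodeElement (π.symm p)
  weight : ∀ j : Fin m, mem (m + n + 1 + (j + 1)) = w j
  clauses : Holds mem off (List.ofFn fun j => clauseWord (F.clause j)).flatten
  zero : ∀ a < 0, mem a = 0

/-- Without weights in the input, whatever stands in the cells where weights are read is taken as
weights. The same dynamic program then serves for counting, its maximum being ignored. -/
theorem input_encode (F : CNF m n) (π : Ordering m n) :
    ∃ w, Input F w π (m + n + 2) (initState (encode F π)).mem := by
  have h := holds_initState (encode F π)
  have hz : ∀ a < 0, (initState (encode F π)).mem a = 0 := fun a ha => by simp [initState, ha]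
  generalize (initState (encode F π)).mem = mem at h hz
  unfold encode at h
  rw [holds_append, holds_append] at h
  obtain ⟨⟨⟨h0, h1, -⟩, h2⟩, h3⟩ := h
  refine ⟨fun j => mem (m + n + 1 + (j + 1)), h0, h1, fun p => ?_, fun j => rfl, ?_, hz⟩
  · have := h2.get (i := p) (by simp)
    simpa using this
  · simp only [List.length_append, List.length_cons, List.length_nil, List.length_ofFn] at h3
    rw [show ((m + n + 2 : ℕ) : ℤ) = 0 + ((0 + 1 + 1 + (m + n) : ℕ) : ℤ) by push_cast; ring]
    exact h3

theorem input_encodeWeighted (F : CNF m n) (π : Ordering m n) (w : Fin m → ℤ) :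
    Input F w π (m + n + 2 + m) (initState (encodeWeighted F π w)).mem := by
  have h := holds_initState (encodeWeighted F π w)
  have hz : ∀ a < 0, (initState (encodeWeighted F π w)).mem a = 0 := fun a ha => by
    simp [initState, ha]
  generalize (initState (encodeWeighted F π w)).mem = mem at h hz
  unfold encodeWeighted at h
  rw [holds_append, holds_append, holds_append] at h
  obtain ⟨⟨⟨⟨h0, h1, -⟩, h2⟩, h4⟩, h3⟩ := h
  refine ⟨h0, h1, fun p => ?_, fun j => ?_, ?_, hz⟩
  · have := h2.get (i := p) (by simp)
    simpa using this
  · have := h4.get (i := j) (by simp)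
    simp only [List.getElem_ofFn] at this
    rw [← this]
    congr 1
    simp; ring
  · simp only [List.length_append, List.length_cons, List.length_nil, List.length_ofFn] at h3
    rw [show ((m + n + 2 + m : ℕ) : ℤ) = 0 + ((0 + 1 + 1 + (m + n) + m : ℕ) : ℤ) by
      push_cast; ring]
    exact h3

/-- Read the numbers of clauses and variables and compute the constants. -/
def headerProg : Prog := seqs
  [.const 5 1, .load 1 6, .load 2 5, mov 100 1, powProg, mov 3 101, .add 8 3 5, .sub 7 6 2,
   .sub 7 7 5, .add 9 1 2, .add 9 9 5, .add 14 8 8, .add 14 14 14, .add 14 14 8, .add 11 9 5]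

theorem wp_header {s₀ : State} (hr : ∀ r, s₀.reg r = 0) (h0 : s₀.mem 0 = m) (h1 : s₀.mem 1 = n) :
    Wp headerProg s₀ (fun t s' => t ≤ 3 * m + 30 ∧ s'.mem = s₀.mem ∧ Glob m n s' ∧
      s'.reg 14 = 5 * (2 ^ m + 1) ∧ s'.reg 11 = (m + n + 2 : ℕ)) := by
  simp only [headerProg, wp_seqs_cons, wp_const, wp_load, wp_add]
  refine (wp_pow m (by simp) (by simp [hr, h0])).mono ?_
  rintro t s₁ ⟨ht, hm, hs, h101⟩
  have f : ∀ r < 100, s₁.reg r = if r = 2 then (n : ℤ) else if r = 1 then (m : ℤ) else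
      if r = 5 then 1 else 0 := by
    intro r hr'
    rw [hs r hr']
    simp [hr, h0, h1]
    omega
  simp only [wp_sub, wp_seqs_nil]
  refine ⟨by omega, by simp [hm], ?_, ?_, ?_⟩
  · constructor <;> simp [f, h101]
    ring
  · simp [f, h101]; ring
  · simp [f]; ring

/-- Add the content of register `12` to the table entry of the literal in register `15`. -/
def addLit : Prog := seqs [.add 16 7 15, .load 17 16, .add 17 17 12, .store 16 17]

/-- Read one literal. -/
def litStep : Prog := seqs
  [.load 15 11, .add 11 11 5,
   .ifPos 15 addLit (.seq (.sub 16 6 15) (.ifPos 16 addLit (.const 13 0)))]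

theorem wp_while_true {r : ℕ} {body : Prog} {s : State} {Q : ℕ → State → Prop}
    (hr : 0 < s.reg r)
    (h : Wp body s (fun t s' => Wp (.whilePos r body) s' (fun t' s'' => Q (t + t' + 1) s''))) :
    Wp (.whilePos r body) s Q := by
  obtain ⟨t, s', h1, t', s'', h2, h3⟩ := h
  exact ⟨_, _, .whileTrue hr h1 h2, h3⟩

theorem encodeLiteral_injective : Function.Injective (encodeLiteral : Fin n × Bool → ℤ) := by
  rintro ⟨x, b⟩ ⟨y, c⟩ h
  cases b <;> cases c <;> simp [encodeLiteral] at h ⊢ <;> omega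

theorem encodeLiteral_bound (l : Fin n × Bool) :
    -(n : ℤ) ≤ encodeLiteral l ∧ encodeLiteral l ≤ n ∧ encodeLiteral l ≠ 0 := by
  obtain ⟨x, b⟩ := l
  have := x.2
  cases b <;> simp [encodeLiteral] <;> omega

theorem wp_litStep {s : State} (l : Fin n × Bool) (hg : Glob m n s)
    (hl : s.mem (s.reg 11) = encodeLiteral l) :
    Wp litStep s (fun t s' => t ≤ 14 ∧ s'.reg 11 = s.reg 11 + 1 ∧
      (∀ r < 15, r ≠ 11 → s'.reg r = s.reg r) ∧
      s'.mem = Function.update s.mem (-(n + 1) + encodeLiteral l)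
        (s.mem (-(n + 1) + encodeLiteral l) + s.reg 12)) := by
  have hb := encodeLiteral_bound l
  simp only [litStep, addLit, wp_seqs_cons, wp_load, wp_add, wp_sub, wp_ifPos, wp_seq, wp_store,
    wp_const, wp_seqs_nil, reg_setReg, mem_setReg, mem_setMem, reg_setMem, Nat.reduceEqDiff,
    if_true, if_false, hl, hg.r5, hg.r6, hg.r7, zero_sub]
  split_ifs with h1 h2
  · exact ⟨by omega, trivial, fun r hr hr' => by
      simp [hr', show r ≠ 15 by omega, show r ≠ 16 by omega, show r ≠ 17 by omega], trivial⟩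
  · exact ⟨by omega, trivial, fun r hr hr' => by
      simp [hr', show r ≠ 15 by omega, show r ≠ 16 by omega, show r ≠ 17 by omega], trivial⟩
  · omega

theorem wp_clause {s : State} (c : List (Fin n × Bool)) (hg : Glob m n s) (h13 : 0 < s.reg 13)
    (h11 : 0 ≤ s.reg 11) (hc : Holds s.mem (s.reg 11) (clauseWord c)) :
    Wp (.whilePos 13 litStep) s (fun t s' => t ≤ 15 * c.length + 12 ∧
      s'.reg 11 = s.reg 11 + (clauseWord c).length ∧
      (∀ r < 15, r ≠ 11 → r ≠ 13 → s'.reg r = s.reg r) ∧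
      (∀ a : ℤ, 0 ≤ a ∨ a < -(2 * n + 1) → s'.mem a = s.mem a) ∧
      ∀ l : Fin n × Bool, s'.mem (-(n + 1) + encodeLiteral l) =
        s.mem (-(n + 1) + encodeLiteral l) + c.count l * s.reg 12) := by
  induction c generalizing s with
  | nil =>
    have hz : s.mem (s.reg 11) = 0 := hc.1
    refine wp_while_true h13 ?_
    simp only [litStep, wp_seqs_cons, wp_load, wp_add, wp_sub, wp_ifPos, wp_seq, wp_const,
      wp_seqs_nil, reg_setReg, Nat.reduceEqDiff, if_true, if_false, hz, hg.r5, hg.r6,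
      lt_irrefl, sub_zero]
    refine ⟨1, _, .whileFalse (by simp), by simp, by simp [clauseWord], fun r hr h h' => ?_,
      by simp, by simp⟩
    simp only [reg_setReg]
    rw [if_neg (by omega), if_neg (by omega), if_neg (by omega), if_neg (by omega)]
  | cons l c ih =>
    have hb := encodeLiteral_bound l
    refine wp_while_true h13 ((wp_litStep l hg hc.1).mono ?_)
    rintro t s₁ ⟨ht, h11', hs, hm⟩
    have hfr : ∀ a : ℤ, 0 ≤ a ∨ a < -(2 * n + 1) → s₁.mem a = s.mem a := by
      intro a ha
      rw [hm, Function.update_of_ne]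
      omega
    refine (ih (hg.congr fun r hr => hs r (by omega) (by omega)) ?_ ?_ ?_).mono ?_
    · rw [hs 13 (by norm_num) (by norm_num)]; exact h13
    · omega
    · rw [h11']
      exact hc.2.congr (by omega) fun x hx => hfr x (Or.inl hx)
    · rintro t' s₂ ⟨ht', h11'', hs', hfr', hl'⟩
      refine ⟨by simp only [List.length_cons]; omega, ?_, fun r hr h h' => ?_, fun a ha => ?_,
        fun l' => ?_⟩
      · rw [h11'', h11']
        simp [clauseWord]; ring
      · rw [hs' r hr h h', hs r hr h]
      · rw [hfr' a ha, hfr a ha]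
      · rw [hl' l', hs 12 (by norm_num) (by norm_num), hm, List.count_cons]
        by_cases he : l = l'
        · subst he
          simp; ring
        · have : -((n : ℤ) + 1) + encodeLiteral l' ≠ -(n + 1) + encodeLiteral l := fun hh =>
            he (encodeLiteral_injective (by omega))
          rw [Function.update_of_ne this]
          simp [he]

/-- Read the clauses. -/
def clausesProg : Prog := seqs
  [mov 10 1, .const 12 1,
   .whilePos 10 (seqs [.const 13 1, .whilePos 13 litStep, dbl 12, .sub 10 10 5])]

/-- Reading clause i adds 2^i once per occurrence of a literal. Since a clause lists each literal
once, the sum is a binary digit without carry. -/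
theorem digit_lits (F : CNF m n) (l : Fin n × Bool) {i : ℕ} (hi : i < m) :
    digit (lits F l.1 l.2) i = (F.clause ⟨i, hi⟩).count l := by
  unfold digit
  by_cases h : l ∈ F.clause ⟨i, hi⟩
  · rw [List.count_eq_one_of_mem (F.nodup _) h, if_pos ⟨hi, by simpa using h⟩]
  · rw [List.count_eq_zero_of_not_mem h, if_neg]
    rintro ⟨hi', h'⟩
    exact h (by simpa using h')

theorem clause_length_le (F : CNF m n) (j : Fin m) : (F.clause j).length ≤ 2 * n := by
  have := (F.nodup j).length_le_card
  simpa [mul_comm] using this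

theorem wp_clauses {F : CNF m n} {s₀ : State} (hg : Glob m n s₀) (h11 : 0 ≤ s₀.reg 11)
    (hc : Holds s₀.mem (s₀.reg 11) (List.ofFn fun j => clauseWord (F.clause j)).flatten)
    (hz : ∀ a < 0, s₀.mem a = 0) :
    Wp clausesProg s₀ (fun t s' => t ≤ m * (30 * n + 21) + 10 ∧
      (∀ r < 15, r ≠ 10 → r ≠ 11 → r ≠ 12 → r ≠ 13 → s'.reg r = s₀.reg r) ∧
      (∀ a : ℤ, 0 ≤ a ∨ a < -(2 * n + 1) → s'.mem a = s₀.mem a) ∧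
      ∀ l : Fin n × Bool, s'.mem (-(n + 1) + encodeLiteral l) = code (lits F l.1 l.2)) := by
  simp only [clausesProg, wp_seqs_cons, wp_add, wp_const]
  refine (wp_while (fun i s =>
    s.reg 10 = m - i ∧ s.reg 12 = 2 ^ i ∧ 0 ≤ s.reg 11 ∧
    Holds s.mem (s.reg 11) ((List.ofFn fun j => clauseWord (F.clause j)).drop i).flatten ∧
    (∀ r < 15, r ≠ 10 → r ≠ 11 → r ≠ 12 → r ≠ 13 → s.reg r = s₀.reg r) ∧
    (∀ a : ℤ, 0 ≤ a ∨ a < -(2 * n + 1) → s.mem a = s₀.mem a) ∧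
    ∀ l : Fin n × Bool, s.mem (-(n + 1) + encodeLiteral l) = lowCode (lits F l.1 l.2) i)
    m (30 * n + 20) ?_ ?_ ?_ ?_).mono ?_
  · rintro i s hi ⟨h, -⟩
    rw [h]; omega
  · rintro s ⟨h, -⟩
    rw [h]; omega
  · rintro i s hi ⟨h10, h12, h11, hc, hs, hfr, hl⟩
    have hlen : i < (List.ofFn fun j => clauseWord (F.clause j)).length := by simpa using hi
    rw [List.drop_eq_getElem_cons hlen, List.flatten_cons, holds_append, List.getElem_ofFn] at hc
    have hg1 : Glob m n s :=
      hg.congr fun r hr => hs r (by omega) (by omega) (by omega) (by omega) (by omega)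
    simp only [wp_seqs_cons, wp_const]
    refine (wp_clause (m := m) (F.clause ⟨i, hi⟩) (hg1.congr (by simp [same_setReg])) (by simp)
      (by simpa using h11) (by simpa using hc.1)).mono ?_
    rintro t s₁ ⟨ht, h11', hs1, hfr1, hl1⟩
    have hle := clause_length_le F ⟨i, hi⟩
    simp only [wp_add, wp_sub, wp_seqs_nil]
    simp only [mem_setReg, reg_setReg] at hfr1 hl1 h11' hs1
    have hfr' : ∀ a : ℤ, 0 ≤ a ∨ a < -(2 * n + 1) → s₁.mem a = s₀.mem a := fun a ha => by
      rw [hfr1 a ha, hfr a ha]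
    have g5 : s₁.reg 5 = 1 := by
      rw [hs1 5 (by norm_num) (by norm_num) (by norm_num)]; simp [hg1.r5]
    have g10 : s₁.reg 10 = m - i := by
      rw [hs1 10 (by norm_num) (by norm_num) (by norm_num)]; simp [h10]
    have g12 : s₁.reg 12 = 2 ^ i := by
      rw [hs1 12 (by norm_num) (by norm_num) (by norm_num)]; simp [h12]
    simp only [Nat.reduceEqDiff, if_false] at h11' hl1
    refine ⟨by omega, by simp [g10, g5]; ring, by simp [g12]; ring, ?_, ?_, ?_, ?_, ?_⟩
    · simp [h11']; omega
    · simp only [mem_setReg, reg_setReg, Nat.reduceEqDiff, if_false, h11']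
      exact hc.2.congr (by omega) fun x hx => by rw [hfr1 x (Or.inl hx)]
    · intro r hr a1 a2 a3 a4
      simp only [reg_setReg]
      rw [if_neg a1, if_neg a3, hs1 r hr a2 a4, if_neg a4, hs r hr a1 a2 a3 a4]
    · simpa using hfr'
    · intro l
      simp only [mem_setReg]
      rw [hl1 l, hl l, h12, lowCode_succ, digit_lits F l hi]
      push_cast; ring
  · refine ⟨by simp [hg.r6, hg.r1], by simp, by simpa using h11, by simpa using hc,
      fun r hr a1 a2 a3 a4 => ?_, by simp, fun l => ?_⟩
    · simp [a1, a3]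
    · have := encodeLiteral_bound l
      simp only [mem_setReg]
      rw [hz _ (by omega)]
      simp [lowCode]
  · rintro t s' ⟨ht, -, -, -, -, hs, hfr, hl⟩
    simp only [wp_seqs_nil]
    rw [show 30 * n + 20 + 1 = 30 * n + 21 by rfl] at ht
    refine ⟨by omega, hs, hfr, fun l => ?_⟩
    rw [hl l, lowCode_self]

/-- Store the powers of two. -/
def powersProg : Prog := seqs
  [mov 10 2, .const 12 1, .sub 11 7 2, .sub 11 11 5,
   .whilePos 10 (seqs [.store 11 12, dbl 12, .sub 11 11 5, .sub 10 10 5])]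

/-- The powers are tabulated because doubling anew at each variable would cost about n² steps in
all, which the bound does not cover for small m and k. For clauses, up to m doublings per position
are affordable. -/
theorem wp_powers {s₀ : State} (hg : Glob m n s₀) :
    Wp powersProg s₀ (fun t s' => t ≤ n * 6 + 10 ∧
      (∀ r, r ≠ 10 → r ≠ 11 → r ≠ 12 → s'.reg r = s₀.reg r) ∧
      (∀ a : ℤ, -(2 * n + 1) ≤ a ∨ a ≤ -(3 * n + 2) → s'.mem a = s₀.mem a) ∧
      ∀ x : Fin n, s'.mem (-(n + 1) - n - (x + 1)) = 2 ^ (x : ℕ)) := by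
  simp only [powersProg, wp_seqs_cons, wp_add, wp_const, wp_sub]
  refine (wp_while (fun i s =>
    s.reg 10 = n - i ∧ s.reg 12 = 2 ^ i ∧ s.reg 11 = -(n + 1) - n - (i + 1) ∧
    (∀ r, r ≠ 10 → r ≠ 11 → r ≠ 12 → s.reg r = s₀.reg r) ∧
    (∀ a : ℤ, -(2 * n + 1) ≤ a ∨ a ≤ -(3 * n + 2) → s.mem a = s₀.mem a) ∧
    ∀ x : Fin n, (x : ℕ) < i → s.mem (-(n + 1) - n - (x + 1)) = 2 ^ (x : ℕ))
    n 5 ?_ ?_ ?_ ?_).mono ?_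
  · rintro i s hi ⟨h, -⟩
    rw [h]; omega
  · rintro s ⟨h, -⟩
    rw [h]; omega
  · rintro i s hi ⟨h10, h12, h11, hs, hfr, hp⟩
    simp only [wp_seqs_cons, wp_add, wp_sub, wp_store, wp_seqs_nil]
    have g5 : s.reg 5 = 1 := by rw [hs 5 (by norm_num) (by norm_num) (by norm_num), hg.r5]
    refine ⟨by omega, by simp [h10, g5]; ring, by simp [h12]; ring, by simp [h11, g5]; ring,
      ?_, ?_, ?_⟩
    · intro r a1 a2 a3
      simp [a1, a2, a3, hs]
    · intro a ha
      simp only [mem_setReg, mem_setMem]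
      rw [Function.update_of_ne (by omega), hfr a ha]
    · intro x hx
      simp only [mem_setReg, mem_setMem]
      by_cases hxi : (x : ℕ) = i
      · rw [h11, ← hxi, Function.update_self, h12, hxi]
      · rw [Function.update_of_ne (by omega), hp x (by omega)]
  · refine ⟨by simp [hg.r2, hg.r6], by simp, by simp [hg.r7, hg.r2, hg.r5], ?_, by simp,
      by simp⟩
    intro r a1 a2 a3
    simp [a1, a2, a3]
  · rintro t s' ⟨ht, -, -, -, hs, hfr, hp⟩
    simp only [wp_seqs_nil]
    exact ⟨by omega, hs, hfr, fun x => hp x x.2⟩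

end Input

end KInterval

namespace KInterval

/-! ### The dynamic program -/

section Core

variable {m n : ℕ}

/-- The input has been read. -/
structure Ready (F : CNF m n) (w : Fin m → ℤ) (π : Ordering m n) (s : State) : Prop where
  glob : Glob m n s
  r14 : s.reg 14 = 5 * (2 ^ m + 1)
  low : Low F w π s.mem
  fresh : ∀ z c, s.mem (loc m n z c) = 0

theorem loc_le (z c : ℕ) : loc m n z c ≤ -(3 * n + 2) := by
  have := cell_le (3 * n + 2) (2 ^ m + 1) z c
  unfold loc
  push_cast at this
  omega

/-- Read the input; `p` moves register `11` to the first clause. -/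
def inputProg (p : Prog) : Prog := seqs [headerProg, p, clausesProg, powersProg]

theorem wp_inputProg {F : CNF m n} {w : Fin m → ℤ} {π : Ordering m n} {off : ℕ} {p : Prog}
    {s₀ : State} (hr : ∀ r, s₀.reg r = 0) (hin : Input F w π off s₀.mem)
    (hp : ∀ s, Glob m n s → s.reg 11 = (m + n + 2 : ℕ) → Wp p s (fun t s' => t ≤ 1 ∧
      s'.mem = s.mem ∧ s'.reg 11 = off ∧ ∀ r < 15, r ≠ 11 → s'.reg r = s.reg r)) :
    Wp (inputProg p) s₀ (fun t s' => t ≤ 3 * m + m * (30 * n + 21) + n * 6 + 52 ∧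
      Ready F w π s') := by
  simp only [inputProg, wp_seqs_cons]
  refine (wp_header hr hin.numClauses hin.numVars).mono ?_
  rintro t₁ s₁ ⟨ht₁, hm₁, hg₁, h14, h11⟩
  refine (hp s₁ hg₁ h11).mono ?_
  rintro t₂ s₂ ⟨ht₂, hm₂, h11', hs₂⟩
  have hg₂ : Glob m n s₂ := hg₁.congr fun r hr => hs₂ r (by omega) (by omega)
  have hmem : s₂.mem = s₀.mem := hm₂.trans hm₁
  refine (wp_clauses (F := F) hg₂ (by omega) (by rw [h11', hmem]; exact hin.clauses)
    (by rw [hmem]; exact hin.zero)).mono ?_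
  rintro t₃ s₃ ⟨ht₃, hs₃, hf₃, hl₃⟩
  have hg₃ : Glob m n s₃ :=
    hg₂.congr fun r hr => hs₃ r (by omega) (by omega) (by omega) (by omega) (by omega)
  refine (wp_powers hg₃).mono ?_
  rintro t₄ s₄ ⟨ht₄, hs₄, hf₄, hp₄⟩
  simp only [wp_seqs_nil]
  refine ⟨by omega, hg₃.congr fun r hr => hs₄ r (by omega) (by omega) (by omega), ?_, ?_, ?_⟩
  · rw [hs₄ 14 (by norm_num) (by norm_num) (by norm_num), hs₃ 14 (by norm_num) (by norm_num)
      (by norm_num) (by norm_num) (by norm_num), hs₂ 14 (by norm_num) (by norm_num), h14]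
  · have hpos : ∀ a : ℤ, 0 ≤ a → s₄.mem a = s₀.mem a := fun a ha => by
      rw [hf₄ a (by omega), hf₃ a (by omega), hmem]
    refine ⟨fun l => ?_, hp₄, fun j => ?_, fun p => ?_⟩
    · have := encodeLiteral_bound l
      rw [hf₄ _ (by omega), hl₃]
    · rw [hpos _ (by omega), hin.weight]
    · rw [hpos _ (by omega), hin.order]
  · intro z c
    have := loc_le (m := m) (n := n) z c
    rw [hf₄ _ (by omega), hf₃ _ (by omega), hmem, hin.zero _ (by omega)]

theorem code_univ : (code (Finset.univ : Finset (Fin m)) : ℤ) = 2 ^ m - 1 := by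
  have : code (Finset.univ : Finset (Fin m)) = ∑ i ∈ Finset.range m, 2 ^ i :=
    Fin.sum_univ_eq_sum_range (fun i => 2 ^ i) m
  rw [this, Nat.geomSum_eq (le_refl 2)]
  push_cast [Nat.one_le_two_pow]
  simp

theorem loc_zero (z : ℕ) : loc m n z 0 = -(3 * n + 2) - (2 ^ m + 1) * z := by
  simp [loc, cell]; ring

/-- Prepare the computation of the families of the ordering. -/
def leftStart : Prog := seqs
  [.sub 18 7 2, .sub 18 18 2, .sub 18 18 5, .sub 10 9 5, .const 11 2, .const 12 1, .sub 28 3 5]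

theorem wp_leftStart {π : Ordering m n} {s : State} (hg : Glob m n s)
    (h14 : s.reg 14 = 5 * (2 ^ m + 1)) :
    Wp leftStart s (fun t s' => t ≤ 10 ∧ s'.mem = s.mem ∧ ListRegs n π 0 2 1 0 s') := by
  simp only [leftStart, wp_seqs_cons, wp_sub, wp_const, wp_seqs_nil]
  refine ⟨by omega, by simp, hg.congr (by simp [same_setReg]), ?_, ?_, ?_, ?_, ?_, ?_⟩
  · simp [hg.r9, hg.r5]
  · simp
  · simp
  · simp [h14]
  · simp [hg.r7, hg.r2, hg.r5, loc_zero]; ring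
  · simp [hg.r3, hg.r5, rem_zero, code_univ]

/-- Prepare the computation of the families of the reversed ordering. -/
def rightStart : Prog := seqs
  [.sub 18 7 2, .sub 18 18 2, .sub 18 18 5, .sub 18 18 8, .sub 10 9 5, mov 11 9, .const 12 (-1),
   .sub 28 3 5]

theorem wp_rightStart {σ : Ordering m n} {s : State} (hg : Glob m n s)
    (h14 : s.reg 14 = 5 * (2 ^ m + 1)) :
    Wp rightStart s (fun t s' => t ≤ 10 ∧ s'.mem = s.mem ∧
      ListRegs n σ 1 (m + n + 1) (-1) 0 s') := by
  simp only [rightStart, wp_seqs_cons, wp_sub, wp_add, wp_const, wp_seqs_nil]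
  refine ⟨by omega, by simp, hg.congr (by simp [same_setReg]), ?_, ?_, ?_, ?_, ?_, ?_⟩
  · simp [hg.r9, hg.r5]
  · simp [hg.r9, hg.r6]
  · simp
  · simp [h14]
  · simp [hg.r7, hg.r2, hg.r5, hg.r8, loc_zero]; ring
  · simp [hg.r3, hg.r5, rem_zero, code_univ]

/-- Prepare the computation of the tables. -/
def tabStart : Prog := seqs
  [.add 16 18 14, .sub 13 7 2, .sub 13 13 2, .sub 13 13 5, mov 15 13, .sub 13 13 8, .sub 13 13 8,
   .store 13 5, .sub 20 13 8, .sub 20 20 8, .store 20 5, .sub 10 9 5, .const 11 2, .sub 28 3 5]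

theorem wp_tabStart {F : CNF m n} {w : Fin m → ℤ} {π : Ordering m n} {s : State}
    (hg : Glob m n s) (h14 : s.reg 14 = 5 * (2 ^ m + 1))
    (h18 : s.reg 18 = loc m n (1 + 5 * (m + n)) 0)
    (hf : ∀ z c, 2 ≤ z % 5 → c < 2 ^ m + 1 → s.mem (loc m n z c) = 0) :
    Wp tabStart s (fun t s' => t ≤ 20 ∧ TabRegs n π 0 s' ∧ TabMem F π w s.mem 0 s'.mem) := by
  have hW : 0 < 2 ^ m + 1 := Nat.succ_pos _
  have h13 : (s.reg 7 - s.reg 2 - s.reg 2 - s.reg 5 - s.reg 8 - s.reg 8) = loc m n 2 0 := by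
    rw [hg.r7, hg.r2, hg.r5, hg.r8, loc_zero]; push_cast; ring
  have h20 : loc m n 2 0 - s.reg 8 - s.reg 8 = loc m n 4 0 := by
    rw [hg.r8, loc_zero, loc_zero]; push_cast; ring
  simp only [tabStart, wp_seqs_cons, wp_sub, wp_add, wp_const, wp_store, wp_seqs_nil]
  refine ⟨by omega, ⟨hg.congr (by simp [same_setReg]), ?_, ?_, ?_, ?_, ?_, ?_, ?_⟩, ?_⟩
  · simp [hg.r9, hg.r5]
  · simp
  · simp [h13]
  · simp [h14]
  · simp [hg.r7, hg.r2, hg.r5, hg.r6, loc_zero]; ring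
  · simp [h18, h14, loc_zero]; ring
  · simp [hg.r3, hg.r5, rem_zero, code_univ]
  · simp only [mem_setReg, mem_setMem, reg_setReg, reg_setMem, Nat.reduceEqDiff, if_true, if_false,
      hg.r5, hg.r6, add_zero]
    have e1 : (-(n + 1) - s.reg 2 - s.reg 2 - 1 - s.reg 8 - s.reg 8) = loc m n 2 0 := by
      rw [← h13, hg.r7, hg.r5]
    simp only [hg.r7, e1, h20]
    constructor
    · intro U _
      have hU := code_lt U
      have c2 : code U < 2 ^ m + 1 := by omega
      rw [rem_zero, Finset.compl_univ, Finset.inter_empty, Finset.inter_univ]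
      unfold Entry
      simp only [mul_zero, zero_add]
      rw [Function.update_of_ne (loc_row_ne (show 2 ≠ 4 by norm_num) c2 hW),
        Function.update_of_ne (loc_row_ne (show 3 ≠ 4 by norm_num) c2 hW),
        Function.update_of_ne (loc_row_ne (show 3 ≠ 2 by norm_num) c2 hW), hf 3 _ (by norm_num) c2]
      -- At the first cut the only left set is ∅, with one normalized assignment. Its entry is count
      -- 1, weight 0 (never written) and code 1; every other block is empty.
      by_cases h : U = ∅
      · subst h
        rw [code_empty, Function.update_self, Function.update_self]
        exact Rep.first F w
      · have hc : code U ≠ 0 := (code_pos.2 (Finset.nonempty_iff_ne_empty.2 h)).ne'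
        rw [Function.update_of_ne fun he => hc (loc_inj c2 hW he).2, hf 2 _ (by norm_num) c2,
          Function.update_of_ne fun he => hc (loc_inj c2 hW he).2,
          Function.update_of_ne (loc_row_ne (by norm_num) c2 hW), hf 4 _ (by norm_num) c2]
        have hb : block F π 0 U = ∅ := by
          ext τ
          simp [block, lset_zero, Ne.symm h]
        rw [hb]
        exact Rep.zero F w _ _ _
    · intro j hj c hc
      refine ⟨?_, ?_, ?_⟩ <;>
      · rw [Function.update_of_ne (loc_row_ne (by omega) hc hW),
          Function.update_of_ne (loc_row_ne (by omega) hc hW), hf _ _ (by omega) hc]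
    · intro a ha
      rw [Function.update_of_ne (ha 0 0 hW).2.2, Function.update_of_ne (ha 0 0 hW).1]

/-- The dynamic program on an input that has been read. -/
def coreProg : Prog := seqs [leftStart, listPhase, rightStart, listPhase, tabStart, tabPhase]

theorem wp_coreProg {F : CNF m n} {w : Fin m → ℤ} {π : Ordering m n} {K : ℕ} {s₀ : State}
    (h : Ready F w π s₀) (hK : 1 ≤ K) (hcard : ∀ i, (fam F π i).card ≤ K)
    (hcard' : ∀ i, (fam F (rev π) i).card ≤ K) :
    Wp coreProg s₀ (fun t s' =>
      t ≤ (m + n) * (600 * (K * (m + 1)) + 620 * (K * K * (m + 1)) + 3) + 100 ∧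
      Glob m n s' ∧ s'.mem (s'.reg 13) = F.numSat ∧
      ∃ τ, s'.mem (s'.reg 13 - s'.reg 8 - s'.reg 8) = enc τ ∧
        s'.mem (s'.reg 13 - s'.reg 8) = F.satWeight w τ ∧
        ∀ τ', F.satWeight w τ' ≤ F.satWeight w τ) := by
  obtain ⟨hg, h14, hlow, hfresh⟩ := h
  have hW : 0 < 2 ^ m + 1 := Nat.succ_pos _
  simp only [coreProg, wp_seqs_cons]
  refine (wp_leftStart (π := π) hg h14).mono ?_
  rintro t₁ s₁ ⟨ht₁, hm₁, hr₁⟩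
  refine (wp_listPhase (F := F) (w := w) (π := π) (by rw [hm₁]; exact hlow) ?_ hK hcard hr₁
    (fun _ _ _ => by rw [hm₁, hfresh])).mono ?_
  · intro i hi
    refine ⟨by push_cast; omega, ?_⟩
    rw [hm₁, ← hlow.order]
    simp
  rintro t₂ s₂ ⟨ht₂, hr₂, hi₂⟩
  rw [hm₁] at hi₂
  have hlow₂ := hlow.congr hi₂.sameLow
  refine (wp_rightStart (σ := rev π) hr₂.glob hr₂.r14).mono ?_
  rintro t₃ s₃ ⟨ht₃, hm₃, hr₃⟩
  have hf₃ : ∀ z c, z % 5 ≠ 0 → c < 2 ^ m + 1 → s₃.mem (loc m n z c) = 0 := by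
    intro z c hz hc
    rw [hm₃, hi₂.frame _ fun _ _ hc' => loc_row_ne (by omega) hc hc', hfresh]
  refine (wp_listPhase (F := F) (w := w) (π := π) (by rw [hm₃]; exact hlow₂) ?_ hK hcard' hr₃
    (fun _ _ hc => hf₃ _ _ (by omega) hc)).mono ?_
  · intro i hi
    refine ⟨by push_cast; omega, ?_⟩
    rw [hm₃, rev_symm, ← hlow₂.order, Fin.val_rev]
    congr 1
    push_cast [show i + 1 ≤ m + n from hi]
    ring
  rintro t₄ s₄ ⟨ht₄, hr₄, hi₄⟩
  have hlow₄ : Low F w π s₄.mem := (hm₃ ▸ hlow₂ : Low F w π s₃.mem).congr hi₄.sameLow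
  have hf₄ : ∀ z c, 2 ≤ z % 5 → c < 2 ^ m + 1 → s₄.mem (loc m n z c) = 0 := by
    intro z c hz hc
    rw [hi₄.frame _ fun _ _ hc' => loc_row_ne (by omega) hc hc', hf₃ z c (by omega) hc]
  refine (wp_tabStart (F := F) (w := w) (π := π) hr₄.glob hr₄.r14 hr₄.r18 hf₄).mono ?_
  rintro t₅ s₅ ⟨ht₅, hr₅, hi₅⟩
  refine (wp_tabPhase (K := K) hlow₄ (fun p hp => ?_) (fun p hp => hi₄.done p hp) hK hcard hcard'
    hr₅ hi₅).mono ?_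
  · obtain ⟨l, hl, hmem⟩ := hi₂.done p hp
    simp only [zero_add] at hl
    refine ⟨l, hl.congr fun c hc => ?_, hmem⟩
    rw [hi₄.frame _ fun _ _ hc' => loc_row_ne (by omega) hc hc', hm₃]
  rintro t₆ s₆ ⟨ht₆, hr₆, hi₆⟩
  simp only [wp_seqs_nil]
  -- At the last cut the reversed ordering is at position 0, where its family is {∅}, so the entry
  -- of ∅ is guaranteed.
  have hrep := hi₆.ok ∅ (by simp [fam_zero])
  rw [rem_last, Finset.empty_inter, Finset.empty_inter] at hrep
  unfold Entry at hrep
  have e8 : ∀ z, loc m n z 0 - s₆.reg 8 = loc m n (z + 1) 0 := fun z => by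
    rw [hr₆.glob.r8, loc_zero, loc_zero]; push_cast; ring
  rw [hr₆.r13, e8, e8]
  obtain ⟨h1, τ, h2, h3, h4⟩ := Rep.last F w hrep
  refine ⟨?_, hr₆.glob, h1, τ, h2, h3, h4⟩
  rw [show (m + n) * (600 * (K * (m + 1)) + 620 * (K * K * (m + 1)) + 3) =
    (m + n) * (300 * (K * (m + 1)) + 1) + (m + n) * (300 * (K * (m + 1)) + 1) +
      (m + n) * (620 * (K * K * (m + 1)) + 1) by ring]
  omega

/-- Report the best assignment and its weight. -/
def outputProg : Prog := seqs
  [.sub 20 13 8, .load 0 20, .sub 20 20 8, .load 21 20, .sub 21 21 5, mov 100 2, powProg,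
   mov 10 2,
   .whilePos 10 (seqs
    [.sub 10 10 5, dbl 21, .sub 23 21 101, .add 23 23 5,
     .ifPos 23 (.seq (.sub 21 21 101) (.store 10 5)) (.store 10 6)])]

/-- The digits of the code, after removal of its offset 1, are read from the top by doubling and
comparing with 2^n, and written to the cells n - 1 down to 0. These overwrite input that is no
longer needed. -/
theorem wp_outputProg {F : CNF m n} {w : Fin m → ℤ} {s : State} {τ : Fin n → Bool}
    (hg : Glob m n s) (hτ : s.mem (s.reg 13 - s.reg 8 - s.reg 8) = enc τ)
    (hv : s.mem (s.reg 13 - s.reg 8) = F.satWeight w τ) :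
    Wp outputProg s (fun t s' => t ≤ 14 * n + 20 ∧ s'.reg 0 = F.satWeight w τ ∧
      ∀ i : Fin n, s'.mem (i : ℤ) = if τ i then 1 else 0) := by
  set A : Finset (Fin n) := Finset.univ.filter fun x => τ x = true with hA
  have hdig : ∀ i : Fin n, (digit A i : ℤ) = if τ i then 1 else 0 := by
    intro i
    simp [digit, hA]
  have henc : (enc τ : ℤ) - 1 = code A := by simp [enc, hA]
  simp only [outputProg, wp_seqs_cons, wp_sub, wp_load, wp_add]
  refine (wp_pow n (by simp [hg.r5]) (by simp [hg.r2, hg.r6])).mono ?_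
  rintro t₁ s₁ ⟨ht₁, hm₁, hs₁, h101⟩
  have k0 : s₁.reg 0 = F.satWeight w τ := by rw [hs₁ 0 (by norm_num)]; simp [hv]
  have k2 : s₁.reg 2 = n := by rw [hs₁ 2 (by norm_num)]; simp [hg.r2]
  have k5 : s₁.reg 5 = 1 := by rw [hs₁ 5 (by norm_num)]; simp [hg.r5]
  have k6 : s₁.reg 6 = 0 := by rw [hs₁ 6 (by norm_num)]; simp [hg.r6]
  have k21 : s₁.reg 21 = code A := by rw [hs₁ 21 (by norm_num)]; simp [hg.r5, hτ, ← henc]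
  refine (wp_while (fun i s => s.reg 10 = n - i ∧ s.reg 0 = F.satWeight w τ ∧ s.reg 5 = 1 ∧
    s.reg 6 = 0 ∧ s.reg 101 = 2 ^ n ∧ s.reg 21 = lowCode A (n - i) * 2 ^ i ∧
    ∀ x : Fin n, n ≤ x + i → s.mem (x : ℤ) = digit A x) n 9 ?_ ?_ ?_ ?_).mono ?_
  · rintro i s hi ⟨h, -⟩
    rw [h]; omega
  · rintro s ⟨h, -⟩
    rw [h]; omega
  · rintro i s hi ⟨g10, g0, g5, g6, g101, g21, gm⟩
    obtain ⟨r, hr⟩ : ∃ r, n - i = r + 1 := ⟨n - i - 1, by omega⟩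
    have hr' : n - (i + 1) = r := by omega
    have hn : n = r + (i + 1) := by omega
    have hp : (2 : ℤ) ^ n = 2 ^ r * 2 ^ (i + 1) := by rw [← pow_add, ← hn]
    have a1 : (lowCode A (r + 1) * 2 ^ i + lowCode A (r + 1) * 2 ^ i : ℤ)
        = lowCode A r * 2 ^ (i + 1) + digit A r * 2 ^ n := by
      rw [lowCode_succ, hp]; push_cast; ring
    have a2 : 0 ≤ (lowCode A r * 2 ^ (i + 1) : ℤ) := by positivity
    have a3 : (lowCode A r * 2 ^ (i + 1) : ℤ) < 2 ^ n := by
      rw [hp]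
      exact mul_lt_mul_of_pos_right (by exact_mod_cast lowCode_lt A r) (by positivity)
    have a4 : (n : ℤ) - i - 1 = r := by omega
    have hst : ∀ v : ℤ, v = digit A r → ∀ x : Fin n, n ≤ x + (i + 1) →
        Function.update s.mem (r : ℤ) v (x : ℤ) = digit A x := by
      intro v hv x hx
      by_cases hxr : (x : ℕ) = r
      · rw [hxr, Function.update_self, hv]
      · rw [Function.update_of_ne (by omega), gm x (by omega)]
    rw [hr] at g21
    simp only [wp_seqs_cons, wp_add, wp_sub, wp_ifPos, wp_seq, wp_store, wp_seqs_nil, reg_setReg,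
      mem_setReg, mem_setMem, reg_setMem, Nat.reduceEqDiff, if_true, if_false, g10, g5, g21, a1,
      g101, g0, g6, hr', a4, OfNat.zero_ne_ofNat]
    rcases digit_eq A r with hd | hd <;>
      simp only [hd, Nat.cast_zero, Nat.cast_one, zero_mul, one_mul, add_zero] at hst ⊢
    · rw [if_neg (by omega)]
      exact ⟨by omega, by push_cast; omega, trivial, trivial, trivial, trivial, trivial,
        hst _ rfl⟩
    · rw [if_pos (by omega)]
      exact ⟨by omega, by push_cast; omega, trivial, trivial, trivial, trivial, by ring,
        hst _ rfl⟩
  · refine ⟨by simp [k2, k6], by simp [k0], by simp [k5], by simp [k6], by simp [h101],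
      by simp [k21, lowCode_self], fun x hx => absurd x.2 (by omega)⟩
  · rintro t s' ⟨ht, -, h0, -, -, -, -, hm⟩
    simp only [wp_seqs_nil]
    refine ⟨by omega, h0, fun i => ?_⟩
    rw [hm i (by omega), hdig]

/-- With K = 2 * (m * 2 ^ k), the dominating term is a multiple of K²(m + 1)(m + n). Since m + 1 ≤
2m, this is at most 8 times m³4^k(m + n). Reading the input costs O(mn + m + n), which is smaller.
The constant 20000 is generous. -/
theorem time_le {m : ℕ} (n k : ℕ) (hm : 1 ≤ m) :
    3 * m + m * (30 * n + 21) + n * 6 + 52 +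
      ((m + n) * (600 * (2 * (m * 2 ^ k) * (m + 1)) +
        620 * (2 * (m * 2 ^ k) * (2 * (m * 2 ^ k)) * (m + 1)) + 3) + 100) + (14 * n + 20) + 10 ≤
      20000 * (m ^ 3 * 4 ^ k * (m + n)) := by
  have h4 : (4 : ℕ) ^ k = 2 ^ k * 2 ^ k := by rw [← mul_pow]; norm_num
  have hq : 1 ≤ 2 ^ k := Nat.one_le_two_pow
  rw [h4]
  generalize 2 ^ k = q at *
  set B := m ^ 3 * (q * q) * (m + n) with hB
  have hN : 1 ≤ m + n := by omega
  have hD : m ≤ m ^ 3 * (q * q) := by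
    calc m = m ^ 1 * (1 * 1) := by ring
      _ ≤ m ^ 3 * (q * q) :=
        Nat.mul_le_mul (Nat.pow_le_pow_right hm (by norm_num)) (Nat.mul_le_mul hq hq)
  have h1 : m * (m + n) ≤ B := Nat.mul_le_mul_right _ hD
  have h2 : m + n ≤ m * (m + n) := Nat.le_mul_of_pos_left _ hm
  have h3 : m * n ≤ m * (m + n) := Nat.mul_le_mul_left _ (by omega)
  have h5 : m * q * (m * q) * (m + 1) * (m + n) ≤ 2 * B := by
    calc m * q * (m * q) * (m + 1) * (m + n) ≤ m * q * (m * q) * (m + m) * (m + n) := by gcongr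
      _ = 2 * B := by rw [hB]; ring
  have h6 : m * q * (m + 1) * (m + n) ≤ m * q * (m * q) * (m + 1) * (m + n) :=
    Nat.mul_le_mul_right _ (Nat.mul_le_mul_right _
      (Nat.le_mul_of_pos_left _ (Nat.mul_pos hm hq)))
  have e : (m + n) * (600 * (2 * (m * q) * (m + 1)) +
      620 * (2 * (m * q) * (2 * (m * q)) * (m + 1)) + 3) =
      1200 * (m * q * (m + 1) * (m + n)) + 2480 * (m * q * (m * q) * (m + 1) * (m + n)) +
      3 * (m + n) := by ring
  have e' : m * (30 * n + 21) = 30 * (m * n) + 21 * m := by ring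
  rw [e, e']
  omega

/-- The program for the number of satisfying assignments. -/
def countProg : Prog := seqs [inputProg .skip, coreProg, .load 0 13]

/-- The program for an assignment of maximum weight. -/
def maxProg : Prog := seqs [inputProg (.add 11 11 1), coreProg, outputProg]

/-- For m ≥ 1 the summand 1 in the bound on the families is absorbed by doubling m * 2 ^ k. -/
theorem card_le_of_isKIntervalOrdering {F : CNF m n} {π : Ordering m n} {k : ℕ} (hm : 1 ≤ m)
    (h : IsKIntervalOrdering k F π) : 1 ≤ 2 * (m * 2 ^ k) ∧
      (∀ i, (fam F π i).card ≤ 2 * (m * 2 ^ k)) ∧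
      ∀ i, (fam F (rev π) i).card ≤ 2 * (m * 2 ^ k) := by
  have h1 : 0 < m * 2 ^ k := Nat.mul_pos hm (Nat.two_pow_pos k)
  exact ⟨by omega, fun i => (card_fam_le h i).trans (by omega),
    fun i => (card_fam_rev_le h i).trans (by omega)⟩

theorem wp_countProg {F : CNF m n} {π : Ordering m n} {k : ℕ} (hm : 1 ≤ m)
    (h : IsKIntervalOrdering k F π) :
    Wp countProg (initState (encode F π)) (fun t s =>
      t ≤ 20000 * (m ^ 3 * 4 ^ k * (m + n)) ∧ OutputsCount F s) := by
  obtain ⟨w, hin⟩ := input_encode F π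
  obtain ⟨hK, hc, hc'⟩ := card_le_of_isKIntervalOrdering hm h
  have ht := time_le n k hm
  simp only [countProg, wp_seqs_cons]
  refine (wp_inputProg (fun _ => rfl) hin fun s hg h11 => by simpa using h11).mono ?_
  rintro t₁ s₁ ⟨ht₁, hr⟩
  refine (wp_coreProg hr hK hc hc').mono ?_
  rintro t₂ s₂ ⟨ht₂, -, hcnt, -⟩
  simp only [wp_load, wp_seqs_nil]
  exact ⟨by omega, by simpa [OutputsCount] using hcnt⟩

theorem wp_maxProg {F : CNF m n} {π : Ordering m n} (w : Fin m → ℤ) {k : ℕ} (hm : 1 ≤ m)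
    (h : IsKIntervalOrdering k F π) :
    Wp maxProg (initState (encodeWeighted F π w)) (fun t s =>
      t ≤ 20000 * (m ^ 3 * 4 ^ k * (m + n)) ∧ OutputsMax F w s) := by
  obtain ⟨hK, hc, hc'⟩ := card_le_of_isKIntervalOrdering hm h
  have ht := time_le n k hm
  simp only [maxProg, wp_seqs_cons]
  refine (wp_inputProg (fun _ => rfl) (input_encodeWeighted F π w) fun s hg h11 => ?_).mono ?_
  · simp only [wp_add]
    exact ⟨le_rfl, rfl, by simp [h11, hg.r1], fun r _ hr => by simp [hr]⟩
  rintro t₁ s₁ ⟨ht₁, hr⟩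
  refine (wp_coreProg hr hK hc hc').mono ?_
  rintro t₂ s₂ ⟨ht₂, hg, -, τ, hτ, hv, hmax⟩
  refine (wp_outputProg hg hτ hv).mono ?_
  rintro t₃ s₃ ⟨ht₃, h0, hmem⟩
  simp only [wp_seqs_nil]
  exact ⟨by omega, τ, hmem, h0, hmax⟩

end Core

end KInterval

theorem theorem3 :
    (∃ (P : KInterval.Prog) (c : ℕ),
      ∀ (m n k : ℕ), 1 ≤ m →
      ∀ (F : KInterval.CNF m n) (π : KInterval.Ordering m n),
        KInterval.IsKIntervalOrdering k F π →
        ∃ (t : ℕ) (s : KInterval.State),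
          KInterval.Run P (KInterval.initState (KInterval.encode F π)) t s ∧
          t ≤ c * (m ^ 3 * 4 ^ k * (m + n)) ∧
          KInterval.OutputsCount F s) ∧
    (∃ (P : KInterval.Prog) (c : ℕ),
      ∀ (m n k : ℕ), 1 ≤ m →
      ∀ (F : KInterval.CNF m n) (π : KInterval.Ordering m n) (w : Fin m → ℤ),
        KInterval.IsKIntervalOrdering k F π →
        ∃ (t : ℕ) (s : KInterval.State),
          KInterval.Run P (KInterval.initState (KInterval.encodeWeighted F π w)) t s ∧
          t ≤ c * (m ^ 3 * 4 ^ k * (m + n)) ∧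
          KInterval.OutputsMax F w s) := by
  constructor
  · refine ⟨KInterval.countProg, 20000, fun m n k hm F π h => ?_⟩
    exact KInterval.wp_countProg hm h
  · refine ⟨KInterval.maxProg, 20000, fun m n k hm F π w h => ?_⟩
    exact KInterval.wp_maxProg w hm h
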